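/- For a bi-infinite sequence $\theta=(\theta_i)_{i\in\mathbb Z}$ of positive integers put $\lambda_i(\theta)=[\theta_i;\theta_{i+1},\theta_{i+2},\dots]+[0;\theta_{i-1},\theta_{i-2},\dots]$ (sum of two continued fractions) and let $m(\theta)=\sup_{i\in\mathbb Z}\lambda_i(\theta)$ be its Markov value. Let $M=\{m(\theta): m(\theta)<\infty\}$ be the Markov spectrum, and let $L\subset\mathbb R$, the Lagrange spectrum, be the closure of the set of Markov values of periodic sequences. Write $2_n$ for the string $2,\dots,2$ of length $n$. For an integer $k\ge 1$ let $$\omega_k = 2_{2k-1},1,2_{2k},1,2_{2k+1},1,$$ let $\theta(\omega_k)=\dots\omega_k\omega_k\omega_k\dots$ be the periodic bi-infinite sequence obtained by repeating $\omega_k$, and let $$\gamma_k^1=\overline{2_{2k-1},1,2_{2k},1,2_{2k+1},1}\;2^*\,2_{2k-2},1,2_{2k},1,2_{2k+1},1,2_{2k-1},1,2_{2k},1,2_{2k-1},1,1,\overline{2}$$ be the bi-infinite sequence which is $\omega_k$ repeated infinitely often to the left of position $0$ (marked by $*$), followed from position $0$ on by the displayed finite string and then by $2$ forever. Theorem. (a)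 $m(\theta(\omega_k))<m(\gamma_k^1)<m(\theta(\omega_{k-1}))$ for all $k\ge 3$. (b) $\lim_{k\to\infty}m(\theta(\omega_k))=1+\frac{3}{\sqrt2}$; thus $1+\frac{3}{\sqrt2}\in L$. (c) $m(\gamma_k^1)\in M\setminus L$ for all $k\ge 4$. In particular, $1+\frac{3}{\sqrt2}\in L\cap\overline{(M\setminus L)}$, and $M\setminus L$ is not a closed subset of $\mathbb R$. -/

import Mathlib

open Filter Topology

namespace MarkovLagrange

noncomputable section

/-- The finite continued fraction `[a 0; a 1, …, a n]`. -/
def cfConv : ℕ → (ℕ → ℕ+) → ℝ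
  | 0, a => ((a 0 : ℕ) : ℝ)
  | n + 1, a => ((a 0 : ℕ) : ℝ) + 1 / cfConv n (fun i => a (i + 1))

/-- The infinite continued fraction `[a 0; a 1, a 2, …]`, the limit of its convergents (which
always exists, see `tendsto_cfConv`). -/
def cfValue (a : ℕ → ℕ+) : ℝ :=
  limUnder atTop (fun n => cfConv n a)

lemma one_le_cfConv (n : ℕ) (a : ℕ → ℕ+) : 1 ≤ cfConv n a := by
  induction n generalizing a with
  | zero =>
    have h1 : (1 : ℝ) ≤ ((a 0 : ℕ) : ℝ) := by exact_mod_cast (a 0).pos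
    exact h1
  | succ n ih =>
    have h1 : (1 : ℝ) ≤ ((a 0 : ℕ) : ℝ) := by exact_mod_cast (a 0).pos
    have h2 : 0 ≤ 1 / cfConv n (fun i => a (i + 1)) :=
      div_nonneg zero_le_one (zero_le_one.trans (ih _))
    simp only [cfConv]
    linarith

lemma cfConv_mem (n : ℕ) (a : ℕ → ℕ+) :
    ((a 0 : ℕ) : ℝ) ≤ cfConv n a ∧ cfConv n a ≤ ((a 0 : ℕ) : ℝ) + 1 := by
  cases n with
  | zero => simp [cfConv]
  | succ n =>
    have h := one_le_cfConv n (fun i => a (i + 1))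
    have h1 : 1 / cfConv n (fun i => a (i + 1)) ≤ 1 := by
      rw [div_le_one (by linarith)]; exact h
    have h2 : 0 ≤ 1 / cfConv n (fun i => a (i + 1)) := by positivity
    simp only [cfConv]
    constructor <;> linarith

lemma abs_cfConv_sub_le (m : ℕ) : ∀ (n : ℕ) (a : ℕ → ℕ+),
    |cfConv (n + m) a - cfConv n a| ≤ 2 * (1 / 2 : ℝ) ^ n
  | 0, a => by
    rw [Nat.zero_add, pow_zero]
    have h1 := cfConv_mem m a
    have h2 := cfConv_mem 0 a
    rw [abs_le]; constructor <;> linarith [h1.1, h1.2, h2.1, h2.2]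
  | 1, a => by
    have h1 := cfConv_mem (1 + m) a
    have h2 := cfConv_mem 1 a
    rw [abs_le]; constructor <;> norm_num <;> linarith [h1.1, h1.2, h2.1, h2.2]
  | n + 2, a => by
    have ih := abs_cfConv_sub_le m n (fun i => a (i + 1 + 1))
    have e : n + 2 + m = (n + m) + 2 := by omega
    rw [e]
    simp only [cfConv]
    set x := cfConv (n + m) (fun i => a (i + 1 + 1)) with hx
    set y := cfConv n (fun i => a (i + 1 + 1)) with hy
    have hx1 : 1 ≤ x := one_le_cfConv _ _
    have hy1 : 1 ≤ y := one_le_cfConv _ _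
    have hb : (1 : ℝ) ≤ ((a (0 + 1) : ℕ) : ℝ) := by exact_mod_cast (a (0 + 1)).pos
    set b : ℝ := ((a (0 + 1) : ℕ) : ℝ)
    have hbx : 2 ≤ b * x + 1 := by nlinarith
    have hby : 2 ≤ b * y + 1 := by nlinarith
    have key : ((a 0 : ℕ) : ℝ) + 1 / (b + 1 / x) - (((a 0 : ℕ) : ℝ) + 1 / (b + 1 / y))
        = (x - y) / ((b * x + 1) * (b * y + 1)) := by
      have hx0 : x ≠ 0 := by linarith
      have hy0 : y ≠ 0 := by linarith
      have e1 : b + 1 / x = (b * x + 1) / x := by field_simp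
      have e2 : b + 1 / y = (b * y + 1) / y := by field_simp
      have hbx0 : b * x + 1 ≠ 0 := by linarith
      have hby0 : b * y + 1 ≠ 0 := by linarith
      rw [e1, e2]
      field_simp
      ring
    rw [key, abs_div, abs_of_pos (a := (b * x + 1) * (b * y + 1)) (by positivity),
      div_le_iff₀ (by positivity)]
    have h4 : (4 : ℝ) ≤ (b * x + 1) * (b * y + 1) := by nlinarith
    have hp : (0 : ℝ) ≤ 2 * (1 / 2 : ℝ) ^ (n + 2) := by positivity
    calc |x - y| ≤ 2 * (1 / 2 : ℝ) ^ n := ih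
      _ = 2 * (1 / 2 : ℝ) ^ (n + 2) * 4 := by ring
      _ ≤ _ := mul_le_mul_of_nonneg_left h4 hp

/-- The convergents of every continued fraction converge to its value. -/
lemma tendsto_cfConv (a : ℕ → ℕ+) :
    Tendsto (fun n => cfConv n a) atTop (𝓝 (cfValue a)) := by
  have hc : CauchySeq (fun n => cfConv n a) := by
    refine cauchySeq_of_le_geometric (1 / 2) 2 (by norm_num) (fun n => ?_)
    rw [dist_comm, Real.dist_eq]
    exact abs_cfConv_sub_le 1 n a
  exact hc.tendsto_limUnder

/-- `λ_i(θ) = [θ_i; θ_{i+1}, θ_{i+2}, …] + [0; θ_{i-1}, θ_{i-2}, …]`. -/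
def lam (θ : ℤ → ℕ+) (i : ℤ) : ℝ :=
  cfValue (fun n => θ (i + n)) + 1 / cfValue (fun n => θ (i - 1 - n))

/-- The Markov value `m(θ) = sup_i λ_i(θ)`; meaningful when the supremum is finite. -/
def markovValue (θ : ℤ → ℕ+) : ℝ :=
  ⨆ i : ℤ, lam θ i

/-- The Markov spectrum: all finite Markov values. -/
def markovSpectrum : Set ℝ :=
  {x | ∃ θ : ℤ → ℕ+, BddAbove (Set.range (lam θ)) ∧ markovValue θ = x}

/-- The Lagrange spectrum: the closure of the set of Markov values of periodic words. -/
def lagrangeSpectrum : Set ℝ :=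
  closure {x | ∃ θ : ℤ → ℕ+, (∃ p : ℤ, 0 < p ∧ Function.Periodic θ p) ∧ markovValue θ = x}

/-- The string `2_n = 2 2 … 2` (`n` times). -/
def twos (n : ℕ) : List ℕ+ := List.replicate n 2

/-- The string `ω_k = 2_{2k-1} 1 2_{2k} 1 2_{2k+1} 1` (for `k ≥ 1`). -/
def omega (k : ℕ) : List ℕ+ :=
  twos (2 * k - 1) ++ [1] ++ twos (2 * k) ++ [1] ++ twos (2 * k + 1) ++ [1]

/-- The periodic bi-infinite word `… u u u …` for a nonempty string `u`, a copy of `u` starting at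
position `0` (the default value `1` is used only for empty `u`). -/
def periodicWord (u : List ℕ+) : ℤ → ℕ+ :=
  fun i => u.getD (i % (u.length : ℤ)).toNat 1

/-- The bi-infinite word `… u u u w v v v …`, where `w` starts at position `0`. -/
def biPeriodicWord (u w v : List ℕ+) : ℤ → ℕ+ :=
  fun i =>
    if i < 0 then periodicWord u i
    else if i < (w.length : ℤ) then w.getD i.toNat 1
    else periodicWord v (i - (w.length : ℤ))

/-- The periodic word `θ(ω_k)`. -/
def thetaOmega (k : ℕ) : ℤ → ℕ+ := periodicWord (omega k)

/-- The word `γ_k^1`: the string `ω_k` repeated to the left, then, from position `0` on,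
`2 2_{2k-2} 1 2_{2k} 1 2_{2k+1} 1 2_{2k-1} 1 2_{2k} 1 2_{2k-1} 1 1`, followed by `2` forever. -/
def gammaOne (k : ℕ) : ℤ → ℕ+ :=
  biPeriodicWord (omega k)
    ([2] ++ twos (2 * k - 2) ++ [1] ++ twos (2 * k) ++ [1] ++ twos (2 * k + 1) ++ [1]
      ++ twos (2 * k - 1) ++ [1] ++ twos (2 * k) ++ [1] ++ twos (2 * k - 1) ++ [1, 1])
    [2]

end

end MarkovLagrange

/-!
The numbers `m(γ_k^1)` lie strictly between `m(θ(ω_k))` and `m(θ(ω_{k-1}))`, all these values tend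
to `1 + 3 / √2`, and none of the `m(γ_k^1)` is in the Lagrange spectrum, because a periodic word
with nearly the same Markov value would have to be a translate of `θ(ω_k)` or of its reflection.

All estimates are made in one coordinate. The map `z ↦ 2 + 1 / z` fixes `1 + √2` and `1 - √2`; in
the coordinate `coord` that sends these points to `0` and `∞` it is the multiplication by `-q`
with `q = 3 - 2√2`. The effect of a block `2_n 1` is therefore explicit: differences of
coordinates are multiplied by `±q ^ n` times a factor in the narrow interval `[0.368, 0.419]`
(`coord_prependBlocks_sub`). If `θ_{i-1} = 1`, then `λ_i(θ)` is an increasing function `height` of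
the coordinate `x` of the digits from `i` on and of the coordinate `y` of the digits to the left
of that `1` (`height_eq`).

*Markov values.* The value `λ` can exceed `3` only at the ends of blocks of twos. For both words
it is largest at the first digit of the shortest block of `ω_k`; thus `m(θ(ω_k))` and `m(γ_k^1)`
are explicit heights (`markovValue_thetaOmega`, `markovValue_gammaOne`) with the same left side,
and `ω_k` has odd length, so that changing the right side after one period changes its coordinate
in the opposite direction. Both heights are `1 + 3 / √2` plus a quantity of size `q ^ (2k - 1)`.

*Exclusion from the Lagrange spectrum.* Let `θ` be periodic with `m(θ)` extremely close to
`m(γ_k^1)`. The supremum is attained, at the position `i` say, and up to reflection the digits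
around `i` are `2 2 1 2 2 2` (`readsAt_or_reflect_of_height_near`). Comparing `λ_i(θ)` with
`λ_0(γ_k^1)` gives `δ ≈ S ε`, where `δ` and `ε` are the deviations of the right and the left
coordinate and `S` is about `1 / 2` in absolute value. Passing a digit `1` on one side and then on
the other one restores such a relation, and at each step all pairs of digits but one violate it.
So the equality of heights alone determines about five blocks to either side
(`agree_of_height_near`).

From there one goes to the left by one period at a time, comparing with `θ(ω_k)`. At these
positions the right coordinate is close to that of `ω_k ω_k …`, hence the bound for `λ` bounds the
left coordinate from above; as `ω_k` has odd length, the same bound one period further left also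
bounds it from below. A deviation by at most this amount leaves no choice for the digits
(`next_blocks_eq`), except for one block of twos that may be too short by two; then the `λ` at its
other end is too large (`lt_height_of_short_block`). Hence `θ` is `… ω_k ω_k` to the left of some
position, and by periodicity it is a translate of `θ(ω_k)`. But `m(θ(ω_k))` is not close enough to
`m(γ_k^1)`, a contradiction.
-/

namespace MarkovLagrange

noncomputable section

/-! ### Rays and the linearising coordinate -/

lemma cfValue_eq (a : ℕ → ℕ+) :
    cfValue a = ((a 0 : ℕ) : ℝ) + 1 / cfValue (fun n => a (n + 1)) := by
  have h1 := (tendsto_cfConv a).comp (tendsto_add_atTop_nat 1)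
  have h2 := tendsto_cfConv (fun n => a (n + 1))
  have h3 : 1 ≤ cfValue (fun n => a (n + 1)) :=
    ge_of_tendsto' h2 (fun n => one_le_cfConv n _)
  have h4 : Tendsto (fun n => ((a 0 : ℕ) : ℝ) + 1 / cfConv n (fun n => a (n + 1))) atTop
      (𝓝 (((a 0 : ℕ) : ℝ) + 1 / cfValue (fun n => a (n + 1)))) :=
    (tendsto_const_nhds.div h2 (by linarith)).const_add _
  exact tendsto_nhds_unique h1 h4

lemma one_le_cfValue (a : ℕ → ℕ+) : 1 ≤ cfValue a :=
  ge_of_tendsto' (tendsto_cfConv a) (fun n => one_le_cfConv n _)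

/-- The ray obtained by putting the digit `d` in front of the ray `a`. -/
def rayCons (d : ℕ+) (a : ℕ → ℕ+) : ℕ → ℕ+
  | 0 => d
  | n + 1 => a n

/-- The ray `2_n a`. -/
def prependTwos : ℕ → (ℕ → ℕ+) → ℕ → ℕ+
  | 0, a => a
  | n + 1, a => rayCons 2 (prependTwos n a)

/-- The ray `2_{n₁} 1 2_{n₂} 1 … 2_{n_r} 1 a` for the list `[n₁, …, n_r]`. -/
def prependBlocks : List ℕ → (ℕ → ℕ+) → ℕ → ℕ+
  | [], a => a
  | n :: l, a => prependTwos n (rayCons 1 (prependBlocks l a))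

lemma rayCons_tail (a : ℕ → ℕ+) : rayCons (a 0) (fun n => a (n + 1)) = a := by
  funext n; cases n <;> rfl

lemma eq_rayCons_of_head {a : ℕ → ℕ+} {d : ℕ+} (h : a 0 = d) :
    a = rayCons d (fun n => a (n + 1)) := by
  rw [← h, rayCons_tail]

lemma rayCons_inj {d e : ℕ+} {a b : ℕ → ℕ+} (h : rayCons d a = rayCons e b) : d = e ∧ a = b :=
  ⟨congrFun h 0, funext fun n => congrFun h (n + 1)⟩

lemma prependTwos_add (m n : ℕ) (a : ℕ → ℕ+) :
    prependTwos (m + n) a = prependTwos m (prependTwos n a) := by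
  induction m with
  | zero => simp [prependTwos]
  | succ m ih => rw [Nat.succ_add]; simp [prependTwos, ih]

lemma prependTwos_succ' (n : ℕ) (a : ℕ → ℕ+) :
    prependTwos (n + 1) a = prependTwos n (rayCons 2 a) := by
  rw [prependTwos_add]; rfl

lemma prependBlocks_append (l l' : List ℕ) (a : ℕ → ℕ+) :
    prependBlocks (l ++ l') a = prependBlocks l (prependBlocks l' a) := by
  induction l with
  | nil => rfl
  | cons n l ih => simp [prependBlocks, ih]

/-- All digits of the ray are `1` or `2`. -/
def OneTwo (a : ℕ → ℕ+) : Prop := ∀ n, a n = 1 ∨ a n = 2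

lemma OneTwo.rayCons_one {a : ℕ → ℕ+} (h : OneTwo a) : OneTwo (rayCons 1 a) := by
  intro n; cases n with
  | zero => exact Or.inl rfl
  | succ n => exact h n

lemma OneTwo.rayCons_two {a : ℕ → ℕ+} (h : OneTwo a) : OneTwo (rayCons 2 a) := by
  intro n; cases n with
  | zero => exact Or.inr rfl
  | succ n => exact h n

lemma OneTwo.prependTwos {a : ℕ → ℕ+} (h : OneTwo a) (n : ℕ) : OneTwo (prependTwos n a) := by
  induction n with
  | zero => exact h
  | succ n ih => exact ih.rayCons_two

lemma OneTwo.prependBlocks {a : ℕ → ℕ+} (h : OneTwo a) (l : List ℕ) :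
    OneTwo (prependBlocks l a) := by
  induction l with
  | nil => exact h
  | cons n l ih => exact ih.rayCons_one.prependTwos n

/-- A ray with digits `1` and `2` starts with `1` or with `2`. -/
lemma OneTwo.cases {a : ℕ → ℕ+} (h : OneTwo a) :
    (∃ b, OneTwo b ∧ a = rayCons 1 b) ∨ ∃ b, OneTwo b ∧ a = rayCons 2 b := by
  rcases h 0 with h0 | h0
  · exact Or.inl ⟨_, fun n => h (n + 1), eq_rayCons_of_head h0⟩
  · exact Or.inr ⟨_, fun n => h (n + 1), eq_rayCons_of_head h0⟩

/-- The contraction ratio `(1 + √2)⁻² = 3 - 2√2` of the digit `2`. -/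
def q : ℝ := 3 - 2 * √2

/-- The linearising coordinate of a ray: if `z` is the value of its continued fraction, this is
`(z - β) / (z + β⁻¹)` with `β = 1 + √2 = [2; 2, 2, …]` and `β⁻¹ = √2 - 1`, so that the Möbius map
`z ↦ 2 + 1 / z`, with fixed points `β` and `-β⁻¹`, becomes multiplication by `-q`. -/
def coord (a : ℕ → ℕ+) : ℝ := (cfValue a - (1 + √2)) / (cfValue a + (√2 - 1))

/-- The denominator of `oneMap`. -/
def oneDen (x : ℝ) : ℝ := (3 + √2) - (√2 - 1) * x

/-- The map `z ↦ 1 + 1 / z` in the linearising coordinate. -/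
def oneMap (x : ℝ) : ℝ := -((1 + √2) + (3 - √2) * x) / oneDen x

lemma sqrt_two_mul : √2 * √2 = (2 : ℝ) := Real.mul_self_sqrt (by norm_num)

lemma sqrt_two_lb : 141421 / 100000 < √2 := by
  rw [Real.lt_sqrt (by norm_num)]; norm_num

lemma sqrt_two_ub : √2 < 141422 / 100000 := by
  rw [Real.sqrt_lt' (by norm_num)]; norm_num

lemma q_lb : 17156 / 100000 < q := by unfold q; linarith [sqrt_two_ub]
lemma q_ub : q < 17158 / 100000 := by unfold q; linarith [sqrt_two_lb]
lemma q_pos : 0 < q := by linarith [q_lb]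
lemma q_lt_one : q < 1 := by linarith [q_ub]

lemma cfValue_rayCons (d : ℕ+) (a : ℕ → ℕ+) :
    cfValue (rayCons d a) = ((d : ℕ) : ℝ) + 1 / cfValue a := cfValue_eq _

lemma coord_rayCons_two (a : ℕ → ℕ+) : coord (rayCons 2 a) = -q * coord a := by
  have h := one_le_cfValue a
  have h1 := sqrt_two_lb
  have h2 := sqrt_two_mul
  unfold coord q
  rw [cfValue_rayCons]
  set z := cfValue a
  set s := √2
  have e1 : z + (s - 1) ≠ 0 := by nlinarith
  have e2 : (((2 : ℕ+) : ℕ) : ℝ) + 1 / z + (s - 1) ≠ 0 := by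
    have : 0 ≤ 1 / z := by positivity
    have : (((2 : ℕ+) : ℕ) : ℝ) = 2 := by norm_num
    rw [this]; nlinarith
  have e3 : z ≠ 0 := by linarith
  have e4 : (((2 : ℕ+) : ℕ) : ℝ) = 2 := by norm_num
  rw [e4] at e2 ⊢
  have e5 : (1 + s) * z + 1 ≠ 0 := by nlinarith
  have e6 : 2 + 1 / z + (s - 1) = ((1 + s) * z + 1) / z := by field_simp; ring
  rw [e6]
  field_simp
  linear_combination (2 * z * s - 2 * z ^ 2 + 2) * h2

lemma coord_rayCons_one (a : ℕ → ℕ+) : coord (rayCons 1 a) = oneMap (coord a) := by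
  have h := one_le_cfValue a
  have h1 := sqrt_two_lb
  have h1' := sqrt_two_ub
  have h2 := sqrt_two_mul
  unfold coord oneMap oneDen
  rw [cfValue_rayCons]
  set z := cfValue a
  set s := √2
  have e0 : 0 < z + (s - 1) := by linarith
  have e1 : z + (s - 1) ≠ 0 := e0.ne'
  have e3 : z ≠ 0 := by linarith
  have e4 : (((1 : ℕ+) : ℕ) : ℝ) = 1 := by norm_num
  rw [e4]
  have e5 : s * z + 1 ≠ 0 := by nlinarith
  have e6 : 1 + 1 / z + (s - 1) = (s * z + 1) / z := by field_simp; ring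
  have e7 : 3 + s - (s - 1) * ((z - (1 + s)) / (z + (s - 1))) = (4 * z + 2 * s) / (z + (s - 1)) := by
    field_simp
    linear_combination 2 * h2
  have e8 : 1 + s + (3 - s) * ((z - (1 + s)) / (z + (s - 1))) = (4 * z - 2 * s) / (z + (s - 1)) := by
    field_simp
    linear_combination 2 * h2
  have e9 : 4 * z + 2 * s ≠ 0 := by linarith
  rw [e6, e7, e8]
  field_simp
  linear_combination (-4 * z) * h2

/-- Values of rays with digits `1` and `2` lie between `[1; 2, 1, 2, …]` and `[2; 1, 2, 1, …]`. -/
lemma OneTwo.cfValue_mem {a : ℕ → ℕ+} (h : OneTwo a) :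
    136585 / 100000 ≤ cfValue a ∧ cfValue a ≤ 273334 / 100000 := by
  have up : ∀ m : ℝ, 0 < m → (∀ a, OneTwo a → m ≤ cfValue a) →
      ∀ a, OneTwo a → cfValue a ≤ 2 + 1 / m := by
    intro m hm H a ha
    rcases ha.cases with ⟨b, hb, rfl⟩ | ⟨b, hb, rfl⟩ <;> rw [cfValue_rayCons] <;>
      have := one_div_le_one_div_of_le hm (H b hb) <;> norm_num at this ⊢ <;> linarith
  have lo : ∀ M : ℝ, 0 < M → (∀ a, OneTwo a → cfValue a ≤ M) →
      ∀ a, OneTwo a → 1 + 1 / M ≤ cfValue a := by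
    intro m hm H a ha
    rcases ha.cases with ⟨b, hb, rfl⟩ | ⟨b, hb, rfl⟩ <;> rw [cfValue_rayCons] <;>
      have := one_div_le_one_div_of_le (by linarith [one_le_cfValue b]) (H b hb) <;>
      norm_num at this ⊢ <;> linarith
  have s1 := up 1 one_pos (fun a _ => one_le_cfValue a)
  have s2 := lo _ (by norm_num) s1
  have s3 := up _ (by norm_num) s2
  have s4 := lo _ (by norm_num) s3
  have s5 := up _ (by norm_num) s4
  have s6 := lo _ (by norm_num) s5
  have s7 := up _ (by norm_num) s6
  have s8 := lo _ (by norm_num) s7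
  have s9 := up _ (by norm_num) s8
  constructor
  · exact le_trans (by norm_num) (s8 a h)
  · exact (s9 a h).trans (by norm_num)

lemma OneTwo.coord_mem {a : ℕ → ℕ+} (h : OneTwo a) :
    -589 / 1000 ≤ coord a ∧ coord a ≤ 1014 / 10000 := by
  obtain ⟨h1, h2⟩ := h.cfValue_mem
  have h3 := sqrt_two_lb
  have h4 := sqrt_two_ub
  unfold coord
  have e0 : 0 < cfValue a + (√2 - 1) := by linarith
  rw [le_div_iff₀ e0, div_le_iff₀ e0]
  constructor <;> linarith

lemma oneDen_mem {x : ℝ} (h : -589 / 1000 ≤ x ∧ x ≤ 1014 / 10000) :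
    43722 / 10000 ≤ oneDen x ∧ oneDen x ≤ 46583 / 10000 := by
  have h3 := sqrt_two_lb
  have h4 := sqrt_two_ub
  unfold oneDen
  constructor <;> nlinarith

lemma OneTwo.coord_one_mem {a : ℕ → ℕ+} (h : OneTwo a) :
    -589 / 1000 ≤ coord (rayCons 1 a) ∧ coord (rayCons 1 a) ≤ -3177 / 10000 := by
  refine ⟨h.rayCons_one.coord_mem.1, ?_⟩
  have h1 := h.coord_mem
  have h2 := oneDen_mem h1
  have h3 := sqrt_two_lb
  have h4 := sqrt_two_ub
  rw [coord_rayCons_one, oneMap, div_le_iff₀ (by linarith)]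
  unfold oneDen
  nlinarith

lemma OneTwo.coord_two_mem {a : ℕ → ℕ+} (h : OneTwo a) :
    -174 / 10000 ≤ coord (rayCons 2 a) ∧ coord (rayCons 2 a) ≤ 1011 / 10000 := by
  have h1 := h.coord_mem
  have h3 := q_lb
  have h4 := q_ub
  rw [coord_rayCons_two]
  constructor <;> nlinarith

lemma oneMap_sub {x y : ℝ} (hx : oneDen x ≠ 0) (hy : oneDen y ≠ 0) :
    oneMap x - oneMap y = -(8 / (oneDen x * oneDen y)) * (x - y) := by
  unfold oneMap
  field_simp
  unfold oneDen
  ring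

lemma coord_prependTwos (n : ℕ) (a : ℕ → ℕ+) :
    coord (prependTwos n a) = (-q) ^ n * coord a := by
  induction n with
  | zero => simp [prependTwos]
  | succ n ih => rw [prependTwos, coord_rayCons_two, ih]; ring

/-- The derivative of `1 + 1 / z` in the linearising coordinate is nearly constant. -/
lemma eight_div_oneDen_mem {x y : ℝ} (hx : -589 / 1000 ≤ x ∧ x ≤ 1014 / 10000)
    (hy : -589 / 1000 ≤ y ∧ y ≤ 1014 / 10000) :
    368 / 1000 ≤ 8 / (oneDen x * oneDen y) ∧ 8 / (oneDen x * oneDen y) ≤ 419 / 1000 := by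
  have h1 := oneDen_mem hx
  have h2 := oneDen_mem hy
  have e : 0 < oneDen x * oneDen y := mul_pos (by linarith) (by linarith)
  rw [le_div_iff₀ e, div_le_iff₀ e]
  constructor <;> nlinarith

/-- Putting a prefix in front of two rays scales the difference of their coordinates by a factor
that is known up to the accuracy with which the factor of each digit `1` is. -/
lemma coord_prependBlocks_sub (l : List ℕ) {a b : ℕ → ℕ+} (ha : OneTwo a) (hb : OneTwo b) :
    ∃ c : ℝ, q ^ l.sum * (368 / 1000) ^ l.length ≤ c ∧ c ≤ q ^ l.sum * (419 / 1000) ^ l.length ∧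
      coord (prependBlocks l a) - coord (prependBlocks l b)
        = (-1) ^ (l.sum + l.length) * c * (coord a - coord b) := by
  induction l with
  | nil => exact ⟨1, by simp, by simp, by simp [prependBlocks]⟩
  | cons n l ih =>
    obtain ⟨c, h1, h2, h3⟩ := ih
    have hA := (ha.prependBlocks l).coord_mem
    have hB := (hb.prependBlocks l).coord_mem
    obtain ⟨k1, k2⟩ := eight_div_oneDen_mem hA hB
    have q0 := q_pos
    have c0 : 0 < c := lt_of_lt_of_le (by positivity) h1
    set κ := 8 / (oneDen (coord (prependBlocks l a)) * oneDen (coord (prependBlocks l b)))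
    refine ⟨q ^ n * κ * c, ?_, ?_, ?_⟩
    · calc _ = q ^ n * (368 / 1000) * (q ^ l.sum * (368 / 1000) ^ l.length) := by
            simp only [List.sum_cons, List.length_cons]; ring
        _ ≤ _ := by gcongr
    · calc _ ≤ q ^ n * (419 / 1000) * (q ^ l.sum * (419 / 1000) ^ l.length) := by gcongr
        _ = _ := by simp only [List.sum_cons, List.length_cons]; ring
    · simp only [prependBlocks, coord_prependTwos, coord_rayCons_one]
      rw [← mul_sub, oneMap_sub (by linarith [(oneDen_mem hA).1]) (by linarith [(oneDen_mem hB).1]),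
        h3]
      simp only [List.sum_cons, List.length_cons]
      rw [neg_pow q n]
      ring

/-! ### Positions in a word and the value of `λ` -/

/-- The ray `θ_i, θ_{i+1}, …`. -/
def rightRay (θ : ℤ → ℕ+) (i : ℤ) : ℕ → ℕ+ := fun n => θ (i + n)

/-- The ray `θ_i, θ_{i-1}, …`. -/
def leftRay (θ : ℤ → ℕ+) (i : ℤ) : ℕ → ℕ+ := fun n => θ (i - n)

lemma rightRay_eq_rayCons (θ : ℤ → ℕ+) (i : ℤ) :
    rightRay θ i = rayCons (θ i) (rightRay θ (i + 1)) := by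
  funext n
  cases n with
  | zero => simp [rightRay, rayCons]
  | succ n => simp only [rightRay, rayCons]; congr 1; push_cast; ring

lemma leftRay_eq_rayCons (θ : ℤ → ℕ+) (i : ℤ) :
    leftRay θ i = rayCons (θ i) (leftRay θ (i - 1)) := by
  funext n
  cases n with
  | zero => simp [leftRay, rayCons]
  | succ n => simp only [leftRay, rayCons]; congr 1; push_cast; ring

lemma lam_eq (θ : ℤ → ℕ+) (i : ℤ) :
    lam θ i = cfValue (rightRay θ i) + 1 / cfValue (leftRay θ (i - 1)) := rfl

lemma lam_eq_digit_add (θ : ℤ → ℕ+) (i : ℤ) :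
    lam θ i = ((θ i : ℕ) : ℝ) + 1 / cfValue (rightRay θ (i + 1))
      + 1 / cfValue (leftRay θ (i - 1)) := by
  rw [lam_eq, rightRay_eq_rayCons, cfValue_rayCons]

lemma lam_eq_left (θ : ℤ → ℕ+) (i : ℤ) :
    lam θ i = cfValue (leftRay θ i) + 1 / cfValue (rightRay θ (i + 1)) := by
  rw [lam_eq_digit_add, leftRay_eq_rayCons θ i, cfValue_rayCons]; ring

lemma leftRay_of_rightRay_cons {θ : ℤ → ℕ+} {i : ℤ} {d : ℕ+} {a : ℕ → ℕ+}
    (h : rightRay θ i = rayCons d a) :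
    rightRay θ (i + 1) = a ∧ leftRay θ i = rayCons d (leftRay θ (i - 1)) := by
  rw [rightRay_eq_rayCons] at h
  obtain ⟨h1, h2⟩ := rayCons_inj h
  exact ⟨h2, by rw [leftRay_eq_rayCons θ i, h1]⟩

lemma rightRay_of_leftRay_cons {θ : ℤ → ℕ+} {i : ℤ} {d : ℕ+} {a : ℕ → ℕ+}
    (h : leftRay θ i = rayCons d a) :
    leftRay θ (i - 1) = a ∧ rightRay θ i = rayCons d (rightRay θ (i + 1)) := by
  rw [leftRay_eq_rayCons] at h
  obtain ⟨h1, h2⟩ := rayCons_inj h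
  exact ⟨h2, by rw [rightRay_eq_rayCons θ i, h1]⟩

lemma leftRay_of_rightRay_twos {θ : ℤ → ℕ+} {n : ℕ} :
    ∀ {i : ℤ} {a : ℕ → ℕ+}, rightRay θ i = prependTwos n a →
    rightRay θ (i + n) = a ∧ leftRay θ (i + n - 1) = prependTwos n (leftRay θ (i - 1)) := by
  induction n with
  | zero => intro i a h; simpa [prependTwos] using h
  | succ n ih =>
    intro i a h
    rw [prependTwos_succ'] at h
    obtain ⟨h1, h2⟩ := ih h
    obtain ⟨h3, h4⟩ := leftRay_of_rightRay_cons h1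
    refine ⟨by rw [← h3]; congr 1; push_cast; ring, ?_⟩
    rw [prependTwos, ← h2, ← h4]
    congr 1; push_cast; ring

lemma rightRay_of_leftRay_twos {θ : ℤ → ℕ+} {n : ℕ} :
    ∀ {i : ℤ} {a : ℕ → ℕ+}, leftRay θ i = prependTwos n a →
    leftRay θ (i - n) = a ∧ rightRay θ (i - n + 1) = prependTwos n (rightRay θ (i + 1)) := by
  induction n with
  | zero => intro i a h; simpa [prependTwos] using h
  | succ n ih =>
    intro i a h
    rw [prependTwos_succ'] at h
    obtain ⟨h1, h2⟩ := ih h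
    obtain ⟨h3, h4⟩ := rightRay_of_leftRay_cons h1
    refine ⟨by rw [← h3]; congr 1; push_cast; ring, ?_⟩
    rw [prependTwos, ← h2, ← h4]
    congr 1; push_cast; ring

/-- At position `i` of `θ` one reads `… 1 | a`: the digits from position `i` on are `a`, the digit
to the left of position `i` is `1`, and the digits further left are, read leftwards, `c`. -/
def ReadsAt (θ : ℤ → ℕ+) (i : ℤ) (a c : ℕ → ℕ+) : Prop :=
  rightRay θ i = a ∧ leftRay θ (i - 1) = rayCons 1 c

lemma ReadsAt.move {θ : ℤ → ℕ+} {i : ℤ} {n : ℕ} {a c : ℕ → ℕ+}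
    (h : ReadsAt θ i (prependTwos n (rayCons 1 a)) c) :
    ReadsAt θ (i + n + 1) a (prependTwos n (rayCons 1 c)) := by
  obtain ⟨h1, h2⟩ := leftRay_of_rightRay_twos h.1
  obtain ⟨h3, h4⟩ := leftRay_of_rightRay_cons h1
  refine ⟨h3, ?_⟩
  rw [add_sub_cancel_right, h4, h2, h.2]

lemma ReadsAt.moveBack {θ : ℤ → ℕ+} {i : ℤ} {n : ℕ} {a c : ℕ → ℕ+}
    (h : ReadsAt θ i a (prependTwos n (rayCons 1 c))) :
    ReadsAt θ (i - (n + 1)) (prependTwos n (rayCons 1 a)) c := by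
  obtain ⟨h1, h2⟩ := rightRay_of_leftRay_cons h.2
  obtain ⟨h3, h4⟩ := rightRay_of_leftRay_twos h1
  refine ⟨?_, ?_⟩
  · rw [show i - 1 + 1 = i by ring, h.1] at h2
    rw [show i - 1 - 1 + 1 = i - 1 by ring, h2] at h4
    rw [← h4]; congr 1; ring
  · rw [← h3]; congr 1; ring

lemma ReadsAt.moveBlocks {θ : ℤ → ℕ+} {l : List ℕ} :
    ∀ {i : ℤ} {a c : ℕ → ℕ+}, ReadsAt θ i (prependBlocks l a) c →
    ReadsAt θ (i + (l.sum + l.length : ℕ)) a (prependBlocks l.reverse c) := by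
  induction l with
  | nil => intro i a c h; simpa [prependBlocks] using h
  | cons n l ih =>
    intro i a c h
    have := ih h.move
    rw [List.reverse_cons, prependBlocks_append]
    convert this using 1
    · simp only [List.sum_cons, List.length_cons]; push_cast; ring
    · rfl

lemma ReadsAt.moveBlocksBack {θ : ℤ → ℕ+} {l : List ℕ} :
    ∀ {i : ℤ} {a c : ℕ → ℕ+}, ReadsAt θ i a (prependBlocks l c) →
    ReadsAt θ (i - (l.sum + l.length : ℕ)) (prependBlocks l.reverse a) c := by
  induction l with
  | nil => intro i a c h; simpa [prependBlocks] using h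
  | cons n l ih =>
    intro i a c h
    have := ih (ReadsAt.moveBack h)
    rw [List.reverse_cons, prependBlocks_append]
    convert this using 1
    · simp only [List.sum_cons, List.length_cons]; push_cast; ring
    · rfl

/-- The contribution to `λ_i`, up to the factor `√2`, of the digits from position `i` on, as a
function of their coordinate, when `θ_{i-1} = 1`. It is normalised to vanish at `2 2 2 …`. -/
def frontTerm (x : ℝ) : ℝ := 2 * x / (1 - x)

/-- The contribution to `λ_i`, up to the factor `√2`, of the digits left of `θ_{i-1} = 1`, as a
function of their coordinate, again normalised to vanish at `2 2 2 …`. -/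
def backTerm (y : ℝ) : ℝ := q * y / (1 - q * y)

/-- The value of `λ_i`, when `θ_{i-1} = 1`, in terms of the coordinates of the two rays. -/
def height (x y : ℝ) : ℝ := 1 + 3 / √2 + √2 * (frontTerm x + backTerm y)

lemma height_eq (a c : ℕ → ℕ+) :
    cfValue a + 1 / cfValue (rayCons 1 c) = height (coord a) (coord c) := by
  rw [cfValue_rayCons]
  have h := one_le_cfValue a
  have h' := one_le_cfValue c
  have h1 := sqrt_two_lb
  have h1' := sqrt_two_ub
  have h2 := sqrt_two_mul
  unfold height frontTerm backTerm coord q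
  set z := cfValue a
  set w := cfValue c
  set s := √2
  have e4 : (((1 : ℕ+) : ℕ) : ℝ) = 1 := by norm_num
  rw [e4]
  have e0 : z + (s - 1) ≠ 0 := by linarith
  have e0' : w + (s - 1) ≠ 0 := by linarith
  have e1 : 1 - (z - (1 + s)) / (z + (s - 1)) = 2 * s / (z + (s - 1)) := by
    field_simp; ring
  have e2 : 1 - (3 - 2 * s) * ((w - (1 + s)) / (w + (s - 1)))
      = 2 * (s - 1) * (w + 1) / (w + (s - 1)) := by
    field_simp
    linear_combination (-2) * h2
  have e3 : s ≠ 0 := by linarith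
  have e5 : s - 1 ≠ 0 := by linarith
  have e6 : w + 1 ≠ 0 := by linarith
  have e7 : w ≠ 0 := by linarith
  have e8 : 1 + 1 / w = (w + 1) / w := by field_simp
  rw [e1, e2, e8]
  have e9 : 2 * ((z - (1 + s)) / (z + (s - 1))) / (2 * s / (z + (s - 1))) = (z - (1 + s)) / s := by
    field_simp
  have e10 : (3 - 2 * s) * ((w - (1 + s)) / (w + (s - 1))) / (2 * (s - 1) * (w + 1) / (w + (s - 1)))
      = (s - 1) * (w - (1 + s)) / (2 * (w + 1)) := by
    field_simp
    linear_combination (-(w - (1 + s))) * h2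
  rw [e9, e10]
  field_simp
  linear_combination (3 * w + 3 - w * s + s ^ 2) * h2

lemma ReadsAt.lam_eq {θ : ℤ → ℕ+} {i : ℤ} {a c : ℕ → ℕ+} (h : ReadsAt θ i a c) :
    lam θ i = height (coord a) (coord c) := by
  rw [MarkovLagrange.lam_eq, h.1, h.2, height_eq]

lemma ReadsAt.lam_end_eq {θ : ℤ → ℕ+} {i : ℤ} {n : ℕ} {a c : ℕ → ℕ+}
    (h : ReadsAt θ i (prependTwos n (rayCons 1 a)) c) :
    lam θ (i + n - 1) = height (coord (prependTwos n (rayCons 1 c))) (coord a) := by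
  obtain ⟨h1, h2⟩ := leftRay_of_rightRay_twos h.1
  rw [lam_eq_left, h2, show i + n - 1 + 1 = i + (n : ℤ) by ring, h1, h.2, height_eq]

lemma oneTwo_rightRay {θ : ℤ → ℕ+} (h : ∀ i, θ i = 1 ∨ θ i = 2) (i : ℤ) : OneTwo (rightRay θ i) :=
  fun _ => h _

lemma oneTwo_leftRay {θ : ℤ → ℕ+} (h : ∀ i, θ i = 1 ∨ θ i = 2) (i : ℤ) : OneTwo (leftRay θ i) :=
  fun _ => h _

lemma lam_le_of_one {θ : ℤ → ℕ+} {i : ℤ} (hi : θ i = 1) :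
    lam θ i ≤ 3 := by
  rw [lam_eq_digit_add, hi]
  have h1 := one_div_le_one_div_of_le one_pos (one_le_cfValue (rightRay θ (i + 1)))
  have h2 := one_div_le_one_div_of_le one_pos (one_le_cfValue (leftRay θ (i - 1)))
  norm_num at h1 h2 ⊢
  linarith

lemma lam_le_of_two_two_two {θ : ℤ → ℕ+} {i : ℤ}
    (h1 : θ i = 2) (h2 : θ (i - 1) = 2) (h3 : θ (i + 1) = 2) : lam θ i ≤ 3 := by
  rw [lam_eq_digit_add, h1, rightRay_eq_rayCons, leftRay_eq_rayCons, h2, h3, cfValue_rayCons,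
    cfValue_rayCons]
  have k : ∀ z : ℝ, 1 ≤ z → 1 / ((((2 : ℕ+) : ℕ) : ℝ) + 1 / z) ≤ 1 / 2 := by
    intro z hz
    have : 0 ≤ 1 / z := by positivity
    apply one_div_le_one_div_of_le (by norm_num)
    norm_num at this ⊢; linarith
  have k1 := k _ (one_le_cfValue (rightRay θ (i + 1 + 1)))
  have k2 := k _ (one_le_cfValue (leftRay θ (i - 1 - 1)))
  have : (((2 : ℕ+) : ℕ) : ℝ) = 2 := by norm_num
  rw [this] at k1 k2 ⊢
  linarith

lemma prependTwos_apply {n j : ℕ} (h : j < n) (a : ℕ → ℕ+) : prependTwos n a j = 2 := by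
  induction n generalizing j with
  | zero => omega
  | succ n ih =>
    cases j with
    | zero => rfl
    | succ j => exact ih (by omega)

/-- Along a block `2_n 1`, only the two ends of the block of twos can have a large `λ`. -/
lemma ReadsAt.lam_le {θ : ℤ → ℕ+} {i : ℤ} {n : ℕ} {a c : ℕ → ℕ+}
    (h : ReadsAt θ i (prependTwos n (rayCons 1 a)) c) {M : ℝ} (hM : 3 ≤ M)
    (h1 : height (coord (prependTwos n (rayCons 1 a))) (coord c) ≤ M)
    (h2 : height (coord (prependTwos n (rayCons 1 c))) (coord a) ≤ M)
    {t : ℤ} (ht1 : i ≤ t) (ht2 : t < i + n + 1) : lam θ t ≤ M := by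
  have two : ∀ j : ℤ, i ≤ j → j < i + n → θ j = 2 := by
    intro j hj1 hj2
    have e : θ j = rightRay θ i (j - i).toNat := by
      unfold rightRay; congr 1; omega
    rw [e, h.1, prependTwos_apply (by omega)]
  rcases eq_or_lt_of_le ht1 with rfl | ht1
  · rw [h.lam_eq]; exact h1
  by_cases e : t = i + n - 1
  · rw [e, h.lam_end_eq]; exact h2
  by_cases e' : t = i + n
  · refine (lam_le_of_one ?_).trans hM
    have := congrFun (leftRay_of_rightRay_twos h.1).1 0
    rw [e']
    simpa [rightRay, rayCons] using this
  · exact (lam_le_of_two_two_two (two t (by omega) (by omega)) (two _ (by omega) (by omega))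
      (two _ (by omega) (by omega))).trans hM

/-! ### The words `θ(ω_k)` and `γ_k^1` -/

/-- The ray `w a` for a string `w`. -/
def prependList : List ℕ+ → (ℕ → ℕ+) → ℕ → ℕ+
  | [], a => a
  | d :: w, a => rayCons d (prependList w a)

lemma prependList_append (w w' : List ℕ+) (a : ℕ → ℕ+) :
    prependList (w ++ w') a = prependList w (prependList w' a) := by
  induction w with
  | nil => rfl
  | cons d w ih => simp [prependList, ih]

lemma prependList_twos (n : ℕ) (a : ℕ → ℕ+) : prependList (twos n) a = prependTwos n a := by
  induction n with
  | zero => rfl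
  | succ n ih => rw [twos, List.replicate_succ, prependList, ← twos, ih]; rfl

lemma rightRay_eq_prependList {θ : ℤ → ℕ+} {w : List ℕ+} :
    ∀ {i : ℤ}, (∀ n : ℕ, n < w.length → θ (i + n) = w.getD n 1) →
    rightRay θ i = prependList w (rightRay θ (i + w.length)) := by
  induction w with
  | nil => intro i _; simp [prependList]
  | cons d w ih =>
    intro i h
    rw [rightRay_eq_rayCons, ih (i := i + 1), prependList]
    · have h0 := h 0 (by simp)
      simp only [Nat.cast_zero, add_zero, List.getD_cons_zero] at h0
      rw [h0]
      congr 3; simp only [List.length_cons]; push_cast; ring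
    · intro n hn
      have h1 := h (n + 1) (by simpa using hn)
      rw [List.getD_cons_succ] at h1
      rw [← h1]; congr 1; push_cast; ring

lemma prependList_omega (k : ℕ) (hk : 1 ≤ k) (a : ℕ → ℕ+) :
    prependList (omega k) a = prependBlocks [2 * k - 1, 2 * k - 1 + 1, 2 * k - 1 + 2] a := by
  have e1 : 2 * k - 1 + 1 = 2 * k := by omega
  have e2 : 2 * k - 1 + 2 = 2 * k + 1 := by omega
  rw [e1, e2]
  simp only [omega, prependList_append, prependList_twos, prependBlocks, prependList]

lemma length_omega (k : ℕ) (hk : 1 ≤ k) : (omega k).length = 6 * k + 3 := by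
  simp [omega, twos]; omega

lemma omega_mem {k : ℕ} : ∀ d ∈ omega k, d = 1 ∨ d = 2 := by
  intro d hd
  simp only [omega, twos, List.mem_append, List.mem_replicate, List.mem_singleton] at hd
  tauto

lemma getD_one_or_two {w : List ℕ+} (h : ∀ d ∈ w, d = 1 ∨ d = 2) (n : ℕ) :
    w.getD n 1 = 1 ∨ w.getD n 1 = 2 := by
  rw [List.getD_eq_getElem?_getD]
  rcases hn : w[n]? with _ | d
  · simp
  · simpa using h d (List.mem_of_getElem? hn)

lemma periodicWord_add (u : List ℕ+) (i : ℤ) :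
    periodicWord u (i + u.length) = periodicWord u i := by
  simp [periodicWord]

lemma periodicWord_natCast (u : List ℕ+) {n : ℕ} (h : n < u.length) :
    periodicWord u n = u.getD n 1 := by
  unfold periodicWord
  rw [Int.emod_eq_of_lt (by omega) (by omega)]
  simp

lemma thetaOmega_oneTwo (k : ℕ) (i : ℤ) : thetaOmega k i = 1 ∨ thetaOmega k i = 2 :=
  getD_one_or_two omega_mem _

lemma thetaOmega_periodic (k : ℕ) : Function.Periodic (thetaOmega k) ((omega k).length : ℤ) :=
  fun i => periodicWord_add _ i

/-- The ray of `θ(ω_k)` to the right of the origin. -/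
def omegaRight (k : ℕ) : ℕ → ℕ+ := rightRay (thetaOmega k) 0

/-- The ray of `θ(ω_k)` to the left of the digit `1` at position `-1`. -/
def omegaLeft (k : ℕ) : ℕ → ℕ+ := leftRay (thetaOmega k) (-2)

/-- The ray of `γ_k^1` to the right of the origin. -/
def gammaRight (k : ℕ) : ℕ → ℕ+ :=
  prependBlocks [2 * k - 1, 2 * k - 1 + 1, 2 * k - 1 + 2, 2 * k - 1, 2 * k - 1 + 1, 2 * k - 1]
    (rayCons 1 (fun _ => 2))

lemma rightRay_add_period {θ : ℤ → ℕ+} {p : ℤ} (h : Function.Periodic θ p) (i : ℤ) :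
    rightRay θ (i + p) = rightRay θ i := by
  funext n
  simp only [rightRay]
  rw [← h (i + n)]; congr 1; ring

lemma leftRay_add_period {θ : ℤ → ℕ+} {p : ℤ} (h : Function.Periodic θ p) (i : ℤ) :
    leftRay θ (i + p) = leftRay θ i := by
  funext n
  simp only [leftRay]
  rw [← h (i - n)]; congr 1; ring

lemma thetaOmega_neg_one (k : ℕ) (hk : 1 ≤ k) : thetaOmega k (-1) = 1 := by
  have h := thetaOmega_periodic k (-1)
  have hl := length_omega k hk
  rw [← h]
  have e : (-1 + ((omega k).length : ℤ)) = (((omega k).length - 1 : ℕ) : ℤ) := by omega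
  rw [e, thetaOmega, periodicWord_natCast _ (by omega), omega]
  rw [List.getD_append_right _ _ _ _ (by simp)]
  simp

lemma omegaRight_eq {k : ℕ} (hk : 1 ≤ k) :
    omegaRight k = prependBlocks [2 * k - 1, 2 * k - 1 + 1, 2 * k - 1 + 2] (omegaRight k) := by
  have h : rightRay (thetaOmega k) 0
      = prependList (omega k) (rightRay (thetaOmega k) (0 + (omega k).length)) := by
    apply rightRay_eq_prependList
    intro n hn
    rw [zero_add]
    exact periodicWord_natCast _ hn
  rw [rightRay_add_period (thetaOmega_periodic k), prependList_omega k hk] at h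
  exact h

lemma readsAt_thetaOmega {k : ℕ} (hk : 1 ≤ k) :
    ReadsAt (thetaOmega k) 0 (omegaRight k) (omegaLeft k) := by
  refine ⟨rfl, ?_⟩
  rw [leftRay_eq_rayCons, show (0 : ℤ) - 1 = -1 by norm_num, thetaOmega_neg_one k hk]
  rfl

lemma omegaLeft_eq {k : ℕ} (hk : 1 ≤ k) :
    omegaLeft k = prependBlocks [2 * k - 1 + 2, 2 * k - 1 + 1, 2 * k - 1] (omegaLeft k) := by
  have h := readsAt_thetaOmega hk
  have h1 := h.2
  rw [omegaRight_eq hk] at h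
  have h2 := h.moveBlocks.2
  have hl := length_omega k hk
  have e : (0 + (([2 * k - 1, 2 * k - 1 + 1, 2 * k - 1 + 2].sum
      + [2 * k - 1, 2 * k - 1 + 1, 2 * k - 1 + 2].length : ℕ) : ℤ)) - 1
      = (0 - 1) + ((omega k).length : ℤ) := by
    simp; omega
  rw [e, leftRay_add_period (thetaOmega_periodic k), h1] at h2
  exact (rayCons_inj h2).2

lemma omegaRight_oneTwo (k : ℕ) : OneTwo (omegaRight k) := oneTwo_rightRay (thetaOmega_oneTwo k) _

lemma omegaLeft_oneTwo (k : ℕ) : OneTwo (omegaLeft k) := oneTwo_leftRay (thetaOmega_oneTwo k) _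

lemma oneTwo_const_two : OneTwo (fun _ => 2) := fun _ => Or.inr rfl

lemma gammaRight_oneTwo (k : ℕ) : OneTwo (gammaRight k) :=
  oneTwo_const_two.rayCons_one.prependBlocks _

lemma gammaOne_of_neg {k : ℕ} {i : ℤ} (hi : i < 0) : gammaOne k i = thetaOmega k i := by
  simp [gammaOne, biPeriodicWord, hi, thetaOmega]

lemma readsAt_gammaOne {k : ℕ} (hk : 1 ≤ k) :
    ReadsAt (gammaOne k) 0 (gammaRight k) (omegaLeft k) := by
  constructor
  · set w : List ℕ+ := [2] ++ twos (2 * k - 2) ++ [1] ++ twos (2 * k) ++ [1] ++ twos (2 * k + 1)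
      ++ [1] ++ twos (2 * k - 1) ++ [1] ++ twos (2 * k) ++ [1] ++ twos (2 * k - 1) ++ [1, 1] with hw
    have h : rightRay (gammaOne k) 0
        = prependList w (rightRay (gammaOne k) (0 + w.length)) := by
      apply rightRay_eq_prependList
      intro n hn
      unfold gammaOne biPeriodicWord
      rw [← hw, if_neg (by omega), if_pos (by omega)]
      simp
    have h' : rightRay (gammaOne k) (0 + w.length) = fun _ => 2 := by
      funext n
      unfold rightRay gammaOne biPeriodicWord
      rw [← hw, if_neg (by omega), if_neg (by omega)]
      simp [periodicWord]
    have e1 : 2 * k - 1 + 1 = 2 * k := by omega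
    have e2 : 2 * k - 1 + 2 = 2 * k + 1 := by omega
    have e3 : 2 * k - 1 = 2 * k - 2 + 1 := by omega
    rw [h, h', hw, gammaRight, e1, e2]
    simp only [prependList_append, prependList_twos, prependBlocks, prependList]
    rw [e3]; rfl
  · rw [← (readsAt_thetaOmega hk).2]
    funext n
    exact gammaOne_of_neg (by omega)

/-! ### Estimates of `λ` along blocks of twos -/

lemma frontTerm_sub {x y : ℝ} (hx : x < 1) (hy : y < 1) :
    frontTerm x - frontTerm y = 2 * (x - y) / ((1 - x) * (1 - y)) := by
  have h1 : 1 - x ≠ 0 := by linarith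
  have h2 : 1 - y ≠ 0 := by linarith
  unfold frontTerm; field_simp; ring

lemma backTerm_sub {x y : ℝ} (hx : q * x < 1) (hy : q * y < 1) :
    backTerm x - backTerm y = q * (x - y) / ((1 - q * x) * (1 - q * y)) := by
  have h1 : 1 - q * x ≠ 0 := by linarith
  have h2 : 1 - q * y ≠ 0 := by linarith
  unfold backTerm; field_simp; ring

lemma frontTerm_mono {x y : ℝ} (h : x ≤ y) (hy : y < 1) : frontTerm x ≤ frontTerm y := by
  rw [← sub_nonneg, frontTerm_sub hy (by linarith)]
  have : 0 < (1 - y) * (1 - x) := mul_pos (by linarith) (by linarith)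
  apply div_nonneg _ this.le; linarith

lemma frontTerm_strictMono {x y : ℝ} (h : x < y) (hy : y < 1) : frontTerm x < frontTerm y := by
  rw [← sub_pos, frontTerm_sub hy (by linarith)]
  have : 0 < (1 - y) * (1 - x) := mul_pos (by linarith) (by linarith)
  apply div_pos _ this; linarith

lemma backTerm_mono {x y : ℝ} (h : x ≤ y) (hy : y ≤ 1) : backTerm x ≤ backTerm y := by
  have h1 : q * y < 1 := by nlinarith [q_pos, q_lt_one]
  have h2 : q * x < 1 := by nlinarith [q_pos, q_lt_one]
  rw [← sub_nonneg, backTerm_sub h1 h2]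
  have : 0 < (1 - q * y) * (1 - q * x) := mul_pos (by linarith) (by linarith)
  apply div_nonneg _ this.le; nlinarith [q_pos]

lemma coord_block (n : ℕ) (a : ℕ → ℕ+) :
    coord (prependTwos n (rayCons 1 a)) = (-q) ^ n * coord (rayCons 1 a) := coord_prependTwos _ _

lemma coord_block_odd {n : ℕ} (hn : Odd n) (a : ℕ → ℕ+) :
    coord (prependTwos n (rayCons 1 a)) = q ^ n * -coord (rayCons 1 a) := by
  rw [coord_block, hn.neg_pow]; ring

lemma coord_block_even {n : ℕ} (hn : Even n) (a : ℕ → ℕ+) :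
    coord (prependTwos n (rayCons 1 a)) = q ^ n * coord (rayCons 1 a) := by
  rw [coord_block, hn.neg_pow]

lemma abs_coord_le {a : ℕ → ℕ+} (ha : OneTwo a) : |coord a| ≤ 589 / 1000 := by
  have := ha.coord_mem
  rw [abs_le]; constructor <;> linarith

lemma abs_coord_prependTwos_le (n : ℕ) {a : ℕ → ℕ+} (ha : OneTwo a) :
    |coord (prependTwos n a)| ≤ q ^ n * (589 / 1000) := by
  rw [coord_prependTwos, abs_mul, abs_pow, abs_neg, abs_of_pos q_pos]
  exact mul_le_mul_of_nonneg_left (abs_coord_le ha) (pow_nonneg q_pos.le n)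

lemma q_pow_le {m n : ℕ} (h : m ≤ n) : q ^ n ≤ q ^ m :=
  pow_le_pow_of_le_one q_pos.le q_lt_one.le h

lemma q_pow_five : q ^ 5 ≤ 15 / 100000 :=
  (pow_le_pow_left₀ q_pos.le q_ub.le 5).trans (by norm_num)

/-- A digit `1` followed by a long block of twos pins the coordinate. -/
lemma coord_one_near {a : ℕ → ℕ+} (ha : |coord a| ≤ 12 / 100000) :
    -5470 / 10000 ≤ coord (rayCons 1 a) ∧ coord (rayCons 1 a) ≤ -5468 / 10000 := by
  have h3 := sqrt_two_lb
  have h4 := sqrt_two_ub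
  obtain ⟨h1, h2⟩ := abs_le.mp ha
  rw [coord_rayCons_one]
  unfold oneMap oneDen
  have e : 0 < 3 + √2 - (√2 - 1) * coord a := by nlinarith
  rw [le_div_iff₀ e, div_le_iff₀ e]
  constructor <;> nlinarith

lemma abs_coord_prependTwos_le_of_five_le {n : ℕ} (hn : 5 ≤ n) {a : ℕ → ℕ+} (ha : OneTwo a) :
    |coord (prependTwos n a)| ≤ 1 / 10000 := by
  have h1 := abs_coord_prependTwos_le n ha
  have h2 := (q_pow_le hn).trans q_pow_five
  linarith

/-- Lower bound for the heights at the positions of `θ(ω_k)` with largest `λ`. -/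
lemma le_frontTerm_add_backTerm {Q x y : ℝ} (hQ : 0 < Q) (hx : 5468 / 10000 * Q ≤ x) (hx1 : x < 1)
    (hy : 0 ≤ y) (hy1 : y ≤ 1) : 10936 / 10000 * Q ≤ frontTerm x + backTerm y := by
  have h0 := backTerm_mono hy hy1
  have h1 : backTerm 0 = 0 := by simp [backTerm]
  have h2 : 2 * x ≤ frontTerm x := by
    unfold frontTerm
    rw [le_div_iff₀ (by linarith)]
    nlinarith
  linarith

lemma frontTerm_add_backTerm_le_of_neg {Q x y : ℝ} (hQ : 0 < Q) (hQ1 : Q ≤ 15 / 100000)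
    (hx : x ≤ 5471 / 10000 * Q) (hy : y ≤ -3177 / 10000 * (q * Q)) :
    frontTerm x + backTerm y ≤ 10936 / 10000 * Q := by
  have q1 := q_lb
  have q2 := q_ub
  have hq : q * Q ≤ 1 := by nlinarith
  have hq' : 0 < q * Q := mul_pos q_pos hQ
  have h1 := frontTerm_mono hx (by linarith)
  have h2 := backTerm_mono hy (by linarith)
  have h3 : frontTerm (5471 / 10000 * Q) ≤ 10944 / 10000 * Q := by
    unfold frontTerm
    rw [div_le_iff₀ (by linarith)]
    nlinarith
  have h4 : backTerm (-3177 / 10000 * (q * Q)) ≤ -90 / 10000 * Q := by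
    unfold backTerm
    rw [div_le_iff₀ (by nlinarith)]
    have : 29 / 1000 * Q ≤ q * (q * Q) := by nlinarith
    nlinarith
  linarith

lemma frontTerm_add_backTerm_le_of_small {Q x y : ℝ} (hQ : 0 < Q) (hQ1 : Q ≤ 15 / 100000)
    (hx : x ≤ 2 / 100 * Q) (hy : y ≤ 6 / 10 * Q) :
    frontTerm x + backTerm y ≤ 10936 / 10000 * Q := by
  have q1 := q_lb
  have q2 := q_ub
  have h1 := frontTerm_mono hx (by linarith)
  have h2 := backTerm_mono hy (by linarith)
  have h3 : frontTerm (2 / 100 * Q) ≤ 1 / 10 * Q := by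
    unfold frontTerm
    rw [div_le_iff₀ (by linarith)]
    nlinarith
  have h4 : backTerm (6 / 10 * Q) ≤ 2 / 10 * Q := by
    unfold backTerm
    have : q * (6 / 10 * Q) ≤ 11 / 100 * Q := by nlinarith
    rw [div_le_iff₀ (by nlinarith)]
    nlinarith
  linarith

lemma height_mono {s : ℝ} {x y : ℝ} (h : frontTerm x + backTerm y ≤ s) :
    height x y ≤ 1 + 3 / √2 + √2 * s := by
  unfold height
  have := mul_le_mul_of_nonneg_left h (Real.sqrt_nonneg 2)
  linarith

lemma three_le_height : (3 : ℝ) ≤ 1 + 3 / √2 := by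
  have h3 := sqrt_two_lb
  have h4 := sqrt_two_ub
  have : 2 ≤ 3 / √2 := by rw [le_div_iff₀ (by linarith)]; linarith
  linarith

/-- Two blocks of the periodic word, read after `… 1 2_N 1 2_{N+1} 1 2_{N+2} 1`: the value of `λ`
at the first position dominates the other ones. -/
lemma ReadsAt.lam_le_two_blocks {N : ℕ} (hN : Odd N) (h5 : 5 ≤ N)
    {θ : ℤ → ℕ+} {i : ℤ} {A Y : ℕ → ℕ+} (hA : OneTwo A)
    (hY1 : OneTwo Y) (hY : |coord Y| ≤ 1 / 10000) (hA1 : coord A ≤ 6 / 10 * q ^ N)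
    (h : ReadsAt θ i (prependBlocks [N, N + 1] A) Y) {M : ℝ}
    (hM : 1 + 3 / √2 + √2 * (10936 / 10000 * q ^ N) ≤ M)
    (hm : height (coord (prependBlocks [N, N + 1] A)) (coord Y) ≤ M)
    {t : ℤ} (ht1 : i ≤ t) (ht2 : t < i + (2 * N + 3)) : lam θ t ≤ M := by
  have q0 := q_pos
  have hQ : 0 < q ^ N := pow_pos q_pos N
  have hQ1 : q ^ N ≤ 15 / 100000 := (q_pow_le h5).trans q_pow_five
  have hM3 : 3 ≤ M := by
    have := three_le_height
    have : 0 ≤ √2 * (10936 / 10000 * q ^ N) := by positivity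
    linarith
  have hev : Even (N + 1) := hN.add_one
  have e1 := coord_block_even hev A
  have c1 := hA.coord_one_mem
  rw [pow_succ] at e1
  have hqQ : 0 < q * q ^ N := mul_pos q_pos hQ
  by_cases ht : t < i + N + 1
  · refine ReadsAt.lam_le h hM3 hm ?_ ht1 ht
    refine (height_mono ?_).trans hM
    apply frontTerm_add_backTerm_le_of_neg hQ hQ1
    · rw [coord_block_odd hN]
      have := (coord_one_near (hY.trans (by norm_num))).1
      nlinarith
    · simp only [prependBlocks]
      rw [e1]; nlinarith [c1.2]
  · refine ReadsAt.lam_le h.move hM3 ?_ ?_ (by omega) (by push_cast; omega)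
    · refine (height_mono ?_).trans hM
      apply frontTerm_add_backTerm_le_of_small hQ hQ1
      · simp only [prependBlocks]
        rw [e1]; nlinarith [c1.2]
      · rw [coord_block_odd hN]
        have := hY1.coord_one_mem
        nlinarith
    · refine (height_mono ?_).trans hM
      apply frontTerm_add_backTerm_le_of_small hQ hQ1
      · rw [coord_block_even hev, pow_succ]
        have := (hY1.rayCons_one.prependTwos N).coord_one_mem
        nlinarith
      · exact hA1

lemma ReadsAt.lam_le_period {N : ℕ} (hN : Odd N) (h5 : 5 ≤ N)
    {θ : ℤ → ℕ+} {i : ℤ} {A Y : ℕ → ℕ+} (hA : OneTwo A)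
    (hY1 : OneTwo Y) (hY : |coord Y| ≤ 1 / 10000) (hA1 : coord A ≤ 6 / 10 * q ^ N)
    (h : ReadsAt θ i (prependBlocks [N, N + 1, N + 2] A) Y) {M : ℝ}
    (hM : 1 + 3 / √2 + √2 * (10936 / 10000 * q ^ N) ≤ M)
    (hm : height (coord (prependBlocks [N, N + 1, N + 2] A)) (coord Y) ≤ M)
    {t : ℤ} (ht1 : i ≤ t) (ht2 : t < i + (3 * N + 6)) : lam θ t ≤ M := by
  have q0 := q_pos
  have q2 := q_ub
  have hQ : 0 < q ^ N := pow_pos q_pos N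
  have hQ1 : q ^ N ≤ 15 / 100000 := (q_pow_le h5).trans q_pow_five
  have hM3 : 3 ≤ M := by
    have := three_le_height
    have : 0 ≤ √2 * (10936 / 10000 * q ^ N) := by positivity
    linarith
  have hev : Odd (N + 2) := hN.add_even (by decide)
  have small : ∀ a, OneTwo a → coord (prependTwos (N + 2) (rayCons 1 a)) ≤ 2 / 100 * q ^ N := by
    intro a ha
    have := ha.coord_one_mem
    have e : q ^ (N + 2) = q ^ 2 * q ^ N := by ring
    have e' : q ^ 2 ≤ 30 / 1000 := by nlinarith
    rw [coord_block_odd hev, e]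
    have : q ^ 2 * q ^ N ≤ 30 / 1000 * q ^ N := by nlinarith
    have : 0 < q ^ 2 * q ^ N := by positivity
    nlinarith
  by_cases ht : t < i + (2 * N + 3)
  · refine ReadsAt.lam_le_two_blocks (A := prependBlocks [N + 2] A) hN h5
      (hA.prependBlocks _) hY1 hY ?_ h hM hm ht1 ht
    have := small A hA
    simp only [prependBlocks]
    linarith
  · refine ReadsAt.lam_le h.move.move hM3 ?_ ?_ (by push_cast; omega) (by push_cast; omega)
    · refine (height_mono ?_).trans hM
      apply frontTerm_add_backTerm_le_of_small hQ hQ1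
      · exact small A hA
      · rw [coord_block_even hN.add_one]
        have := (hY1.rayCons_one.prependTwos N).coord_one_mem
        have : 0 < q ^ (N + 1) := pow_pos q_pos _
        nlinarith
    · refine (height_mono ?_).trans hM
      apply frontTerm_add_backTerm_le_of_small hQ hQ1
      · exact small _ ((hY1.rayCons_one.prependTwos N).rayCons_one.prependTwos (N + 1))
      · exact hA1

/-- Lower and upper bounds for the dominant values of `λ`. -/
lemma height_mem_of_blocks {N : ℕ} (hN : Odd N) (h5 : 5 ≤ N)
    {A C : ℕ → ℕ+} (hA1 : |coord A| ≤ 1 / 10000)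
    (hC : OneTwo C) :
    1 + 3 / √2 + √2 * (10936 / 10000 * q ^ N)
        ≤ height (coord (prependTwos N (rayCons 1 A))) (coord (prependTwos (N + 2) (rayCons 1 C))) ∧
      height (coord (prependTwos N (rayCons 1 A))) (coord (prependTwos (N + 2) (rayCons 1 C)))
        ≤ 1 + 3 / √2 + √2 * (2 * q ^ N) := by
  have q0 := q_pos
  have q2 := q_ub
  have hQ : 0 < q ^ N := pow_pos q_pos N
  have hQ1 : q ^ N ≤ 15 / 100000 := (q_pow_le h5).trans q_pow_five
  have hev : Odd (N + 2) := hN.add_even (by decide)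
  have c1 := coord_one_near (hA1.trans (by norm_num))
  have c2 := hC.coord_one_mem
  have e : q ^ (N + 2) = q ^ 2 * q ^ N := by ring
  have e' : q ^ 2 ≤ 30 / 1000 := by nlinarith
  have e3 : q ^ (N + 2) ≤ 30 / 1000 * q ^ N := by rw [e]; nlinarith
  have e4 : 0 < q ^ (N + 2) := pow_pos q_pos _
  rw [coord_block_odd hN, coord_block_odd hev]
  set x := q ^ N * -coord (rayCons 1 A) with hx
  set y := q ^ (N + 2) * -coord (rayCons 1 C) with hy
  have x1 : 5468 / 10000 * q ^ N ≤ x := by rw [hx]; nlinarith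
  have x2 : x ≤ 5470 / 10000 * q ^ N := by rw [hx]; nlinarith
  have y1 : 0 ≤ y := by rw [hy]; nlinarith
  have y2 : y ≤ 30 / 1000 * q ^ N := by rw [hy]; nlinarith
  constructor
  · have := le_frontTerm_add_backTerm hQ x1 (by linarith) y1 (by linarith)
    unfold height
    have := mul_le_mul_of_nonneg_left this (Real.sqrt_nonneg 2)
    linarith
  · apply height_mono
    have h1 : frontTerm x ≤ 12 / 10 * q ^ N := by
      unfold frontTerm
      rw [div_le_iff₀ (by linarith)]
      nlinarith
    have h2 : backTerm y ≤ 1 / 10 * q ^ N := by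
      unfold backTerm
      have : q * y ≤ 6 / 1000 * q ^ N := by nlinarith
      rw [div_le_iff₀ (by nlinarith)]
      nlinarith
    linarith

/-! ### The Markov values of `θ(ω_k)` and `γ_k^1` -/

lemma markovValue_eq_of_forall_le {θ : ℤ → ℕ+} {i : ℤ} (h : ∀ t, lam θ t ≤ lam θ i) :
    BddAbove (Set.range (lam θ)) ∧ markovValue θ = lam θ i := by
  have hb : BddAbove (Set.range (lam θ)) := ⟨lam θ i, by rintro _ ⟨t, rfl⟩; exact h t⟩
  exact ⟨hb, le_antisymm (ciSup_le h) (le_ciSup hb i)⟩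

lemma lam_periodic {θ : ℤ → ℕ+} {p : ℤ} (h : Function.Periodic θ p) :
    Function.Periodic (lam θ) p := by
  intro i
  rw [lam_eq, lam_eq, rightRay_add_period h, show i + p - 1 = i - 1 + p by ring,
    leftRay_add_period h]

/-- The height of the dominant positions of `θ(ω_k)`. -/
def omegaHeight (k : ℕ) : ℝ := height (coord (omegaRight k)) (coord (omegaLeft k))

/-- The height of the origin of `γ_k^1`. -/
def gammaHeight (k : ℕ) : ℝ := height (coord (gammaRight k)) (coord (omegaLeft k))

lemma odd_two_mul_sub_one {k : ℕ} (hk : 1 ≤ k) : Odd (2 * k - 1) := ⟨k - 1, by omega⟩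

lemma coord_block_le {N : ℕ} (hN : Odd N) {a : ℕ → ℕ+} (ha : OneTwo a) :
    coord (prependTwos N (rayCons 1 a)) ≤ 6 / 10 * q ^ N := by
  have := ha.coord_one_mem
  have : 0 < q ^ N := pow_pos q_pos N
  rw [coord_block_odd hN]
  nlinarith

lemma omegaLeft_near {k : ℕ} (hk : 3 ≤ k) : |coord (omegaLeft k)| ≤ 1 / 10000 := by
  rw [omegaLeft_eq (by omega)]
  exact abs_coord_prependTwos_le_of_five_le (by omega)
    ((omegaLeft_oneTwo k).prependBlocks [2 * k - 1 + 1, 2 * k - 1]).rayCons_one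

lemma height_omegaLeft_mem {k : ℕ} (hk : 3 ≤ k) {a : ℕ → ℕ+} (ha : |coord a| ≤ 1 / 10000) :
    1 + 3 / √2 + √2 * (10936 / 10000 * q ^ (2 * k - 1))
        ≤ height (coord (prependTwos (2 * k - 1) (rayCons 1 a))) (coord (omegaLeft k)) ∧
      height (coord (prependTwos (2 * k - 1) (rayCons 1 a))) (coord (omegaLeft k))
        ≤ 1 + 3 / √2 + √2 * (2 * q ^ (2 * k - 1)) := by
  rw [omegaLeft_eq (by omega)]
  exact height_mem_of_blocks (odd_two_mul_sub_one (by omega)) (by omega) ha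
    ((omegaLeft_oneTwo k).prependBlocks [2 * k - 1 + 1, 2 * k - 1])

lemma omegaHeight_mem {k : ℕ} (hk : 3 ≤ k) :
    1 + 3 / √2 + √2 * (10936 / 10000 * q ^ (2 * k - 1)) ≤ omegaHeight k ∧
      omegaHeight k ≤ 1 + 3 / √2 + √2 * (2 * q ^ (2 * k - 1)) := by
  rw [omegaHeight, omegaRight_eq (by omega)]
  exact height_omegaLeft_mem hk (abs_coord_prependTwos_le_of_five_le (by omega)
    ((omegaRight_oneTwo k).prependBlocks [2 * k - 1 + 2]).rayCons_one)

lemma gammaHeight_mem {k : ℕ} (hk : 3 ≤ k) :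
    1 + 3 / √2 + √2 * (10936 / 10000 * q ^ (2 * k - 1)) ≤ gammaHeight k ∧
      gammaHeight k ≤ 1 + 3 / √2 + √2 * (2 * q ^ (2 * k - 1)) :=
  height_omegaLeft_mem hk (abs_coord_prependTwos_le_of_five_le (by omega)
    (oneTwo_const_two.rayCons_one.prependBlocks
      [2 * k - 1 + 2, 2 * k - 1, 2 * k - 1 + 1, 2 * k - 1]).rayCons_one)

lemma markovValue_thetaOmega {k : ℕ} (hk : 3 ≤ k) :
    markovValue (thetaOmega k) = omegaHeight k := by
  have hr := readsAt_thetaOmega (k := k) (by omega)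
  have h0 : lam (thetaOmega k) 0 = omegaHeight k := hr.lam_eq
  rw [← h0]
  refine (markovValue_eq_of_forall_le fun t => ?_).2
  have hl := length_omega k (by omega)
  have hp := (lam_periodic (thetaOmega_periodic k)).sub_zsmul_eq (t / (omega k).length) (x := t)
  have hmod := Int.emod_add_mul_ediv t (omega k).length
  have h1 := Int.emod_nonneg t (b := (omega k).length) (by omega)
  have h2 := Int.emod_lt_of_pos t (b := (omega k).length) (by omega)
  rw [← hp]
  have e : t - (t / (omega k).length) • ((omega k).length : ℤ) = t % (omega k).length := by
    rw [smul_eq_mul, mul_comm]; linarith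
  rw [e, h0]
  have hm : height (coord (omegaRight k)) (coord (omegaLeft k)) ≤ omegaHeight k := le_rfl
  rw [omegaRight_eq (by omega)] at hr hm
  refine ReadsAt.lam_le_period (odd_two_mul_sub_one (by omega)) (by omega) (omegaRight_oneTwo k)
    (omegaLeft_oneTwo k) (omegaLeft_near hk) ?_ hr (omegaHeight_mem hk).1 hm h1 (by omega)
  rw [omegaRight_eq (by omega)]
  exact coord_block_le (odd_two_mul_sub_one (by omega))
    ((omegaRight_oneTwo k).prependBlocks [2 * k - 1 + 1, 2 * k - 1 + 2])

/-- Putting `ω_k` in front of a ray moves its coordinate to the other side of the coordinate of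
`ω_k ω_k …`, and closer to it. -/
lemma coord_prepend_omega_sub {k : ℕ} (hk : 1 ≤ k) {a : ℕ → ℕ+} (ha : OneTwo a) :
    ∃ c : ℝ, 0 < c ∧ c ≤ 1 ∧
      coord (prependBlocks [2 * k - 1, 2 * k - 1 + 1, 2 * k - 1 + 2] a) - coord (omegaRight k)
        = -c * (coord a - coord (omegaRight k)) := by
  obtain ⟨c, h1, h2, h3⟩ := coord_prependBlocks_sub
    [2 * k - 1, 2 * k - 1 + 1, 2 * k - 1 + 2] ha (omegaRight_oneTwo k)
  refine ⟨c, lt_of_lt_of_le (by have := q_pos; positivity) h1, h2.trans ?_, ?_⟩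
  · exact mul_le_one₀ (pow_le_one₀ q_pos.le q_lt_one.le) (by positivity) (by norm_num)
  · rw [← omegaRight_eq hk] at h3
    rw [h3]
    have : Odd ([2 * k - 1, 2 * k - 1 + 1, 2 * k - 1 + 2].sum
        + [2 * k - 1, 2 * k - 1 + 1, 2 * k - 1 + 2].length) := by
      refine ⟨3 * k + 1, ?_⟩
      simp; omega
    rw [this.neg_one_pow]; ring

lemma gammaRight_eq (k : ℕ) :
    gammaRight k = prependBlocks [2 * k - 1, 2 * k - 1 + 1, 2 * k - 1 + 2]
      (prependBlocks [2 * k - 1, 2 * k - 1 + 1, 2 * k - 1] (rayCons 1 (fun _ => 2))) := rfl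

lemma coord_const_two : coord (fun _ => (2 : ℕ+)) = 0 := by
  have : (fun _ => (2 : ℕ+)) = rayCons 2 (fun _ => 2) := (rayCons_tail (fun _ => 2)).symm
  have h := coord_rayCons_two (fun _ => 2)
  rw [← this] at h
  have := q_pos
  nlinarith

lemma coord_one_one_const_two : coord (rayCons 1 (rayCons 1 (fun _ => 2))) = -1 / 3 := by
  have s0 := sqrt_two_lb
  have s1 := sqrt_two_ub
  have s2 := sqrt_two_mul
  rw [coord_rayCons_one, coord_rayCons_one, coord_const_two]
  unfold oneMap oneDen
  have d1 : 3 + √2 ≠ 0 := by linarith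
  have d2 : 8 + 8 * √2 ≠ 0 := by linarith
  have e1 : 3 + √2 - (√2 - 1) * (-(1 + √2 + (3 - √2) * 0) / (3 + √2 - (√2 - 1) * 0))
      = (12 + 6 * √2) / (3 + √2) := by
    simp only [mul_zero, add_zero, sub_zero]
    field_simp
    linear_combination 2 * s2
  have d3 : 12 + 6 * √2 ≠ 0 := by linarith
  rw [e1]
  simp only [mul_zero, add_zero, sub_zero]
  field_simp
  linear_combination (-6) * s2

/-- The ray of `γ_k^1` after its first period lies below that of `θ(ω_k)`, with explicit bounds for
the difference of the coordinates. -/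
lemma coord_second_sub {k : ℕ} (hk : 1 ≤ k) :
    coord (omegaRight k)
      - coord (prependBlocks [2 * k - 1, 2 * k - 1 + 1, 2 * k - 1] (rayCons 1 (fun _ => 2))) ∈
      Set.Ioc 0 (q ^ (3 * (2 * k - 1) + 1) * (419 / 1000) ^ 2 * (33 / 100)) := by
  have hR := omegaRight_oneTwo k
  obtain ⟨c, h1, h2, h3⟩ := coord_prependBlocks_sub [2 * k - 1, 2 * k - 1 + 1]
    (a := prependTwos (2 * k - 1) (rayCons 1 (rayCons 1 (fun _ => 2))))
    (b := prependTwos (2 * k - 1) (rayCons 2 (rayCons 2 (rayCons 1 (omegaRight k)))))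
    (oneTwo_const_two.rayCons_one.rayCons_one.prependTwos _)
    (hR.rayCons_one.rayCons_two.rayCons_two.prependTwos _)
  have e : prependBlocks [2 * k - 1, 2 * k - 1 + 1]
      (prependTwos (2 * k - 1) (rayCons 2 (rayCons 2 (rayCons 1 (omegaRight k))))) =
      omegaRight k := by
    conv_rhs => rw [omegaRight_eq hk]
    simp only [prependBlocks, prependTwos_add]
    rfl
  have c0 : 0 < c := lt_of_lt_of_le (by have := q_pos; positivity) h1
  have hodd := odd_two_mul_sub_one hk
  have hs : Odd ([2 * k - 1, 2 * k - 1 + 1].sum + [2 * k - 1, 2 * k - 1 + 1].length) := by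
    refine ⟨2 * k, ?_⟩
    simp; omega
  rw [e, coord_prependTwos, coord_prependTwos, ← mul_sub, hs.neg_one_pow, hodd.neg_pow] at h3
  set w := coord (rayCons 2 (rayCons 2 (rayCons 1 (omegaRight k)))) with hw
  have hw1 : -1 / 3 - w ≤ -30 / 100 ∧ -33 / 100 ≤ -1 / 3 - w := by
    rw [hw, coord_rayCons_two, coord_rayCons_two]
    have := hR.coord_one_mem
    have q1 := q_lb
    have q2 := q_ub
    have q3 : 294 / 10000 < q * q := by nlinarith
    have q4 : q * q < 295 / 10000 := by nlinarith
    constructor <;> nlinarith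
  have hE : coord (prependBlocks [2 * k - 1, 2 * k - 1 + 1, 2 * k - 1] (rayCons 1 (fun _ => 2)))
      - coord (omegaRight k) = c * q ^ (2 * k - 1) * (-1 / 3 - w) := by
    rw [← coord_one_one_const_two]
    have : prependBlocks [2 * k - 1, 2 * k - 1 + 1, 2 * k - 1] (rayCons 1 (fun _ => 2)) =
      prependBlocks [2 * k - 1, 2 * k - 1 + 1]
        (prependTwos (2 * k - 1) (rayCons 1 (rayCons 1 (fun _ => 2)))) := rfl
    rw [this, h3]; ring
  have hQ : 0 < q ^ (2 * k - 1) := pow_pos q_pos _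
  constructor
  · have : 0 < c * q ^ (2 * k - 1) := by positivity
    nlinarith
  · have h4 : c * q ^ (2 * k - 1) ≤ q ^ (3 * (2 * k - 1) + 1) * (419 / 1000) ^ 2 := by
      calc c * q ^ (2 * k - 1) ≤ (q ^ [2 * k - 1, 2 * k - 1 + 1].sum
            * (419 / 1000) ^ [2 * k - 1, 2 * k - 1 + 1].length) * q ^ (2 * k - 1) := by gcongr
        _ = _ := by
          simp only [List.sum_cons, List.sum_nil, List.length_cons, List.length_nil]
          rw [show 3 * (2 * k - 1) + 1 = (2 * k - 1 + (2 * k - 1 + 1 + 0)) + (2 * k - 1) by omega,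
            pow_add]
          ring
    have : 0 < c * q ^ (2 * k - 1) := by positivity
    nlinarith

lemma coord_omegaRight_lt_gammaRight {k : ℕ} (hk : 1 ≤ k) :
    coord (omegaRight k) < coord (gammaRight k) := by
  obtain ⟨c, h1, -, h3⟩ := coord_prepend_omega_sub hk
    (oneTwo_const_two.rayCons_one.prependBlocks [2 * k - 1, 2 * k - 1 + 1, 2 * k - 1])
  rw [← gammaRight_eq] at h3
  have := (coord_second_sub hk).1
  nlinarith

lemma omegaHeight_lt_gammaHeight {k : ℕ} (hk : 1 ≤ k) : omegaHeight k < gammaHeight k := by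
  have h1 := frontTerm_strictMono (coord_omegaRight_lt_gammaRight hk)
    (by linarith [(gammaRight_oneTwo k).coord_mem.2])
  unfold omegaHeight gammaHeight height
  have := mul_lt_mul_of_pos_left h1 (show (0 : ℝ) < √2 by positivity)
  linarith

lemma height_le_height {x x' y : ℝ} (h : x ≤ x') (h1 : x' < 1) : height x y ≤ height x' y := by
  have h1 := frontTerm_mono h h1
  unfold height
  have := mul_le_mul_of_nonneg_left h1 (show (0 : ℝ) ≤ √2 by positivity)
  linarith

/-- The rays of `γ_k^1` to the right of the positions `-j |ω_k|` have coordinates at most that of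
the ray at the origin. -/
lemma exists_readsAt_gammaOne {k : ℕ} (hk : 1 ≤ k) (j : ℕ) :
    ∃ a, OneTwo a ∧
      ReadsAt (gammaOne k) (-(j * (3 * (2 * k - 1 : ℕ) + 6)))
        (prependBlocks [2 * k - 1, 2 * k - 1 + 1, 2 * k - 1 + 2] a) (omegaLeft k) ∧
      coord a ≤ 6 / 10 * q ^ (2 * k - 1) ∧
      |coord (prependBlocks [2 * k - 1, 2 * k - 1 + 1, 2 * k - 1 + 2] a) - coord (omegaRight k)|
        ≤ coord (gammaRight k) - coord (omegaRight k) := by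
  have hodd := odd_two_mul_sub_one hk
  have hlt := coord_omegaRight_lt_gammaRight hk
  induction j with
  | zero =>
    refine ⟨prependBlocks [2 * k - 1, 2 * k - 1 + 1, 2 * k - 1] (rayCons 1 (fun _ => 2)),
      oneTwo_const_two.rayCons_one.prependBlocks _, ?_, ?_, ?_⟩
    · rw [← gammaRight_eq]
      simpa using readsAt_gammaOne hk
    · exact coord_block_le hodd
        (oneTwo_const_two.rayCons_one.prependBlocks [2 * k - 1 + 1, 2 * k - 1])
    · rw [← gammaRight_eq, abs_of_pos (by linarith)]
  | succ j ih =>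
    obtain ⟨a, ha, hr, h1, h2⟩ := ih
    refine ⟨_, ha.prependBlocks [2 * k - 1, 2 * k - 1 + 1, 2 * k - 1 + 2], ?_, ?_, ?_⟩
    · rw [omegaLeft_eq hk] at hr
      have := hr.moveBlocksBack
      convert this using 1
      · generalize 2 * k - 1 = N
        simp only [List.sum_cons, List.sum_nil, List.length_cons, List.length_nil]
        push_cast; ring
      · rfl
    · exact coord_block_le hodd (ha.prependBlocks [2 * k - 1 + 1, 2 * k - 1 + 2])
    · obtain ⟨c, c0, c1, h3⟩ := coord_prepend_omega_sub hk
        (ha.prependBlocks [2 * k - 1, 2 * k - 1 + 1, 2 * k - 1 + 2])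
      rw [h3, abs_mul, abs_neg, abs_of_pos c0]
      have := abs_nonneg
        (coord (prependBlocks [2 * k - 1, 2 * k - 1 + 1, 2 * k - 1 + 2] a) - coord (omegaRight k))
      nlinarith

lemma three_le_gammaHeight {k : ℕ} (hk : 3 ≤ k) : 3 ≤ gammaHeight k := by
  have h1 := three_le_height
  have h2 := (gammaHeight_mem hk).1
  have : 0 ≤ √2 * (10936 / 10000 * q ^ (2 * k - 1)) :=
    mul_nonneg (Real.sqrt_nonneg _) (mul_nonneg (by norm_num) (pow_nonneg q_pos.le _))
  linarith

/-- `λ` is at most its value at the origin at all positions of `γ_k^1` in the periodic part. -/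
lemma lam_gammaOne_le_of_lt {k : ℕ} (hk : 3 ≤ k) {t : ℤ} (ht : t < 3 * (2 * k - 1 : ℕ) + 6) :
    lam (gammaOne k) t ≤ gammaHeight k := by
  have hk1 : 1 ≤ k := by omega
  have hodd := odd_two_mul_sub_one hk1
  have hM := (gammaHeight_mem hk).1
  have hG := (gammaRight_oneTwo k).coord_mem
  set N := 2 * k - 1 with hNdef
  set P : ℤ := 3 * N + 6 with hP
  have hmod := Int.emod_add_mul_ediv t P
  have h1 := Int.emod_nonneg t (b := P) (by omega)
  have h2 := Int.emod_lt_of_pos t (b := P) (by omega)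
  have hle : t / P ≤ 0 := by
    by_contra hcon
    have : 1 ≤ t / P := by omega
    nlinarith
  obtain ⟨a, ha, hra, ha1, ha2⟩ := exists_readsAt_gammaOne hk1 (-(t / P)).toNat
  have hj : (((-(t / P)).toNat : ℕ) : ℤ) = -(t / P) := by omega
  have e : -((((-(t / P)).toNat : ℕ) : ℤ) * (3 * ((2 * k - 1 : ℕ) : ℤ) + 6)) = t - t % P := by
    rw [hj, ← hNdef, ← hP]; linarith
  rw [e] at hra
  refine hra.lam_le_period hodd (by omega) ha (omegaLeft_oneTwo k) (omegaLeft_near hk) ha1 hM ?_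
    (by omega) (by omega)
  refine height_le_height ?_ (by linarith)
  have := (abs_le.mp ha2).2
  linarith

lemma readsAt_gammaOne_second {k : ℕ} (hk : 1 ≤ k) :
    ReadsAt (gammaOne k) (3 * (2 * k - 1 : ℕ) + 6)
      (prependBlocks [2 * k - 1, 2 * k - 1 + 1]
        (prependBlocks [2 * k - 1] (rayCons 1 (fun _ => 2)))) (omegaLeft k) := by
  have hr := readsAt_gammaOne hk
  rw [gammaRight_eq] at hr
  have := hr.moveBlocks
  rw [omegaLeft_eq hk]
  convert this using 1
  · generalize 2 * k - 1 = N
    simp only [List.sum_cons, List.sum_nil, List.length_cons, List.length_nil]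
    push_cast; ring
  · rfl
  · rfl

lemma coord_rayCons_one_le {a : ℕ → ℕ+} (ha : OneTwo a) {Q : ℝ} (h0 : 0 < Q) (h1 : Q ≤ 1) :
    coord (rayCons 1 a) ≤ -3177 / 10000 * (q * Q) := by
  have := ha.coord_one_mem.2
  have : q * Q ≤ 1 := mul_le_one₀ q_lt_one.le h0.le h1
  linarith

lemma lam_gammaOne_le_of_ge {k : ℕ} (hk : 3 ≤ k) {t : ℤ} (ht : 3 * (2 * k - 1 : ℕ) + 6 ≤ t) :
    lam (gammaOne k) t ≤ gammaHeight k := by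
  have hk1 : 1 ≤ k := by omega
  have hr2 := readsAt_gammaOne_second hk1
  have hodd := odd_two_mul_sub_one hk1
  have hM := (gammaHeight_mem hk).1
  have hM3 := three_le_gammaHeight hk
  have hY := omegaLeft_near hk
  have hY1 := omegaLeft_oneTwo k
  have hQ : 0 < q ^ (2 * k - 1) := pow_pos q_pos _
  have hG := (gammaRight_oneTwo k).coord_mem
  have hx : coord (prependBlocks [2 * k - 1, 2 * k - 1 + 1]
      (prependBlocks [2 * k - 1] (rayCons 1 (fun _ => 2)))) ≤ coord (gammaRight k) := by
    have h1 := (coord_second_sub hk1).1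
    have h2 := coord_omegaRight_lt_gammaRight hk1
    change coord (prependBlocks [2 * k - 1, 2 * k - 1 + 1, 2 * k - 1] (rayCons 1 (fun _ => 2))) ≤ _
    linarith
  have hm := height_le_height (y := coord (omegaLeft k)) hx (by linarith)
  change _ ≤ gammaHeight k at hm
  generalize gammaHeight k = M at *
  generalize gammaOne k = θ at *
  generalize omegaLeft k = Y at *
  have h5 : 5 ≤ 2 * k - 1 := by omega
  generalize 2 * k - 1 = N at *
  have hQ1 : q ^ N ≤ 15 / 100000 := (q_pow_le h5).trans q_pow_five
  by_cases ht' : t < 3 * N + 6 + (2 * N + 3)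
  · exact hr2.lam_le_two_blocks hodd h5 (oneTwo_const_two.rayCons_one.prependBlocks [N]) hY1 hY
      (coord_block_le hodd oneTwo_const_two.rayCons_one) hM hm (by omega) (by omega)
  have hr3 : ReadsAt θ (5 * N + 9) (prependTwos N (rayCons 1 (rayCons 1 (fun _ => 2))))
      (prependBlocks [N + 1, N] Y) := by
    convert hr2.moveBlocks using 1
    · simp only [List.sum_cons, List.sum_nil, List.length_cons, List.length_nil]
      push_cast; ring
    · rfl
    · rfl
  by_cases ht'' : t < 5 * N + 9 + N + 1
  · refine hr3.lam_le hM3 ?_ ?_ (by omega) (by omega)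
    · refine (height_mono ?_).trans hM
      apply frontTerm_add_backTerm_le_of_neg hQ hQ1
      · rw [coord_block_odd hodd, coord_one_one_const_two]
        linarith
      · have := ((hY1.prependBlocks [N])).coord_one_mem.2
        change coord (prependTwos (N + 1) (rayCons 1 (prependBlocks [N] Y))) ≤ _
        rw [coord_block_even hodd.add_one, pow_succ']
        have : 0 < q * q ^ N := mul_pos q_pos hQ
        nlinarith
    · refine (height_mono ?_).trans hM
      apply frontTerm_add_backTerm_le_of_neg hQ hQ1
      · rw [coord_block_odd hodd]
        have : |coord (prependBlocks [N + 1, N] Y)| ≤ 1 / 10000 :=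
          abs_coord_prependTwos_le_of_five_le (by omega) (hY1.prependBlocks [N]).rayCons_one
        have := (coord_one_near (this.trans (by norm_num))).1
        nlinarith
      · exact coord_rayCons_one_le oneTwo_const_two hQ (by linarith)
  have hr4 : rightRay θ (5 * N + 9 + N + 1) = rayCons 1 (fun _ => 2) := hr3.move.1
  have hr5 := ReadsAt.move (n := 0) hr3.move
  have h1one : θ (5 * N + 9 + N + 1) = 1 := by
    rw [rightRay_eq_rayCons] at hr4
    exact (rayCons_inj hr4).1
  have h2two : ∀ j : ℤ, 5 * N + 9 + N + 1 + (0 : ℕ) + 1 ≤ j → θ j = 2 := by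
    intro j hj
    have := congrFun hr5.1 (j - (5 * N + 9 + N + 1 + (0 : ℕ) + 1)).toNat
    unfold rightRay at this
    rw [← this]; congr 1; omega
  by_cases e1 : t = 5 * N + 9 + N + 1
  · rw [e1]; exact (lam_le_of_one h1one).trans hM3
  by_cases e2 : t = 5 * N + 9 + N + 1 + (0 : ℕ) + 1
  · rw [e2, hr5.lam_eq]
    refine (height_mono ?_).trans hM
    apply frontTerm_add_backTerm_le_of_neg hQ hQ1
    · rw [coord_const_two]; positivity
    · exact coord_rayCons_one_le ((hY1.prependBlocks [N + 1, N]).rayCons_one.prependTwos N) hQ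
        (by linarith)
  · exact (lam_le_of_two_two_two (h2two _ (by omega)) (h2two _ (by omega))
      (h2two _ (by omega))).trans hM3

lemma markovValue_gammaOne {k : ℕ} (hk : 3 ≤ k) :
    BddAbove (Set.range (lam (gammaOne k))) ∧ markovValue (gammaOne k) = gammaHeight k := by
  have h0 : lam (gammaOne k) 0 = gammaHeight k := (readsAt_gammaOne (by omega)).lam_eq
  rw [← h0]
  refine markovValue_eq_of_forall_le fun t => ?_
  rw [h0]
  rcases lt_or_ge t (3 * (2 * k - 1 : ℕ) + 6) with ht | ht
  · exact lam_gammaOne_le_of_lt hk ht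
  · exact lam_gammaOne_le_of_ge hk ht

lemma markovValue_thetaOmega_lt_gammaOne {k : ℕ} (hk : 3 ≤ k) :
    markovValue (thetaOmega k) < markovValue (gammaOne k) := by
  rw [markovValue_thetaOmega hk, (markovValue_gammaOne hk).2]
  exact omegaHeight_lt_gammaHeight (by omega)

lemma bddAbove_lam {θ : ℤ → ℕ+} (h : ∀ i, θ i = 1 ∨ θ i = 2) :
    BddAbove (Set.range (lam θ)) := by
  refine ⟨4, ?_⟩
  rintro _ ⟨i, rfl⟩
  rw [lam_eq_digit_add]
  have h1 := one_div_le_one_div_of_le one_pos (one_le_cfValue (rightRay θ (i + 1)))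
  have h2 := one_div_le_one_div_of_le one_pos (one_le_cfValue (leftRay θ (i - 1)))
  have h3 : (((θ i : ℕ+) : ℕ) : ℝ) ≤ 2 := by
    rcases h i with h | h <;> rw [h] <;> norm_num
  rw [one_div_one] at h1 h2
  linarith

lemma le_markovValue_thetaOmega {k : ℕ} (hk : 1 ≤ k) :
    1 + 3 / √2 + √2 * (6 / 10 * q ^ (2 * k - 1)) ≤ markovValue (thetaOmega k) := by
  refine le_trans ?_ (le_ciSup (bddAbove_lam (thetaOmega_oneTwo k)) 0)
  rw [(readsAt_thetaOmega hk).lam_eq, height]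
  have hN := odd_two_mul_sub_one hk
  have hQ : 0 < q ^ (2 * k - 1) := pow_pos q_pos _
  have hx : 3177 / 10000 * q ^ (2 * k - 1) ≤ coord (omegaRight k) := by
    rw [omegaRight_eq hk]
    have := ((omegaRight_oneTwo k).prependBlocks [2 * k - 1 + 1, 2 * k - 1 + 2]).coord_one_mem.2
    simp only [prependBlocks] at this ⊢
    rw [coord_block_odd hN]
    nlinarith
  have hx1 := (omegaRight_oneTwo k).coord_mem.2
  have hy : 0 ≤ coord (omegaLeft k) := by
    rw [omegaLeft_eq hk]
    have := ((omegaLeft_oneTwo k).prependBlocks [2 * k - 1 + 1, 2 * k - 1]).coord_one_mem.2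
    simp only [prependBlocks] at this ⊢
    rw [coord_block_odd (hN.add_even (by decide))]
    exact mul_nonneg (pow_nonneg q_pos.le _) (by linarith)
  have hy1 := backTerm_mono hy (by linarith [(omegaLeft_oneTwo k).coord_mem.2])
  have h0 : backTerm 0 = 0 := by simp [backTerm]
  have hf : 2 * coord (omegaRight k) ≤ frontTerm (coord (omegaRight k)) := by
    unfold frontTerm
    rw [le_div_iff₀ (by linarith)]
    nlinarith
  have : 6 / 10 * q ^ (2 * k - 1)
      ≤ frontTerm (coord (omegaRight k)) + backTerm (coord (omegaLeft k)) := by linarith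
  have := mul_le_mul_of_nonneg_left this (Real.sqrt_nonneg 2)
  linarith

lemma markovValue_gammaOne_lt_thetaOmega {k : ℕ} (hk : 3 ≤ k) :
    markovValue (gammaOne k) < markovValue (thetaOmega (k - 1)) := by
  refine lt_of_lt_of_le ?_ (le_markovValue_thetaOmega (by omega))
  rw [(markovValue_gammaOne hk).2]
  refine (gammaHeight_mem hk).2.trans_lt ?_
  have e : 2 * k - 1 = 2 * (k - 1) - 1 + 2 := by omega
  have hQ : 0 < q ^ (2 * (k - 1) - 1) := pow_pos q_pos _
  have hs : 0 < √2 := by positivity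
  have q2 : q ^ 2 ≤ 3 / 100 := by nlinarith [q_pos, q_ub]
  rw [e, pow_add]
  have : 2 * (q ^ (2 * (k - 1) - 1) * q ^ 2) < 6 / 10 * q ^ (2 * (k - 1) - 1) := by nlinarith
  have := mul_lt_mul_of_pos_left this hs
  linarith

lemma tendsto_markovValue_thetaOmega :
    Tendsto (fun k : ℕ => markovValue (thetaOmega k)) atTop (𝓝 (1 + 3 / √2)) := by
  have h1 : Tendsto (fun k : ℕ => 1 + 3 / √2 + √2 * (2 * q ^ (2 * k - 1))) atTop
      (𝓝 (1 + 3 / √2 + √2 * (2 * 0))) := by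
    refine ((Tendsto.const_mul _ ?_).const_mul _).const_add _
    refine (tendsto_pow_atTop_nhds_zero_of_lt_one q_pos.le q_lt_one).comp ?_
    exact tendsto_atTop_mono (fun k => by simp only [id]; omega) tendsto_id
  rw [mul_zero, mul_zero, add_zero] at h1
  refine tendsto_of_tendsto_of_tendsto_of_le_of_le' tendsto_const_nhds h1 ?_ ?_
  · filter_upwards [eventually_ge_atTop 3] with k hk
    rw [markovValue_thetaOmega hk]
    have := (omegaHeight_mem hk).1
    have : 0 ≤ √2 * (10936 / 10000 * q ^ (2 * k - 1)) :=
      mul_nonneg (Real.sqrt_nonneg _) (mul_nonneg (by norm_num) (pow_nonneg q_pos.le _))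
    linarith
  · filter_upwards [eventually_ge_atTop 3] with k hk
    rw [markovValue_thetaOmega hk]
    exact (omegaHeight_mem hk).2

/-! ### Deviations of two pairs of rays with nearly equal heights -/

/-- First part of a stage: while both model rays continue with `2`, so do the given rays. -/
lemma agree_twos_of_neg {c d : ℕ → ℕ+} (hc : -55 / 100 ≤ coord c ∧ coord c ≤ 0)
    (hd : -174 / 10000 ≤ coord d ∧ coord d ≤ 96 / 1000) {S e : ℝ} (hS1 : 465 / 1000 ≤ S)
    (hS2 : S ≤ 5075 / 10000) (he : e ≤ 1 / 1000) (m : ℕ) :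
    ∀ {a b : ℕ → ℕ+}, OneTwo a → OneTwo b →
      |coord a - coord (prependTwos m c) - S * (coord b - coord (prependTwos m d))| ≤ q ^ m * e →
      ∃ a' b', OneTwo a' ∧ OneTwo b' ∧ a = prependTwos m a' ∧ b = prependTwos m b' ∧
        |coord a' - coord c - S * (coord b' - coord d)| ≤ e := by
  have q1 := q_lb
  have q2 := q_ub
  have bc : ∀ j, -55 / 100 ≤ coord (prependTwos j c) ∧ coord (prependTwos j c) ≤ 944 / 10000 := by
    intro j
    induction j with
    | zero => exact ⟨hc.1, by simpa [prependTwos] using hc.2.trans (by norm_num)⟩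
    | succ j ih =>
      rw [prependTwos, coord_rayCons_two]
      constructor <;> nlinarith [ih.1, ih.2]
  have bd : ∀ j, -174 / 10000 ≤ coord (prependTwos j d) ∧ coord (prependTwos j d) ≤ 96 / 1000 := by
    intro j
    induction j with
    | zero => exact hd
    | succ j ih =>
      rw [prependTwos, coord_rayCons_two]
      constructor <;> nlinarith [ih.1, ih.2]
  induction m with
  | zero =>
    intro a b ha hb h
    exact ⟨a, b, ha, hb, rfl, rfl, by simpa [prependTwos] using h⟩
  | succ m ih =>
    intro a b ha hb h
    have he' : q ^ (m + 1) * e ≤ 1 / 1000 := by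
      have h1 : q ^ (m + 1) ≤ 1 := pow_le_one₀ q_pos.le q_lt_one.le
      have h2 : 0 ≤ q ^ (m + 1) := pow_nonneg q_pos.le _
      nlinarith
    have hc1 : -162 / 10000 ≤ coord (prependTwos (m + 1) c) ∧
        coord (prependTwos (m + 1) c) ≤ 944 / 10000 := by
      rw [prependTwos, coord_rayCons_two]
      constructor <;> nlinarith [(bc m).1, (bc m).2]
    have hd1 : -165 / 10000 ≤ coord (prependTwos (m + 1) d) ∧
        coord (prependTwos (m + 1) d) ≤ 3 / 1000 := by
      rw [prependTwos, coord_rayCons_two]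
      constructor <;> nlinarith [(bd m).1, (bd m).2]
    have h' := abs_le.mp (h.trans he')
    rcases ha.cases with ⟨a', ha', rfl⟩ | ⟨a', ha', rfl⟩
    · exfalso
      have k1 := ha'.coord_one_mem
      have k2 := hb.coord_mem
      nlinarith
    rcases hb.cases with ⟨b', hb', rfl⟩ | ⟨b', hb', rfl⟩
    · exfalso
      have k1 := hb'.coord_one_mem
      have k2 := ha'.coord_two_mem
      nlinarith
    obtain ⟨a'', b'', h1, h2, h3, h4, h5⟩ := ih (a := a') (b := b') ha' hb' (by
      simp only [prependTwos, coord_rayCons_two] at h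
      rw [show -q * coord a' - -q * coord (prependTwos m c)
          - S * (-q * coord b' - -q * coord (prependTwos m d))
        = -q * (coord a' - coord (prependTwos m c) - S * (coord b' - coord (prependTwos m d))) by
          ring, abs_mul, abs_neg, abs_of_pos q_pos, pow_succ', mul_assoc] at h
      exact le_of_mul_le_mul_left h q_pos)
    exact ⟨a'', b'', h1, h2, by rw [h3]; rfl, by rw [h4]; rfl, h5⟩

/-- Second part of a stage, after the digit `1` has appeared on one side only. -/
lemma agree_twos_of_pos {c d : ℕ → ℕ+} (hc : -6 / 10000 ≤ coord c ∧ coord c ≤ 6 / 10000)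
    (hd : -55 / 100 ≤ coord d ∧ coord d ≤ 0) {S e : ℝ} (hS1 : 112 / 100 ≤ S)
    (hS2 : S ≤ 1306 / 1000) (he : e ≤ 1 / 1000) (m : ℕ) :
    ∀ {a b : ℕ → ℕ+}, OneTwo a → OneTwo b →
      |coord a - coord (prependTwos m c) + S * (coord b - coord (prependTwos m d))| ≤ q ^ m * e →
      ∃ a' b', OneTwo a' ∧ OneTwo b' ∧ a = prependTwos m a' ∧ b = prependTwos m b' ∧
        |coord a' - coord c + S * (coord b' - coord d)| ≤ e := by
  have q1 := q_lb
  have q2 := q_ub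
  have bc : ∀ j, -6 / 10000 ≤ coord (prependTwos j c) ∧ coord (prependTwos j c) ≤ 6 / 10000 := by
    intro j
    induction j with
    | zero => exact hc
    | succ j ih =>
      rw [prependTwos, coord_rayCons_two]
      constructor <;> nlinarith [ih.1, ih.2]
  have bd : ∀ j, -55 / 100 ≤ coord (prependTwos j d) ∧ coord (prependTwos j d) ≤ 944 / 10000 := by
    intro j
    induction j with
    | zero => exact ⟨hd.1, by simpa [prependTwos] using hd.2.trans (by norm_num)⟩
    | succ j ih =>
      rw [prependTwos, coord_rayCons_two]
      constructor <;> nlinarith [ih.1, ih.2]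
  induction m with
  | zero =>
    intro a b ha hb h
    exact ⟨a, b, ha, hb, rfl, rfl, by simpa [prependTwos] using h⟩
  | succ m ih =>
    intro a b ha hb h
    have he' : q ^ (m + 1) * e ≤ 1 / 1000 := by
      have h1 : q ^ (m + 1) ≤ 1 := pow_le_one₀ q_pos.le q_lt_one.le
      have h2 : 0 ≤ q ^ (m + 1) := pow_nonneg q_pos.le _
      nlinarith
    have hc1 := bc (m + 1)
    have hd1 : -162 / 10000 ≤ coord (prependTwos (m + 1) d) ∧
        coord (prependTwos (m + 1) d) ≤ 944 / 10000 := by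
      rw [prependTwos, coord_rayCons_two]
      constructor <;> nlinarith [(bd m).1, (bd m).2]
    have h' := abs_le.mp (h.trans he')
    rcases hb.cases with ⟨b', hb', rfl⟩ | ⟨b', hb', rfl⟩
    · exfalso
      have k1 := hb'.coord_one_mem
      have k2 := ha.coord_mem
      nlinarith
    rcases ha.cases with ⟨a', ha', rfl⟩ | ⟨a', ha', rfl⟩
    · exfalso
      have k1 := ha'.coord_one_mem
      have k2 := hb'.coord_two_mem
      nlinarith
    obtain ⟨a'', b'', h1, h2, h3, h4, h5⟩ := ih (a := a') (b := b') ha' hb' (by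
      simp only [prependTwos, coord_rayCons_two] at h
      rw [show -q * coord a' - -q * coord (prependTwos m c)
          + S * (-q * coord b' - -q * coord (prependTwos m d))
        = -q * (coord a' - coord (prependTwos m c) + S * (coord b' - coord (prependTwos m d))) by
          ring, abs_mul, abs_neg, abs_of_pos q_pos, pow_succ', mul_assoc] at h
      exact le_of_mul_le_mul_left h q_pos)
    exact ⟨a'', b'', h1, h2, by rw [h3]; rfl, by rw [h4]; rfl, h5⟩

lemma oneDen_near {x : ℝ} (hx : |x| ≤ 6 / 10000) :
    44139 / 10000 ≤ oneDen x ∧ oneDen x ≤ 44146 / 10000 := by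
  have h3 := sqrt_two_lb
  have h4 := sqrt_two_ub
  obtain ⟨h1, h2⟩ := abs_le.mp hx
  unfold oneDen
  constructor <;> nlinarith

/-- The factor by which the relative weight of the two sides changes when a digit `1` has been
passed on both of them. -/
def weightRatio (x x' y y' : ℝ) : ℝ := oneDen x * oneDen x' / (oneDen y * oneDen y')

lemma mul_weightRatio (S : ℝ) {x x' y y' : ℝ} (hx : oneDen x ≠ 0) (hx' : oneDen x' ≠ 0)
    (hy : oneDen y ≠ 0) (hy' : oneDen y' ≠ 0) :
    S * weightRatio x x' y y'
      = S / (8 / (oneDen x * oneDen x')) * (8 / (oneDen y * oneDen y')) := by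
  unfold weightRatio
  field_simp

lemma coord_one_mem_of_abs_le {r : ℕ → ℕ+} (hr1 : |coord r| ≤ 6 / 10000) :
    -55 / 100 ≤ coord (rayCons 1 r) ∧ coord (rayCons 1 r) ≤ -5466 / 10000 := by
  have h3 := sqrt_two_lb
  have h4 := sqrt_two_ub
  obtain ⟨h1, h2⟩ := abs_le.mp hr1
  rw [coord_rayCons_one]
  unfold oneMap oneDen
  have e : 0 < 3 + √2 - (√2 - 1) * coord r := by nlinarith
  rw [le_div_iff₀ e, div_le_iff₀ e]
  constructor <;> nlinarith

lemma coord_twos_one_mem {h : ℕ} (hh : 1 ≤ h) {d : ℕ → ℕ+}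
    (hd : -55 / 100 ≤ coord d ∧ coord d ≤ 0) :
    -174 / 10000 ≤ coord (prependTwos h d) ∧ coord (prependTwos h d) ≤ 96 / 1000 := by
  have q0 := q_pos
  have q2 := q_ub
  induction h, hh using Nat.le_induction with
  | base =>
    simp only [prependTwos, coord_rayCons_two]
    constructor <;> nlinarith [hd.1, hd.2]
  | succ n hn ih =>
    rw [prependTwos, coord_rayCons_two]
    constructor <;> nlinarith [ih.1, ih.2]

set_option maxHeartbeats 400000 in
/-- A stage. The model rays are `2_m 1 2_h p` and `2_{m+h} 1 r`, and the given rays `a`, `b` deviate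
from them in such a way that the deviations, weighted with `1` and about `-1/2`, nearly cancel. Then
there is no deviation within the displayed digits, and the remaining rays are in the same
situation. -/
lemma agree_stage {m h : ℕ} (hh : 1 ≤ h) {p r : ℕ → ℕ+}
    (hp1 : |coord p| ≤ 6 / 10000) (hr1 : |coord r| ≤ 6 / 10000) {S E : ℝ}
    (hS1 : 465 / 1000 ≤ S) (hS2 : S ≤ 5075 / 10000) (hE : E ≤ 1 / 10000) {a b : ℕ → ℕ+}
    (ha : OneTwo a) (hb : OneTwo b)
    (hab : |coord a - coord (prependTwos m (rayCons 1 (prependTwos h p)))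
      - S * (coord b - coord (prependTwos (m + h) (rayCons 1 r)))| ≤ q ^ (m + h) * E) :
    ∃ a' b', OneTwo a' ∧ OneTwo b' ∧ a = prependTwos m (rayCons 1 (prependTwos h a')) ∧
      b = prependTwos (m + h) (rayCons 1 b') ∧
      |coord a' - coord p - S * weightRatio (coord (prependTwos h a')) (coord (prependTwos h p))
        (coord b') (coord r) * (coord b' - coord r)| ≤ 10 * E := by
  have q0 := q_pos
  have q2 := q_ub
  have q1 := q_lb
  have hhp : |coord (prependTwos h p)| ≤ 12 / 100000 := by
    rw [coord_prependTwos, abs_mul, abs_pow, abs_neg, abs_of_pos q0]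
    have : q ^ h ≤ q ^ 1 := q_pow_le hh
    rw [pow_one] at this
    have := abs_nonneg (coord p)
    have : 0 ≤ q ^ h := pow_nonneg q0.le _
    nlinarith
  have hc := coord_one_near hhp
  have hE0 : 0 ≤ E := by
    have h1 := (abs_nonneg _).trans hab
    have : 0 < q ^ (m + h) := pow_pos q0 _
    by_contra hcon
    nlinarith
  have hdr := coord_one_mem_of_abs_le hr1
  have hd := coord_twos_one_mem hh ⟨hdr.1, by linarith [hdr.2]⟩
  have hqh : q ^ h * E ≤ 1 / 10000 := by
    have : q ^ h ≤ 1 := pow_le_one₀ q0.le q_lt_one.le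
    nlinarith
  rw [pow_add, mul_assoc, prependTwos_add m h] at hab
  obtain ⟨a1, b1, ha1, hb1, rfl, rfl, h1⟩ := agree_twos_of_neg (c := rayCons 1 (prependTwos h p))
    (d := prependTwos h (rayCons 1 r)) ⟨by linarith [hc.1], by linarith [hc.2]⟩ hd hS1 hS2
    (hqh.trans (by norm_num)) m ha hb hab
  -- the first side now has to continue with the digit `1`
  rcases ha1.cases with ⟨a2, ha2, rfl⟩ | ⟨a2, ha2, rfl⟩
  swap
  · exfalso
    have k1 := ha2.coord_two_mem
    have k2 := hb1.coord_mem
    have := (abs_le.mp h1).2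
    nlinarith
  have hDa := oneDen_mem ha2.coord_mem
  have hDp := oneDen_near (hhp.trans (by norm_num))
  set κ := 8 / (oneDen (coord a2) * oneDen (coord (prependTwos h p))) with hκ
  have hDD : 0 < oneDen (coord a2) * oneDen (coord (prependTwos h p)) :=
    mul_pos (by linarith) (by linarith)
  have κ1 : 3890 / 10000 ≤ κ := by
    rw [hκ, le_div_iff₀ hDD]; nlinarith
  have κ2 : κ ≤ 4147 / 10000 := by
    rw [hκ, div_le_iff₀ hDD]; nlinarith
  have κ0 : 0 < κ := by linarith
  rw [coord_rayCons_one, coord_rayCons_one, oneMap_sub (by linarith) (by linarith), ← hκ] at h1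
  have h2 : |coord a2 - coord (prependTwos h p)
      + S / κ * (coord b1 - coord (prependTwos h (rayCons 1 r)))| ≤ q ^ h * (3 * E) := by
    have e1 : -κ * (coord a2 - coord (prependTwos h p))
        - S * (coord b1 - coord (prependTwos h (rayCons 1 r)))
        = -κ * (coord a2 - coord (prependTwos h p)
          + S / κ * (coord b1 - coord (prependTwos h (rayCons 1 r)))) := by
      field_simp; ring
    rw [e1, abs_mul, abs_neg, abs_of_pos κ0] at h1
    have := abs_nonneg (coord a2 - coord (prependTwos h p)
          + S / κ * (coord b1 - coord (prependTwos h (rayCons 1 r))))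
    nlinarith
  have hs1 : 1121 / 1000 ≤ S / κ := by rw [le_div_iff₀ κ0]; nlinarith
  have hs2 : S / κ ≤ 1306 / 1000 := by rw [div_le_iff₀ κ0]; nlinarith
  obtain ⟨a3, b3, ha3, hb3, rfl, rfl, h3⟩ := agree_twos_of_pos (c := p) (d := rayCons 1 r)
    ⟨by linarith [(abs_le.mp hp1).1], (abs_le.mp hp1).2⟩ ⟨hdr.1, by linarith⟩
    (by linarith) hs2 (by linarith) h ha2 hb1 h2
  -- finally, the second side has to continue with the digit `1`
  rcases hb3.cases with ⟨b4, hb4, rfl⟩ | ⟨b4, hb4, rfl⟩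
  swap
  · exfalso
    have k1 := hb4.coord_two_mem
    have k2 := ha3.coord_mem
    have k3 := (abs_le.mp h3).2
    have k4 := (abs_le.mp hp1).2
    have k5 : 5292 / 10000 ≤ coord (rayCons 2 b4) - coord (rayCons 1 r) := by linarith
    have k6 : 5932 / 10000 ≤ S / κ * (coord (rayCons 2 b4) - coord (rayCons 1 r)) := by nlinarith
    linarith
  refine ⟨a3, b4, ha3, hb4, rfl, by rw [prependTwos_add], ?_⟩
  have hDb := oneDen_mem hb4.coord_mem
  have hDr := oneDen_near hr1
  rw [coord_rayCons_one, coord_rayCons_one, oneMap_sub (by linarith) (by linarith)] at h3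
  have e2 : S * weightRatio (coord (prependTwos h a3)) (coord (prependTwos h p)) (coord b4)
      (coord r) = S / κ * (8 / (oneDen (coord b4) * oneDen (coord r))) := by
    exact mul_weightRatio S (ne_of_gt (by linarith)) (ne_of_gt (by linarith))
      (ne_of_gt (by linarith)) (ne_of_gt (by linarith))
  rw [e2]
  refine le_trans (le_of_eq ?_) (h3.trans (by linarith))
  congr 1; ring

lemma abs_coord_prependTwos_le_abs (n : ℕ) (a : ℕ → ℕ+) :
    |coord (prependTwos n a)| ≤ |coord a| := by
  rw [coord_prependTwos, abs_mul, abs_pow, abs_neg, abs_of_pos q_pos]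
  exact mul_le_of_le_one_left (abs_nonneg _) (pow_le_one₀ q_pos.le q_lt_one.le)

lemma abs_coord_prependTwos_le_of_four_le {n : ℕ} (hn : 4 ≤ n) {a : ℕ → ℕ+} (ha : OneTwo a) :
    |coord (prependTwos n a)| ≤ 6 / 10000 := by
  have h1 := abs_coord_prependTwos_le n ha
  have h2 := q_pow_le hn
  have h3 : q ^ 4 ≤ 9 / 10000 :=
    (pow_le_pow_left₀ q_pos.le q_ub.le 4).trans (by norm_num)
  linarith

lemma coord_prependTwos_mem {n : ℕ} (hn : 1 ≤ n) {a : ℕ → ℕ+} (ha : OneTwo a) :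
    -174 / 10000 ≤ coord (prependTwos n a) ∧ coord (prependTwos n a) ≤ 1011 / 10000 := by
  obtain ⟨n, rfl⟩ : ∃ n', n = n' + 1 := ⟨n - 1, by omega⟩
  exact (ha.prependTwos n).coord_two_mem

lemma oneDen_mem_of_two {x : ℝ} (h : -174 / 10000 ≤ x ∧ x ≤ 1011 / 10000) :
    43723 / 10000 ≤ oneDen x ∧ oneDen x ≤ 44215 / 10000 := by
  have h3 := sqrt_two_lb
  have h4 := sqrt_two_ub
  unfold oneDen
  constructor <;> nlinarith

lemma weightRatio_mem_of_two {x x' y y' : ℝ} (hx : -174 / 10000 ≤ x ∧ x ≤ 1011 / 10000)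
    (hx' : |x'| ≤ 6 / 10000) (hy : -589 / 1000 ≤ y ∧ y ≤ 1014 / 10000) (hy' : |y'| ≤ 6 / 10000) :
    938 / 1000 ≤ weightRatio x x' y y' ∧ weightRatio x x' y y' ≤ 10115 / 10000 := by
  have h1 := oneDen_mem_of_two hx
  have h2 := oneDen_near hx'
  have h3 := oneDen_mem hy
  have h4 := oneDen_near hy'
  have h5 : 0 < oneDen y * oneDen y' := mul_pos (by linarith) (by linarith)
  unfold weightRatio
  rw [le_div_iff₀ h5, div_le_iff₀ h5]
  constructor <;> nlinarith

lemma weightRatio_near {x x' y y' : ℝ} (hx : |x| ≤ 6 / 10000)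
    (hx' : |x'| ≤ 6 / 10000) (hy : |y| ≤ 6 / 10000) (hy' : |y'| ≤ 6 / 10000) :
    |weightRatio x x' y y' - 1| ≤ 35 / 100000 := by
  have h1 := oneDen_near hx
  have h2 := oneDen_near hx'
  have h3 := oneDen_near hy
  have h4 := oneDen_near hy'
  have h5 : 0 < oneDen y * oneDen y' := mul_pos (by linarith) (by linarith)
  have h6 : 99965 / 100000 ≤ weightRatio x x' y y' := by
    unfold weightRatio
    rw [le_div_iff₀ h5]
    nlinarith
  have h7 : weightRatio x x' y y' ≤ 100035 / 100000 := by
    unfold weightRatio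
    rw [div_le_iff₀ h5]
    nlinarith
  rw [abs_le]; constructor <;> linarith

/-- A stage that follows another one. The weight `T` is the one before the digit `1` that separates
the two stages; the correction `weightRatio` is known only roughly in advance, but precisely once
the rays are known to agree. -/
lemma agree_next_stage {m h h₀ : ℕ} (hh₀ : 1 ≤ h₀) (hh : 1 ≤ h) (hm : 4 ≤ m) {p r : ℕ → ℕ+}
    (hp : OneTwo p) (hr : OneTwo r) (hp1 : |coord p| ≤ 6 / 10000) (hr1 : |coord r| ≤ 6 / 10000)
    {T δ : ℝ} (hT : |T - 1 / 2| ≤ δ) (hδ : δ ≤ 15 / 10000) {K : ℕ} (hK : m + h + 6 ≤ K)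
    {a b : ℕ → ℕ+} (ha : OneTwo a) (hb : OneTwo b)
    (hab : |coord a - coord (prependTwos m (rayCons 1 (prependTwos h p)))
      - T * weightRatio (coord (prependTwos h₀ a))
          (coord (prependTwos h₀ (prependTwos m (rayCons 1 (prependTwos h p))))) (coord b)
          (coord (prependTwos (m + h) (rayCons 1 r)))
        * (coord b - coord (prependTwos (m + h) (rayCons 1 r)))| ≤ q ^ K) :
    ∃ a' b' T', OneTwo a' ∧ OneTwo b' ∧ |T' - 1 / 2| ≤ δ + 2 / 10000 ∧
      a = prependTwos m (rayCons 1 (prependTwos h a')) ∧ b = prependTwos (m + h) (rayCons 1 b') ∧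
      |coord a' - coord p - T' * weightRatio (coord (prependTwos h a')) (coord (prependTwos h p))
        (coord b') (coord r) * (coord b' - coord r)| ≤ q ^ (K - (m + h) - 2) := by
  have q0 := q_pos
  have hA := abs_coord_prependTwos_le_of_four_le hm (hp.prependTwos h).rayCons_one
  have hA0 := (abs_coord_prependTwos_le_abs h₀ _).trans hA
  have hB := abs_coord_prependTwos_le_of_four_le (n := m + h) (by omega) hr.rayCons_one
  obtain ⟨w1, w2⟩ := weightRatio_mem_of_two (coord_prependTwos_mem hh₀ ha) hA0 hb.coord_mem hB
  obtain ⟨t1, t2⟩ := abs_le.mp hT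
  set W := weightRatio (coord (prependTwos h₀ a))
          (coord (prependTwos h₀ (prependTwos m (rayCons 1 (prependTwos h p))))) (coord b)
          (coord (prependTwos (m + h) (rayCons 1 r))) with hW
  have e : q ^ K = q ^ (m + h) * q ^ (K - (m + h)) := by rw [← pow_add]; congr 1; omega
  have hE : q ^ (K - (m + h)) ≤ 1 / 10000 := by
    refine (q_pow_le (show 6 ≤ K - (m + h) by omega)).trans ?_
    exact (pow_le_pow_left₀ q_pos.le q_ub.le 6).trans (by norm_num)
  rw [e] at hab
  obtain ⟨a', b', ha', hb', rfl, rfl, h1⟩ := agree_stage hh hp1 hr1 (S := T * W)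
    (by nlinarith) (by nlinarith) hE ha hb hab
  have hA' := abs_coord_prependTwos_le_of_four_le hm (ha'.prependTwos h).rayCons_one
  have hA0' := (abs_coord_prependTwos_le_abs h₀ _).trans hA'
  have hB' := abs_coord_prependTwos_le_of_four_le (n := m + h) (by omega) hb'.rayCons_one
  have hW1 := abs_le.mp (weightRatio_near hA0' hA0 hB' hB)
  rw [← hW] at hW1
  refine ⟨a', b', T * W, ha', hb', ?_, rfl, rfl, h1.trans ?_⟩
  · rw [abs_le]; constructor <;> nlinarith
  · have e2 : q ^ (K - (m + h)) = q ^ 2 * q ^ (K - (m + h) - 2) := by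
      rw [← pow_add]; congr 1; omega
    have : 0 < q ^ (K - (m + h) - 2) := pow_pos q0 _
    have : q ^ 2 ≤ 1 / 10 := by nlinarith [q_ub]
    rw [e2]; nlinarith

lemma factor_height_sub {u v w z : ℝ} (hu : u ≠ 0) (hv : v ≠ 0) (hw : w ≠ 0) (hz : z ≠ 0)
    (C d e : ℝ) :
    √2 * (2 * -(C * d) / (u * v) + C * e / (w * z))
      = -(C * (2 * √2 / (u * v))) * (d - u * v / (2 * (w * z)) * e) := by
  field_simp
  ring

set_option maxHeartbeats 400000 in
/-- Near equality of heights in terms of the rays that remain after the first digits. -/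
lemma abs_sub_le_of_height {a b a' b' : ℕ → ℕ+} (ha : OneTwo a) (hb : OneTwo b)
    (ha' : OneTwo a') (hb' : OneTwo b') {ε : ℝ}
    (h : |height (coord (prependTwos 3 a)) (coord (prependTwos 2 b))
      - height (coord (prependTwos 3 a')) (coord (prependTwos 2 b'))| ≤ q ^ 3 * ε) :
    ∃ S, 465 / 1000 ≤ S ∧ S ≤ 5075 / 10000 ∧
      (|coord a| ≤ 6 / 10000 → |coord a'| ≤ 6 / 10000 → |coord b| ≤ 6 / 10000 →
        |coord b'| ≤ 6 / 10000 → |S - 1 / 2| ≤ 1 / 10000) ∧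
      |coord a - coord a' - S * (coord b - coord b')| ≤ ε := by
  have q0 := q_pos
  have q1 := q_lb
  have q2 := q_ub
  have k1 : coord (prependTwos 3 a) = -(q ^ 3 * coord a) := by rw [coord_prependTwos]; ring
  have k2 : coord (prependTwos 3 a') = -(q ^ 3 * coord a') := by rw [coord_prependTwos]; ring
  have k3 : q * coord (prependTwos 2 b) = q ^ 3 * coord b := by rw [coord_prependTwos]; ring
  have k4 : q * coord (prependTwos 2 b') = q ^ 3 * coord b' := by rw [coord_prependTwos]; ring
  have h3 : q ^ 3 ≤ 51 / 10000 :=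
    (pow_le_pow_left₀ q_pos.le q_ub.le 3).trans (by norm_num)
  have h30 : 0 < q ^ 3 := pow_pos q0 3
  have bd : ∀ z : ℝ, -589 / 1000 ≤ z ∧ z ≤ 1014 / 10000 →
      -301 / 100000 ≤ q ^ 3 * z ∧ q ^ 3 * z ≤ 52 / 100000 := by
    intro z hz
    constructor <;> nlinarith [hz.1, hz.2]
  have bs : ∀ z : ℝ, |z| ≤ 6 / 10000 → -4 / 1000000 ≤ q ^ 3 * z ∧ q ^ 3 * z ≤ 4 / 1000000 := by
    intro z hz
    obtain ⟨z1, z2⟩ := abs_le.mp hz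
    constructor <;> nlinarith
  have b1 := bd _ ha.coord_mem
  have b2 := bd _ ha'.coord_mem
  have b3 := bd _ hb.coord_mem
  have b4 := bd _ hb'.coord_mem
  have hdiff : height (coord (prependTwos 3 a)) (coord (prependTwos 2 b))
      - height (coord (prependTwos 3 a')) (coord (prependTwos 2 b'))
      = √2 * (2 * -(q ^ 3 * (coord a - coord a')) / ((1 + q ^ 3 * coord a) * (1 + q ^ 3 * coord a'))
        + q ^ 3 * (coord b - coord b') / ((1 - q ^ 3 * coord b) * (1 - q ^ 3 * coord b'))) := by
    have f1 := frontTerm_sub (x := coord (prependTwos 3 a)) (y := coord (prependTwos 3 a'))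
      (by rw [k1]; linarith) (by rw [k2]; linarith)
    have f2 := backTerm_sub (x := coord (prependTwos 2 b)) (y := coord (prependTwos 2 b'))
      (by rw [k3]; linarith) (by rw [k4]; linarith)
    rw [mul_sub, k3, k4, ← mul_sub] at f2
    rw [k1, k2] at f1 ⊢
    unfold height
    rw [show 1 - -(q ^ 3 * coord a) = 1 + q ^ 3 * coord a by ring,
      show 1 - -(q ^ 3 * coord a') = 1 + q ^ 3 * coord a' by ring,
      show -(q ^ 3 * coord a) - -(q ^ 3 * coord a') = -(q ^ 3 * (coord a - coord a')) by ring] at f1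
    linear_combination √2 * f1 + √2 * f2
  generalize coord a = x at *
  generalize coord a' = x' at *
  generalize coord b = y at *
  generalize coord b' = y' at *
  have p1 : 0 < 1 + q ^ 3 * x := by linarith
  have p2 : 0 < 1 + q ^ 3 * x' := by linarith
  have p3 : 0 < 1 - q ^ 3 * y := by linarith
  have p4 : 0 < 1 - q ^ 3 * y' := by linarith
  have p5 := mul_pos p3 p4
  have p6 := mul_pos p1 p2
  refine ⟨(1 + q ^ 3 * x) * (1 + q ^ 3 * x') / (2 * ((1 - q ^ 3 * y) * (1 - q ^ 3 * y'))),
    ?_, ?_, ?_, ?_⟩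
  · rw [le_div_iff₀ (by linarith)]; nlinarith
  · rw [div_le_iff₀ (by linarith)]; nlinarith
  · intro u1 u2 u3 u4
    obtain ⟨v1, w1⟩ := bs _ u1
    obtain ⟨v2, w2⟩ := bs _ u2
    obtain ⟨v3, w3⟩ := bs _ u3
    obtain ⟨v4, w4⟩ := bs _ u4
    have l1 : 4999 / 10000 ≤
        (1 + q ^ 3 * x) * (1 + q ^ 3 * x') / (2 * ((1 - q ^ 3 * y) * (1 - q ^ 3 * y'))) := by
      rw [le_div_iff₀ (by linarith)]; nlinarith
    have l2 : (1 + q ^ 3 * x) * (1 + q ^ 3 * x') / (2 * ((1 - q ^ 3 * y) * (1 - q ^ 3 * y')))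
        ≤ 5001 / 10000 := by
      rw [div_le_iff₀ (by linarith)]; nlinarith
    rw [abs_le]; constructor <;> linarith
  · rw [hdiff] at h
    have e : √2 * (2 * -(q ^ 3 * (x - x')) / ((1 + q ^ 3 * x) * (1 + q ^ 3 * x'))
        + q ^ 3 * (y - y') / ((1 - q ^ 3 * y) * (1 - q ^ 3 * y')))
        = -(q ^ 3 * (2 * √2 / ((1 + q ^ 3 * x) * (1 + q ^ 3 * x')))) * (x - x'
          - (1 + q ^ 3 * x) * (1 + q ^ 3 * x') / (2 * ((1 - q ^ 3 * y) * (1 - q ^ 3 * y')))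
            * (y - y')) :=
      factor_height_sub p1.ne' p2.ne' p3.ne' p4.ne' _ _ _
    have hC : 1 ≤ 2 * √2 / ((1 + q ^ 3 * x) * (1 + q ^ 3 * x')) := by
      have : (1 + q ^ 3 * x) * (1 + q ^ 3 * x') ≤ (101 / 100) * (101 / 100) :=
        mul_le_mul (by linarith) (by linarith) p2.le (by norm_num)
      rw [le_div_iff₀ p6]
      linarith [sqrt_two_lb]
    rw [e, abs_mul, abs_neg, abs_mul, abs_of_pos h30, abs_of_pos (by linarith), mul_assoc] at h
    have h' := le_of_mul_le_mul_left h h30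
    exact (le_mul_of_one_le_left (abs_nonneg _) hC).trans h'

/-! ### Heights close to that of the origin of `γ_k^1` -/

/-- A ray with the first digits of `γ_k^1` on the right of the origin, for `M = 2k - 4`, with the twos
grouped as they are used up in the stages; the three twos in front are already known. -/
lemma rightModel_eq (M : ℕ) (a : ℕ → ℕ+) :
    prependBlocks [M + 3, M + 3 + 1, M + 3 + 2, M + 3, M + 3 + 1] (prependTwos (M + 3) a) =
    prependTwos 3 (prependTwos M (rayCons 1 (prependTwos 3 (prependTwos (M + 1) (rayCons 1
      (prependTwos 3 (prependTwos (M + 2) (rayCons 1 (prependTwos 1 (prependTwos (M + 2) (rayCons 1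
      (prependTwos 3 (prependTwos (M + 1) (rayCons 1 (prependTwos 3
      (prependTwos M a)))))))))))))))) := by
  simp only [prependBlocks, ← prependTwos_add]
  congr 1
  · omega
  congr 2
  · omega
  congr 2
  · omega
  congr 2
  · omega
  congr 2
  · omega
  congr 2
  omega

/-- The left side of the origin of `γ_k^1`, grouped in the same way. -/
lemma leftModel_eq (M : ℕ) (b : ℕ → ℕ+) :
    prependBlocks [M + 3 + 2, M + 3 + 1, M + 3, M + 3 + 2, M + 3 + 1] b =
    prependTwos 2 (prependTwos (M + 3) (rayCons 1 (prependTwos (M + 1 + 3) (rayCons 1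
      (prependTwos (M + 2 + 1) (rayCons 1 (prependTwos (M + 2 + 3) (rayCons 1
      (prependTwos (M + 1 + 3) (rayCons 1 b)))))))))) := by
  simp only [prependBlocks, ← prependTwos_add]
  congr 1
  omega

set_option maxHeartbeats 1000000 in
/-- If the height at a position is nearly the height of the origin of `γ_k^1`, then the digits around
this position are those around the origin of `γ_k^1`, for about five blocks to either side. -/
lemma agree_of_height_near {M : ℕ} (hM : 4 ≤ M) {Y : ℕ → ℕ+} (hY : OneTwo Y)
    (hY1 : |coord Y| ≤ 6 / 10000)
    {a b : ℕ → ℕ+} (ha : OneTwo a) (hb : OneTwo b)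
    (h : |height (coord (prependTwos 3 a)) (coord (prependTwos 2 b))
      - height (coord (prependBlocks [M + 3, M + 3 + 1, M + 3 + 2, M + 3, M + 3 + 1]
          (prependTwos (M + 3) (rayCons 1 (rayCons 1 (fun _ => 2))))))
        (coord (prependBlocks [M + 3 + 2, M + 3 + 1, M + 3, M + 3 + 2, M + 3 + 1]
          (prependTwos M (prependTwos 3 (rayCons 1 Y)))))| ≤ q ^ (6 * M + 58)) :
    ∃ a' b', OneTwo a' ∧ OneTwo b' ∧
      prependTwos 3 a = prependBlocks [M + 3, M + 3 + 1, M + 3 + 2, M + 3, M + 3 + 1]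
        (prependTwos (M + 3) a') ∧
      prependTwos 2 b = prependBlocks [M + 3 + 2, M + 3 + 1, M + 3, M + 3 + 2, M + 3 + 1]
        (prependTwos M b') := by
  have ht : OneTwo (rayCons 1 (rayCons 1 (fun _ => 2))) := oneTwo_const_two.rayCons_one.rayCons_one
  rw [rightModel_eq, leftModel_eq] at h
  -- the remaining model rays at the beginning of the stages
  obtain ⟨p5, hp5⟩ : ∃ p, p = prependTwos M (rayCons 1 (rayCons 1 (fun _ => 2))) := ⟨_, rfl⟩
  obtain ⟨p4, hp4⟩ : ∃ p, p = prependTwos (M + 1) (rayCons 1 (prependTwos 3 p5)) := ⟨_, rfl⟩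
  obtain ⟨p3, hp3⟩ : ∃ p, p = prependTwos (M + 2) (rayCons 1 (prependTwos 3 p4)) := ⟨_, rfl⟩
  obtain ⟨p2, hp2⟩ : ∃ p, p = prependTwos (M + 2) (rayCons 1 (prependTwos 1 p3)) := ⟨_, rfl⟩
  obtain ⟨p1, hp1⟩ : ∃ p, p = prependTwos (M + 1) (rayCons 1 (prependTwos 3 p2)) := ⟨_, rfl⟩
  obtain ⟨r5, hr5⟩ : ∃ r, r = prependTwos M (prependTwos 3 (rayCons 1 Y)) := ⟨_, rfl⟩
  obtain ⟨r4, hr4⟩ : ∃ r, r = prependTwos (M + 1 + 3) (rayCons 1 r5) := ⟨_, rfl⟩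
  obtain ⟨r3, hr3⟩ : ∃ r, r = prependTwos (M + 2 + 3) (rayCons 1 r4) := ⟨_, rfl⟩
  obtain ⟨r2, hr2⟩ : ∃ r, r = prependTwos (M + 2 + 1) (rayCons 1 r3) := ⟨_, rfl⟩
  obtain ⟨r1, hr1⟩ : ∃ r, r = prependTwos (M + 1 + 3) (rayCons 1 r2) := ⟨_, rfl⟩
  rw [← hp5, ← hp4, ← hp3, ← hp2, ← hp1, ← hr5, ← hr4, ← hr3, ← hr2, ← hr1] at h
  have op5 : OneTwo p5 := hp5 ▸ ht.prependTwos M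
  have op4 : OneTwo p4 := hp4 ▸ (op5.prependTwos 3).rayCons_one.prependTwos _
  have op3 : OneTwo p3 := hp3 ▸ (op4.prependTwos 3).rayCons_one.prependTwos _
  have op2 : OneTwo p2 := hp2 ▸ (op3.prependTwos 1).rayCons_one.prependTwos _
  have op1 : OneTwo p1 := hp1 ▸ (op2.prependTwos 3).rayCons_one.prependTwos _
  have or5 : OneTwo r5 := hr5 ▸ (hY.rayCons_one.prependTwos 3).prependTwos M
  have or4 : OneTwo r4 := hr4 ▸ or5.rayCons_one.prependTwos _
  have or3 : OneTwo r3 := hr3 ▸ or4.rayCons_one.prependTwos _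
  have or2 : OneTwo r2 := hr2 ▸ or3.rayCons_one.prependTwos _
  have or1 : OneTwo r1 := hr1 ▸ or2.rayCons_one.prependTwos _
  have np5 : |coord p5| ≤ 6 / 10000 := hp5 ▸ abs_coord_prependTwos_le_of_four_le hM ht
  have np4 : |coord p4| ≤ 6 / 10000 :=
    hp4 ▸ abs_coord_prependTwos_le_of_four_le (by omega) (op5.prependTwos 3).rayCons_one
  have np3 : |coord p3| ≤ 6 / 10000 :=
    hp3 ▸ abs_coord_prependTwos_le_of_four_le (by omega) (op4.prependTwos 3).rayCons_one
  have np2 : |coord p2| ≤ 6 / 10000 :=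
    hp2 ▸ abs_coord_prependTwos_le_of_four_le (by omega) (op3.prependTwos 1).rayCons_one
  have np1 : |coord p1| ≤ 6 / 10000 :=
    hp1 ▸ abs_coord_prependTwos_le_of_four_le (by omega) (op2.prependTwos 3).rayCons_one
  have nr5 : |coord r5| ≤ 6 / 10000 :=
    hr5 ▸ abs_coord_prependTwos_le_of_four_le (by omega) (hY.rayCons_one.prependTwos 3)
  have nr4 : |coord r4| ≤ 6 / 10000 :=
    hr4 ▸ abs_coord_prependTwos_le_of_four_le (by omega) or5.rayCons_one
  have nr3 : |coord r3| ≤ 6 / 10000 :=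
    hr3 ▸ abs_coord_prependTwos_le_of_four_le (by omega) or4.rayCons_one
  have nr2 : |coord r2| ≤ 6 / 10000 :=
    hr2 ▸ abs_coord_prependTwos_le_of_four_le (by omega) or3.rayCons_one
  have nr1 : |coord r1| ≤ 6 / 10000 :=
    hr1 ▸ abs_coord_prependTwos_le_of_four_le (by omega) or2.rayCons_one
  obtain ⟨S, hS1, hS2, hS, h0⟩ := abs_sub_le_of_height ha hb
    ((op1.prependTwos 3).rayCons_one.prependTwos M) (or1.rayCons_one.prependTwos (M + 3))
    (ε := q ^ (M + 3) * q ^ (5 * M + 52))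
    (by rw [← pow_add, ← pow_add]; convert h using 2; omega)
  have hE : q ^ (5 * M + 52) ≤ 1 / 10000 := by
    refine (q_pow_le (show 6 ≤ 5 * M + 52 by omega)).trans ?_
    exact (pow_le_pow_left₀ q_pos.le q_ub.le 6).trans (by norm_num)
  obtain ⟨a1, b1, ha1, hb1, rfl, rfl, h1⟩ := agree_stage (by norm_num) np1 nr1 hS1 hS2 hE ha hb h0
  have hS' := hS
    (abs_coord_prependTwos_le_of_four_le (by omega) (ha1.prependTwos 3).rayCons_one)
    (abs_coord_prependTwos_le_of_four_le (by omega) (op1.prependTwos 3).rayCons_one)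
    (abs_coord_prependTwos_le_of_four_le (by omega) hb1.rayCons_one)
    (abs_coord_prependTwos_le_of_four_le (by omega) or1.rayCons_one)
  have h1' : |coord a1 - coord p1 - S * weightRatio (coord (prependTwos 3 a1))
      (coord (prependTwos 3 p1)) (coord b1) (coord r1) * (coord b1 - coord r1)|
      ≤ q ^ (5 * M + 50) := by
    refine h1.trans ?_
    have : 0 < q ^ (5 * M + 50) := pow_pos q_pos _
    have h3 : q ^ 2 ≤ 1 / 10 := by nlinarith [q_ub, q_pos]
    rw [show 5 * M + 52 = 5 * M + 50 + 2 by omega, pow_add]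
    nlinarith
  rw [hp1, hr1] at h1'
  obtain ⟨a2, b2, T2, ha2, hb2, hT2, rfl, rfl, h2⟩ := agree_next_stage (by norm_num) (by norm_num)
    (by omega) op2 or2 np2 nr2 hS' (by norm_num) (by omega) ha1 hb1 h1'
  rw [hp2, hr2] at h2
  obtain ⟨a3, b3, T3, ha3, hb3, hT3, rfl, rfl, h3⟩ := agree_next_stage (by norm_num) (by norm_num)
    (by omega) op3 or3 np3 nr3 hT2 (by norm_num) (by omega) ha2 hb2 h2
  rw [hp3, hr3] at h3
  obtain ⟨a4, b4, T4, ha4, hb4, hT4, rfl, rfl, h4⟩ := agree_next_stage (by norm_num) (by norm_num)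
    (by omega) op4 or4 np4 nr4 hT3 (by norm_num) (by omega) ha3 hb3 h3
  rw [hp4, hr4] at h4
  obtain ⟨a5, b5, T5, ha5, hb5, hT5, rfl, rfl, h5⟩ := agree_next_stage (by norm_num) (by norm_num)
    (by omega) op5 or5 np5 nr5 hT4 (by norm_num) (by omega) ha4 hb4 h4
  -- the first part of a sixth stage
  obtain ⟨w1, w2⟩ := weightRatio_mem_of_two (coord_prependTwos_mem (n := 3) (by norm_num) ha5)
    ((abs_coord_prependTwos_le_abs 3 p5).trans np5) hb5.coord_mem nr5
  obtain ⟨t1, t2⟩ := abs_le.mp hT5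
  have hd := coord_twos_one_mem (h := 3) (d := rayCons 1 Y) (by norm_num)
    ⟨(coord_one_mem_of_abs_le hY1).1, by linarith [hY.coord_one_mem.2]⟩
  set W := weightRatio (coord (prependTwos 3 a5)) (coord (prependTwos 3 p5)) (coord b5)
    (coord r5) with hW
  rw [hp5, hr5] at h5
  have hE5 : q ^ 6 ≤ 1 / 1000 := (pow_le_pow_left₀ q_pos.le q_ub.le 6).trans (by norm_num)
  obtain ⟨a6, b6, ha6, hb6, rfl, rfl, -⟩ := agree_twos_of_neg (S := T5 * W) (e := q ^ 6)
    (c := rayCons 1 (rayCons 1 (fun _ => 2))) (d := prependTwos 3 (rayCons 1 Y))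
    (by rw [coord_one_one_const_two]; norm_num) hd (by nlinarith) (by nlinarith) hE5 M ha5 hb5
    (h5.trans (by rw [← pow_add]; exact q_pow_le (by omega)))
  exact ⟨a6, b6, ha6, hb6, (rightModel_eq M a6).symm, (leftModel_eq M (prependTwos M b6)).symm⟩

/-! ### The digits nearest to a position with large `λ` -/

lemma one_div_mem {z m M : ℝ} (hm : 0 < m) (h : m ≤ z ∧ z ≤ M) : 1 / M ≤ 1 / z ∧ 1 / z ≤ 1 / m :=
  ⟨one_div_le_one_div_of_le (by linarith [h.1]) h.2, one_div_le_one_div_of_le hm h.1⟩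

lemma cfValue_le_digit_add_one (a : ℕ → ℕ+) : cfValue a ≤ ((a 0 : ℕ) : ℝ) + 1 := by
  rw [cfValue_eq]
  have := one_div_le_one_div_of_le one_pos (one_le_cfValue (fun n => a (n + 1)))
  linarith

/-- If all `λ_i(θ)` are small, then `θ` has digits `1` and `2` only. -/
lemma oneTwo_of_lam_le {θ : ℤ → ℕ+} (h : ∀ i, lam θ i ≤ 32 / 10) (i : ℤ) :
    θ i = 1 ∨ θ i = 2 := by
  have h3 : ∀ j, ((θ j : ℕ) : ℝ) ≤ 3 := by
    intro j
    have h1 := h j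
    rw [lam_eq_digit_add] at h1
    have k1 : 0 ≤ 1 / cfValue (rightRay θ (j + 1)) :=
      one_div_nonneg.mpr (zero_le_one.trans (one_le_cfValue _))
    have k2 : 0 ≤ 1 / cfValue (leftRay θ (j - 1)) :=
      one_div_nonneg.mpr (zero_le_one.trans (one_le_cfValue _))
    have : ((θ j : ℕ) : ℝ) < 4 := by linarith
    have : (θ j : ℕ) < 4 := by exact_mod_cast this
    have : (θ j : ℕ) ≤ 3 := by omega
    exact_mod_cast this
  have h1 := h i
  rw [lam_eq_digit_add] at h1
  have k1 := one_div_le_one_div_of_le (by linarith [one_le_cfValue (rightRay θ (i + 1))])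
    ((cfValue_le_digit_add_one (rightRay θ (i + 1))).trans (add_le_add_left (h3 _) 1))
  have k2 := one_div_le_one_div_of_le (by linarith [one_le_cfValue (leftRay θ (i - 1))])
    ((cfValue_le_digit_add_one (leftRay θ (i - 1))).trans (add_le_add_left (h3 _) 1))
  have : ((θ i : ℕ) : ℝ) < 3 := by norm_num at k1 k2 h1; linarith
  have hlt : (θ i : ℕ) < 3 := by exact_mod_cast this
  have hpos := (θ i).pos
  have : (θ i : ℕ) = 1 ∨ (θ i : ℕ) = 2 := by omega
  rcases this with h | h
  · exact Or.inl (PNat.coe_injective h)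
  · exact Or.inr (PNat.coe_injective h)

lemma cfValue_one_mem {a : ℕ → ℕ+} {m M : ℝ} (hm : 0 < m) (h : m ≤ cfValue a ∧ cfValue a ≤ M) :
    1 + 1 / M ≤ cfValue (rayCons 1 a) ∧ cfValue (rayCons 1 a) ≤ 1 + 1 / m := by
  have := one_div_mem hm h
  rw [cfValue_rayCons, show (((1 : ℕ+) : ℕ) : ℝ) = 1 by norm_num]
  constructor <;> linarith

lemma cfValue_two_mem {a : ℕ → ℕ+} {m M : ℝ} (hm : 0 < m) (h : m ≤ cfValue a ∧ cfValue a ≤ M) :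
    2 + 1 / M ≤ cfValue (rayCons 2 a) ∧ cfValue (rayCons 2 a) ≤ 2 + 1 / m := by
  have := one_div_mem hm h
  rw [cfValue_rayCons, show (((2 : ℕ+) : ℕ) : ℝ) = 2 by norm_num]
  constructor <;> linarith

/-- The digits nearest to a position whose height is close to `1 + 3 / √2 = 3.1213…`, when the
digit on the left is `1` and that on the right is `2`. -/
lemma first_digits_of_height_near {l r : ℕ → ℕ+} (hl : OneTwo l) (hr : OneTwo r)
    (h1 : 31212 / 10000 ≤ 2 + 1 / cfValue (rayCons 2 r) + 1 / cfValue (rayCons 1 l))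
    (h2 : 2 + 1 / cfValue (rayCons 2 r) + 1 / cfValue (rayCons 1 l) ≤ 31215 / 10000) :
    (∃ a, OneTwo a ∧ r = prependTwos 1 a) ∧ ∃ b, OneTwo b ∧ l = prependTwos 2 b := by
  have p : (0 : ℝ) < 136585 / 100000 := by norm_num
  have kr := one_div_mem (by norm_num) (cfValue_two_mem p hr.cfValue_mem)
  rcases hl.cases with ⟨l, hl1, rfl⟩ | ⟨l, hl1, rfl⟩
  · exfalso
    have kl := one_div_mem (by norm_num) (cfValue_one_mem (by norm_num)
      (cfValue_one_mem p hl1.cfValue_mem))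
    norm_num at kl kr h1
    linarith [kl.2, kr.2]
  have kl := one_div_mem (by norm_num) (cfValue_one_mem (by norm_num)
      (cfValue_two_mem p hl1.cfValue_mem))
  rcases hr.cases with ⟨r, hr1, rfl⟩ | ⟨r, hr1, rfl⟩
  · exfalso
    have kr := one_div_mem (by norm_num) (cfValue_two_mem (by norm_num)
      (cfValue_one_mem p hr1.cfValue_mem))
    norm_num at kl kr h1
    linarith [kl.2, kr.2]
  refine ⟨⟨r, hr1, rfl⟩, ?_⟩
  rcases hl1.cases with ⟨l, hl2, rfl⟩ | ⟨l, hl2, rfl⟩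
  · exfalso
    have kr := one_div_mem (by norm_num) (cfValue_two_mem (by norm_num)
      (cfValue_two_mem p hr1.cfValue_mem))
    have kl := one_div_mem (by norm_num) (cfValue_one_mem (by norm_num)
      (cfValue_two_mem (by norm_num) (cfValue_one_mem p hl2.cfValue_mem)))
    norm_num at kl kr h2
    linarith [kl.1, kr.1]
  · exact ⟨l, hl2, rfl⟩

/-- The reflected word. -/
def reflect (θ : ℤ → ℕ+) : ℤ → ℕ+ := fun i => θ (-i)

lemma rightRay_reflect (θ : ℤ → ℕ+) (i : ℤ) : rightRay (reflect θ) i = leftRay θ (-i) := by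
  funext n; simp only [rightRay, reflect, leftRay]; congr 1; ring

lemma leftRay_reflect (θ : ℤ → ℕ+) (i : ℤ) : leftRay (reflect θ) i = rightRay θ (-i) := by
  funext n; simp only [rightRay, reflect, leftRay]; congr 1; ring

lemma lam_reflect (θ : ℤ → ℕ+) (i : ℤ) : lam (reflect θ) i = lam θ (-i) := by
  rw [lam_eq, lam_eq_left, rightRay_reflect, leftRay_reflect]
  congr 4; ring

lemma reflect_periodic {θ : ℤ → ℕ+} {p : ℤ} (h : Function.Periodic θ p) :
    Function.Periodic (reflect θ) p := by
  intro i
  simp only [reflect]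
  rw [← h (-(i + p))]; congr 1; ring

lemma readsAt_of_height_near {θ : ℤ → ℕ+} (hθ : ∀ i, θ i = 1 ∨ θ i = 2) {i : ℤ}
    (h1 : 31212 / 10000 ≤ lam θ i) (h2 : lam θ i ≤ 31215 / 10000)
    (hl : θ (i - 1) = 1) (hi : θ i = 2) (hr : θ (i + 1) = 2) :
    ∃ a b, OneTwo a ∧ OneTwo b ∧ ReadsAt θ i (prependTwos 3 a) (prependTwos 2 b) := by
  have e1 := rightRay_eq_rayCons θ (i + 1)
  have e2 := leftRay_eq_rayCons θ (i - 1)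
  rw [hr] at e1
  rw [hl] at e2
  rw [lam_eq_digit_add, e1, e2, hi, show (((2 : ℕ+) : ℕ) : ℝ) = 2 by norm_num] at h1 h2
  obtain ⟨⟨a, ha, ea⟩, b, hb, eb⟩ := first_digits_of_height_near (oneTwo_leftRay hθ _)
    (oneTwo_rightRay hθ _) h1 h2
  refine ⟨a, b, ha, hb, ?_, ?_⟩
  · rw [rightRay_eq_rayCons, hi, e1, ea]; rfl
  · rw [e2, eb]

/-- If `λ_i(θ)` is close to `1 + 3 / √2`, then, up to reflection, the digits around position `i`
are `2 2 1 2 2 2`, the position `i` being that of the first `2` after the `1`. -/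
lemma readsAt_or_reflect_of_height_near {θ : ℤ → ℕ+} (hθ : ∀ i, θ i = 1 ∨ θ i = 2) {i : ℤ}
    (h1 : 31212 / 10000 ≤ lam θ i) (h2 : lam θ i ≤ 31215 / 10000) :
    ∃ a b, OneTwo a ∧ OneTwo b ∧ (ReadsAt θ i (prependTwos 3 a) (prependTwos 2 b) ∨
      ReadsAt (reflect θ) (-i) (prependTwos 3 a) (prependTwos 2 b)) := by
  have hi : θ i = 2 := by
    rcases hθ i with hi | hi
    · have := lam_le_of_one hi
      linarith
    · exact hi
  have p : (0 : ℝ) < 136585 / 100000 := by norm_num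
  rcases hθ (i - 1) with hl | hl <;> rcases hθ (i + 1) with hr | hr
  · exfalso
    have kl := one_div_mem (by norm_num)
      (cfValue_one_mem p (oneTwo_leftRay hθ (i - 1 - 1)).cfValue_mem)
    have kr := one_div_mem (by norm_num)
      (cfValue_one_mem p (oneTwo_rightRay hθ (i + 1 + 1)).cfValue_mem)
    rw [lam_eq_digit_add, rightRay_eq_rayCons, leftRay_eq_rayCons, hl, hr, hi,
      show (((2 : ℕ+) : ℕ) : ℝ) = 2 by norm_num] at h2
    norm_num at kl kr h2
    linarith [kl.1, kr.1]
  · obtain ⟨a, b, ha, hb, h⟩ := readsAt_of_height_near hθ h1 h2 hl hi hr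
    exact ⟨a, b, ha, hb, Or.inl h⟩
  · rw [show i = - -i by ring, ← lam_reflect] at h1 h2
    obtain ⟨a, b, ha, hb, h⟩ := readsAt_of_height_near (θ := reflect θ) (fun j => hθ (-j)) h1 h2
      (by rw [← hr]; simp only [reflect]; congr 1; ring) (by rw [← hi]; simp [reflect])
      (by rw [← hl]; simp only [reflect]; congr 1; ring)
    exact ⟨a, b, ha, hb, Or.inr h⟩
  · have := lam_le_of_two_two_two hi hl hr
    linarith

/-! ### Nearby coordinates and common digits -/

lemma eq_prependTwos_of_coord_near {D : ℝ} (hD : D ≤ 15 / 10) {c : ℕ → ℕ+} (hc : OneTwo c)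
    (n : ℕ) : ∀ {a : ℕ → ℕ+}, OneTwo a → |coord a - coord (prependTwos n c)| ≤ q ^ n * D →
    ∃ a', OneTwo a' ∧ a = prependTwos n a' ∧ |coord a' - coord c| ≤ D := by
  induction n with
  | zero => intro a ha h; exact ⟨a, ha, rfl, by simpa [prependTwos] using h⟩
  | succ n ih =>
    intro a ha h
    rcases ha.cases with ⟨a, ha1, rfl⟩ | ⟨a, ha1, rfl⟩
    · exfalso
      have k1 := ha1.coord_one_mem
      have k2 := (hc.prependTwos n).coord_two_mem
      have k3 := (abs_le.mp h).1
      have k4 : q ^ n ≤ 1 := pow_le_one₀ q_pos.le q_lt_one.le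
      have k5 : 0 < q ^ n := pow_pos q_pos n
      have k6 : q ^ (n + 1) * D ≤ 26 / 100 := by
        have : q ^ (n + 1) ≤ 17158 / 100000 := by
          rw [pow_succ]; nlinarith [q_ub, q_pos]
        have : 0 < q ^ (n + 1) := pow_pos q_pos _
        nlinarith
      rw [prependTwos] at k3
      linarith
    · rw [prependTwos, coord_rayCons_two, coord_rayCons_two, ← mul_sub, abs_mul, abs_neg,
        abs_of_pos q_pos, pow_succ', mul_assoc] at h
      obtain ⟨a', h1, h2, h3⟩ := ih ha1 (le_of_mul_le_mul_left h q_pos)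
      exact ⟨a', h1, by rw [h2]; rfl, h3⟩

lemma eq_rayCons_one_of_coord_near {D : ℝ} (hD : D ≤ 8 / 10) {c : ℕ → ℕ+} (hc : OneTwo c)
    {a : ℕ → ℕ+} (ha : OneTwo a) (h : |coord a - coord (rayCons 1 c)| ≤ 368 / 1000 * D) :
    ∃ a', OneTwo a' ∧ a = rayCons 1 a' ∧ |coord a' - coord c| ≤ D := by
  have k1 := hc.coord_one_mem
  rcases ha.cases with ⟨a, ha1, rfl⟩ | ⟨a, ha1, rfl⟩
  · refine ⟨a, ha1, rfl, ?_⟩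
    have k2 := oneDen_mem ha1.coord_mem
    have k3 := oneDen_mem hc.coord_mem
    have k4 := (eight_div_oneDen_mem ha1.coord_mem hc.coord_mem).1
    rw [coord_rayCons_one, coord_rayCons_one, oneMap_sub (by linarith) (by linarith), abs_mul,
      abs_neg, abs_of_pos (by linarith)] at h
    have := abs_nonneg (coord a - coord c)
    nlinarith
  · exfalso
    have k2 := ha1.coord_two_mem
    have := (abs_le.mp h).2
    linarith

/-- Closeness of coordinates forces equality of the first digits. -/
lemma eq_prependBlocks_of_coord_near {m n h : ℕ} {c a : ℕ → ℕ+} (hc : OneTwo c) (ha : OneTwo a)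
    (hn : 1 ≤ n) (hh : 1 ≤ h)
    (hac : |coord a - coord (prependBlocks [m, n] (prependTwos h c))|
      ≤ q ^ (m + n + h) * (203 / 1000)) :
    ∃ a', OneTwo a' ∧ a = prependBlocks [m, n] (prependTwos h a') := by
  have q0 := q_pos
  have qh : q ^ h ≤ 2 / 10 := by
    have := q_pow_le hh
    have := q_ub
    rw [pow_one] at *; linarith
  have qn : q ^ n ≤ 2 / 10 := by
    have := q_pow_le hn
    have := q_ub
    rw [pow_one] at *; linarith
  have qh0 : 0 < q ^ h := pow_pos q0 _
  have qn0 : 0 < q ^ n := pow_pos q0 _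
  have qm0 : 0 < q ^ m := pow_pos q0 _
  have w1 : q ^ h * (15 / 10) ≤ 3 / 10 := by linarith
  have w2 : q ^ n * (368 / 1000 * (q ^ h * (15 / 10))) ≤ 3 / 10 := by nlinarith
  obtain ⟨a1, ha1, rfl, h1⟩ := eq_prependTwos_of_coord_near
    (D := 368 / 1000 * (q ^ n * (368 / 1000 * (q ^ h * (15 / 10))))) (by linarith)
    ((hc.prependTwos h).prependBlocks [n]).rayCons_one m ha (hac.trans (by
      rw [pow_add, pow_add]
      have : 0 < q ^ m * q ^ n * q ^ h := by positivity
      nlinarith))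
  obtain ⟨a2, ha2, rfl, h2⟩ := eq_rayCons_one_of_coord_near (by linarith)
    ((hc.prependTwos h).prependBlocks [n]) ha1 h1
  obtain ⟨a3, ha3, rfl, h3⟩ := eq_prependTwos_of_coord_near (by linarith)
    (hc.prependTwos h).rayCons_one n ha2 h2
  obtain ⟨a4, ha4, rfl, h4⟩ := eq_rayCons_one_of_coord_near (by linarith)
    (hc.prependTwos h) ha3 h3
  obtain ⟨a5, ha5, rfl, -⟩ := eq_prependTwos_of_coord_near (by norm_num) hc h ha4 h4
  exact ⟨a5, ha5, rfl⟩

/-- An upper bound for the height gives an upper bound for the coordinate on the left. -/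
lemma coord_left_le_of_height_le {x x' y y' ε Q : ℝ} (hQ : 0 < Q)
    (hx : |x| ≤ 1 / 10000) (hx' : |x'| ≤ 1 / 10000) (hy : y ≤ 1) (hy' : |y'| ≤ 1 / 10000)
    (hε : ε ≤ Q / 100000) (hd : x' - x ≤ 4275 / 1000000 * Q)
    (h : height x y ≤ height x' y' + ε) : y - y' ≤ 51 / 1000 * Q := by
  have q1 := q_lb
  have q2 := q_ub
  obtain ⟨x1, x2⟩ := abs_le.mp hx
  obtain ⟨x3, x4⟩ := abs_le.mp hx'
  obtain ⟨y3, y4⟩ := abs_le.mp hy'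
  by_contra! hcon
  have f1 := frontTerm_sub (x := x') (y := x) (by linarith) (by linarith)
  have g1 := backTerm_sub (x := y) (y := y') (by nlinarith) (by nlinarith)
  have f2 : 2 * (x' - x) / ((1 - x') * (1 - x)) ≤ 8560 / 1000000 * Q := by
    have : 9997 / 10000 ≤ (1 - x') * (1 - x) := by nlinarith
    rw [div_le_iff₀ (by linarith)]
    nlinarith
  have g2 : 8745 / 1000000 * Q ≤ q * (y - y') / ((1 - q * y) * (1 - q * y')) := by
    have d1 : 0 < 1 - q * y := by nlinarith
    have d2 : 1 - q * y ≤ 10001 / 10000 := by nlinarith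
    have d3 : 0 < 1 - q * y' := by nlinarith
    have d4 : 1 - q * y' ≤ 100002 / 100000 := by nlinarith
    have d2' : 1 - q * y ≤ 100002 / 100000 := by nlinarith
    have : (1 - q * y) * (1 - q * y') ≤ 100005 / 100000 := by nlinarith
    rw [le_div_iff₀ (mul_pos d1 d3)]
    nlinarith
  have s1 := sqrt_two_lb
  unfold height at h
  have : √2 * (frontTerm x + backTerm y - (frontTerm x' + backTerm y')) ≤ Q / 100000 := by linarith
  nlinarith

lemma prependTwos_agree {m : ℕ} {a b : ℕ → ℕ+} (h : ∀ j < m, a j = b j) (n : ℕ) :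
    ∀ j < m, prependTwos n a j = prependTwos n b j := by
  induction n with
  | zero => exact h
  | succ n ih =>
    intro j hj
    cases j with
    | zero => rfl
    | succ j => exact ih j (by omega)

lemma prependBlocks_agree {m : ℕ} {a b : ℕ → ℕ+} (h : ∀ j < m, a j = b j) (l : List ℕ) :
    ∀ j < m, prependBlocks l a j = prependBlocks l b j := by
  induction l with
  | nil => exact h
  | cons n l ih =>
    refine prependTwos_agree (fun j hj => ?_) n
    cases j with
    | zero => rfl
    | succ j => exact ih j (by omega)

/-- The infinite word `2_{n₁} 1 2_{n₂} 1 … ` is determined by its blocks. -/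
lemma eq_of_forall_eq_prependBlocks {n : ℕ} {l : List ℕ} {f : ℕ → ℕ → ℕ+} {a : ℕ → ℕ+}
    (hf : ∀ t, f t = prependBlocks (n :: l) (f (t + 1))) (ha : a = prependBlocks (n :: l) a)
    (t : ℕ) : f t = a := by
  have key : ∀ m t, ∀ j < m, f t j = a j := by
    intro m
    induction m with
    | zero => intro t j hj; omega
    | succ m ih =>
      intro t
      rw [hf t, ha]
      refine prependTwos_agree (fun j hj => ?_) n
      cases j with
      | zero => rfl
      | succ j => exact prependBlocks_agree (ih (t + 1)) l j (by omega)
  funext j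
  exact key (j + 1) t j (by omega)

/-! ### Periods to the left of a position with large `λ` -/

lemma ReadsAt.leftRay_sub_two {θ : ℤ → ℕ+} {i : ℤ} {a c : ℕ → ℕ+} (h : ReadsAt θ i a c) :
    leftRay θ (i - 2) = c := by
  have := (rightRay_of_leftRay_cons h.2).1
  rwa [show i - 1 - 1 = i - 2 by ring] at this

/-- A block that is too short by two digits leads to a large `λ`. -/
lemma lt_height_of_short_block {M : ℕ} (hM : Even M) {b c : ℕ → ℕ+} (hb : OneTwo b)
    (hc : OneTwo c) : 1 + 3 / √2 + √2 * (3 * q ^ (M + 3)) <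
      height (coord (prependTwos (M + 1) (rayCons 1 b)))
        (coord (prependTwos (M + 4) (rayCons 1 c))) := by
  have q0 := q_pos
  have q1 := q_lb
  have q2 := q_ub
  have hb1 := hb.coord_one_mem
  have hc1 := hc.coord_one_mem
  have hQ : 0 < q ^ (M + 1) := pow_pos q0 _
  have hQ1 : q ^ (M + 1) ≤ 1 := pow_le_one₀ q0.le q_lt_one.le
  have e3 : q ^ (M + 3) = q ^ (M + 1) * q ^ 2 := by rw [← pow_add]
  have e4 : q ^ (M + 4) = q ^ (M + 1) * q ^ 3 := by rw [← pow_add]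
  have s2 : q ^ 2 ≤ 3 / 100 := by nlinarith
  have s3 : q ^ 3 ≤ 6 / 1000 := (pow_le_pow_left₀ q0.le q2.le 3).trans (by norm_num)
  have s30 : 0 < q ^ 3 := pow_pos q0 3
  rw [coord_block_odd hM.add_one, coord_block_even (hM.add (by decide)), e3, e4]
  set x := q ^ (M + 1) * -coord (rayCons 1 b) with hx
  set y := q ^ (M + 1) * q ^ 3 * coord (rayCons 1 c) with hy
  have x1 : 3177 / 10000 * q ^ (M + 1) ≤ x := by rw [hx]; nlinarith
  have x2 : x < 1 := by rw [hx]; nlinarith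
  have hQ3 : 0 < q ^ (M + 1) * q ^ 3 := mul_pos hQ s30
  have hQ4 : q ^ (M + 1) * q ^ 3 ≤ 6 / 1000 * q ^ (M + 1) := by nlinarith
  have y1 : -(4 / 1000) * q ^ (M + 1) ≤ y := by rw [hy]; nlinarith
  have y2 : y ≤ 0 := by rw [hy]; nlinarith
  have f1 : 2 * x ≤ frontTerm x := by
    unfold frontTerm
    rw [le_div_iff₀ (by linarith)]
    nlinarith
  have g1 : q * y ≤ backTerm y := by
    unfold backTerm
    rw [le_div_iff₀ (by nlinarith)]
    nlinarith [sq_nonneg (q * y)]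
  have g2 : y ≤ q * y := by nlinarith
  have : 3 * (q ^ (M + 1) * q ^ 2) < frontTerm x + backTerm y := by nlinarith
  unfold height
  have := mul_lt_mul_of_pos_left this (show (0 : ℝ) < √2 by positivity)
  linarith

lemma coord_three_block_mem {L : ℕ → ℕ+} (hL : |coord L| ≤ 12 / 100000) :
    275 / 100000 ≤ coord (prependTwos 3 (rayCons 1 L)) ∧
      coord (prependTwos 3 (rayCons 1 L)) ≤ 278 / 100000 := by
  have k := coord_one_near hL
  have q1 : (17156 / 100000 : ℝ) ^ 3 ≤ q ^ 3 := pow_le_pow_left₀ (by norm_num) q_lb.le 3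
  have q2 : q ^ 3 ≤ (17158 / 100000) ^ 3 := pow_le_pow_left₀ q_pos.le q_ub.le 3
  norm_num at q1 q2
  rw [coord_block_odd (by decide)]
  constructor <;> nlinarith

/-- The digits of a ray whose coordinate is not much smaller than that of `2_3 1 L` with `L` close
to `2 2 2 …`. -/
lemma cases_of_le_coord {b : ℕ → ℕ+} (hb : OneTwo b) (h : 265 / 100000 ≤ coord b) :
    (∃ c, OneTwo c ∧ b = rayCons 2 (rayCons 1 c)) ∨
      ∃ c, OneTwo c ∧ b = prependTwos 3 (rayCons 1 c) := by
  have q0 := q_pos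
  have q1 := q_lb
  have q2 := q_ub
  rcases hb.cases with ⟨b1, hb1, rfl⟩ | ⟨b1, hb1, rfl⟩
  · linarith [hb1.coord_one_mem.2]
  rcases hb1.cases with ⟨b2, hb2, rfl⟩ | ⟨b2, hb2, rfl⟩
  · exact Or.inl ⟨b2, hb2, rfl⟩
  have e2 : 89 / 1000 ≤ coord b2 := by
    rw [coord_rayCons_two, coord_rayCons_two] at h
    have : q * q ≤ 2945 / 100000 := by nlinarith
    have : 0 < q * q := by positivity
    by_contra! hcon
    nlinarith
  rcases hb2.cases with ⟨b3, hb3, rfl⟩ | ⟨b3, hb3, rfl⟩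
  · linarith [hb3.coord_one_mem.2]
  rcases hb3.cases with ⟨b4, hb4, rfl⟩ | ⟨b4, hb4, rfl⟩
  · exact Or.inr ⟨b4, hb4, rfl⟩
  · exfalso
    rw [coord_rayCons_two] at e2
    nlinarith [hb4.coord_two_mem.1]

/-- The left side of a position: once two blocks and a part of the third one are those of `L`, the
third block is complete. -/
lemma left_block_eq {M : ℕ} (hM4 : 4 ≤ M) (hM : Even M) {θ : ℤ → ℕ+} {i : ℤ}
    {A b L : ℕ → ℕ+} (hA : OneTwo A) (hb : OneTwo b) (hL : OneTwo L)
    (hL1 : |coord L| ≤ 1 / 10000)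
    (hLper : L = prependBlocks [M + 3 + 2, M + 3 + 1, M + 3] L)
    (hread : ReadsAt θ i A (prependBlocks [M + 3 + 2, M + 3 + 1] (prependTwos M b)))
    (hlam : ∀ t, lam θ t ≤ 1 + 3 / √2 + √2 * (3 * q ^ (M + 3)))
    (hy : coord (prependBlocks [M + 3 + 2, M + 3 + 1] (prependTwos M b)) - coord L
      ≤ 51 / 1000 * q ^ (6 * M + 22)) :
    ∃ b', OneTwo b' ∧ prependBlocks [M + 3 + 2, M + 3 + 1] (prependTwos M b)
      = prependBlocks [M + 3 + 2, M + 3 + 1, M + 3] b' := by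
  have q0 := q_pos
  obtain ⟨c, hc1, -, hc⟩ := coord_prependBlocks_sub [M + 3 + 2, M + 3 + 1] (hb.prependTwos M)
    ((hL.rayCons_one.prependTwos 3).prependTwos M)
  have e : prependBlocks [M + 3 + 2, M + 3 + 1] (prependTwos M (prependTwos 3 (rayCons 1 L)))
      = L := by
    conv_rhs => rw [hLper]
    rw [← prependTwos_add]; rfl
  have hs : Odd ([M + 3 + 2, M + 3 + 1].sum + [M + 3 + 2, M + 3 + 1].length) := by
    refine ⟨M + 5, ?_⟩
    simp; omega
  rw [e, coord_prependTwos, coord_prependTwos, ← mul_sub, hs.neg_one_pow, hM.neg_pow] at hc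
  rw [hc] at hy
  have hw := coord_three_block_mem (hL1.trans (by norm_num))
  set w := coord (prependTwos 3 (rayCons 1 L)) with hwdef
  have hb0 : 265 / 100000 ≤ coord b := by
    by_contra! hcon
    have h1 : 1 / 10000 ≤ w - coord b := by linarith
    have hp : 0 < q ^ (3 * M + 9) := pow_pos q0 _
    have h2 : q ^ (3 * M + 9) * (135 / 1000) ≤ c * q ^ M := by
      have : q ^ (2 * M + 9) * (135 / 1000) ≤ c := by
        refine le_trans ?_ hc1
        simp only [List.sum_cons, List.sum_nil, List.length_cons, List.length_nil]
        rw [show M + 3 + 2 + (M + 3 + 1 + 0) = 2 * M + 9 by omega]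
        have : 0 < q ^ (2 * M + 9) := pow_pos q0 _
        norm_num
        linarith
      rw [show 3 * M + 9 = 2 * M + 9 + M by omega, pow_add]
      have : 0 < q ^ M := pow_pos q0 _
      nlinarith
    have h3 : q ^ (6 * M + 22) ≤ q ^ (3 * M + 9) * (1 / 10000) := by
      rw [show 6 * M + 22 = 3 * M + 9 + (3 * M + 13) by omega, pow_add]
      have : q ^ (3 * M + 13) ≤ q ^ 6 := q_pow_le (by omega)
      have : q ^ 6 ≤ 1 / 10000 := (pow_le_pow_left₀ q0.le q_ub.le 6).trans (by norm_num)
      nlinarith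
    nlinarith
  rcases cases_of_le_coord hb hb0 with ⟨d, hd, rfl⟩ | ⟨d, hd, rfl⟩
  · exfalso
    have hr : ReadsAt θ i A (prependBlocks [M + 3 + 2, M + 3 + 1, M + 1] d) := by
      rw [← prependTwos_succ'] at hread
      exact hread
    have h1 := hr.moveBlocksBack.lam_end_eq (n := M + 1)
      (a := prependBlocks [M + 3 + 1, M + 3 + 2] A)
    have h2 := lt_height_of_short_block hM hd (hA.prependBlocks [M + 3 + 2])
    have h3 := hlam (i - (([M + 3 + 2, M + 3 + 1, M + 1].sum
      + [M + 3 + 2, M + 3 + 1, M + 1].length : ℕ) : ℤ) + ((M + 1 : ℕ) : ℤ) - 1)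
    rw [h1] at h3
    exact absurd h3 (not_le.mpr h2)
  · refine ⟨d, hd, ?_⟩
    rw [← prependTwos_add]; rfl

/-- The left side of a position: if a complete period `u` is followed by a ray with coordinate close
enough to that of `L = u u …`, then the next period begins correctly. -/
lemma next_blocks_eq {M : ℕ} {b L : ℕ → ℕ+}
    (hM4 : 4 ≤ M) (hM : Even M) (hb : OneTwo b) (hL : OneTwo L)
    (hLper : L = prependBlocks [M + 3 + 2, M + 3 + 1, M + 3] L)
    (hy : coord (prependBlocks [M + 3 + 2, M + 3 + 1, M + 3] b) - coord L
      ≤ 51 / 1000 * q ^ (6 * M + 22))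
    (hy' : coord b - coord L ≤ 51 / 1000 * q ^ (6 * M + 22)) :
    ∃ b', OneTwo b' ∧ b = prependBlocks [M + 3 + 2, M + 3 + 1] (prependTwos M b') := by
  have q0 := q_pos
  have e : prependBlocks [M + 3 + 2, M + 3 + 1] (prependTwos M (prependTwos 3 (rayCons 1 L)))
      = L := by
    conv_rhs => rw [hLper]
    rw [← prependTwos_add]; rfl
  apply eq_prependBlocks_of_coord_near (hL.rayCons_one.prependTwos 3) hb (by omega) (by omega)
  rw [e, show M + 3 + 2 + (M + 3 + 1) + M = 3 * M + 9 by omega]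
  obtain ⟨c, hc1, -, hc⟩ := coord_prependBlocks_sub [M + 3 + 2, M + 3 + 1, M + 3] hb hL
  have hs : Odd ([M + 3 + 2, M + 3 + 1, M + 3].sum + [M + 3 + 2, M + 3 + 1, M + 3].length) := by
    obtain ⟨m, rfl⟩ := hM
    refine ⟨3 * m + 7, ?_⟩
    simp; omega
  rw [← hLper, hs.neg_one_pow] at hc
  rw [hc] at hy
  have hp : 0 < q ^ (3 * M + 9) := pow_pos q0 _
  have hpow : q ^ (6 * M + 22) = q ^ (3 * M + 9) * (q ^ (3 * M + 12) * q) := by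
    rw [← pow_succ, ← pow_add]; congr 1; omega
  have hp2 : 0 < q ^ (3 * M + 12) := pow_pos q0 _
  have hc2 : q ^ (3 * M + 12) * (498 / 10000) ≤ c := by
    refine le_trans ?_ hc1
    simp only [List.sum_cons, List.sum_nil, List.length_cons, List.length_nil]
    rw [show M + 3 + 2 + (M + 3 + 1 + (M + 3 + 0)) = 3 * M + 12 by omega]
    norm_num
    linarith
  rw [abs_le]
  constructor
  · by_contra! hcon
    have h1 : q ^ (3 * M + 9) * (203 / 1000) ≤ coord L - coord b := by linarith
    have h2 : q ^ (3 * M + 12) * (498 / 10000) * (q ^ (3 * M + 9) * (203 / 1000))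
        ≤ c * (coord L - coord b) :=
      mul_le_mul hc2 h1 (by positivity) ((by positivity : (0:ℝ) ≤ _).trans hc2)
    rw [hpow] at hy
    have h3 : 0 < q ^ (3 * M + 9) * q ^ (3 * M + 12) := mul_pos hp hp2
    nlinarith [q_ub]
  · have : q ^ (3 * M + 12) * q ≤ 1 := mul_le_one₀ (pow_le_one₀ q0.le q_lt_one.le) q0.le q_lt_one.le
    rw [hpow] at hy'
    nlinarith

/-- If the right side of a position is close to `R = ω ω …`, the left side begins like
`L = … ω ω`, and no `λ` exceeds the bound, then the left side is `L`. -/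
lemma leftRay_eq_of_lam_le {M : ℕ} (hM4 : 4 ≤ M) (hM : Even M) {θ : ℤ → ℕ+}
    {R L : ℕ → ℕ+} (hR : OneTwo R) (hL : OneTwo L) (hL1 : |coord L| ≤ 1 / 10000)
    (hRper : R = prependBlocks [M + 3, M + 3 + 1, M + 3 + 2] R)
    (hLper : L = prependBlocks [M + 3 + 2, M + 3 + 1, M + 3] L)
    {x ε : ℝ} (hx : |x| ≤ 1 / 10000) (hxR : x - coord R ≤ 4262 / 1000000 * q ^ (6 * M + 22))
    (hε : ε ≤ q ^ (6 * M + 22) / 100000)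
    (hlam : ∀ t, lam θ t ≤ height x (coord L) + ε)
    (hbd : height x (coord L) + ε ≤ 1 + 3 / √2 + √2 * (3 * q ^ (M + 3)))
    {i : ℤ} {A b : ℕ → ℕ+} (hA : OneTwo A) (hb : OneTwo b)
    (hread : ReadsAt θ i A (prependBlocks [M + 3 + 2, M + 3 + 1] (prependTwos M b)))
    (hA1 : |coord A| ≤ 1 / 10000)
    (hAR : |coord A - coord R| ≤ 13 / 1000000 * q ^ (6 * M + 22)) :
    leftRay θ (i - 2) = L := by
  have hQ : 0 < q ^ (6 * M + 22) := pow_pos q_pos _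
  have hP : ([M + 3 + 2, M + 3 + 1, M + 3].sum + [M + 3 + 2, M + 3 + 1, M + 3].length)
      = 3 * M + 15 := by simp; omega
  have upper : ∀ {j : ℤ} {A c : ℕ → ℕ+}, OneTwo c → |coord A| ≤ 1 / 10000 →
      |coord A - coord R| ≤ 13 / 1000000 * q ^ (6 * M + 22) → ReadsAt θ j A c →
      coord c - coord L ≤ 51 / 1000 * q ^ (6 * M + 22) := by
    intro j A c hc h1 h2 h3
    have h4 := hlam j
    rw [h3.lam_eq] at h4
    refine coord_left_le_of_height_le hQ h1 hx (by linarith [hc.coord_mem.2]) hL1 hε ?_ h4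
    linarith [(abs_le.mp h2).1]
  -- the right side of position `j` is close to `R`, and its left side begins with a complete period
  let G : ℤ → Prop := fun j => ∃ A b, OneTwo A ∧ OneTwo b ∧ |coord A| ≤ 1 / 10000 ∧
    |coord A - coord R| ≤ 13 / 1000000 * q ^ (6 * M + 22) ∧
    ReadsAt θ j A (prependBlocks [M + 3 + 2, M + 3 + 1, M + 3] b)
  have complete : ∀ {j : ℤ} {A b : ℕ → ℕ+}, OneTwo A → OneTwo b → |coord A| ≤ 1 / 10000 →
      |coord A - coord R| ≤ 13 / 1000000 * q ^ (6 * M + 22) →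
      ReadsAt θ j A (prependBlocks [M + 3 + 2, M + 3 + 1] (prependTwos M b)) → G j := by
    intro j A b hA hb h1 h2 h3
    obtain ⟨b', hb', e⟩ := left_block_eq hM4 hM hA hb hL hL1 hLper h3
      (fun t => (hlam t).trans hbd) (upper ((hb.prependTwos M).prependBlocks _) h1 h2 h3)
    rw [e] at h3
    exact ⟨A, b', hA, hb', h1, h2, h3⟩
  have step : ∀ {j : ℤ}, G j → leftRay θ (j - 2) = prependBlocks [M + 3 + 2, M + 3 + 1, M + 3]
      (leftRay θ (j - (3 * M + 15 : ℕ) - 2)) ∧ G (j - (3 * M + 15 : ℕ)) := by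
    rintro j ⟨A, b, hA, hb, h1, h2, h3⟩
    have h4 : ReadsAt θ (j - (3 * M + 15 : ℕ))
        (prependBlocks [M + 3, M + 3 + 1, M + 3 + 2] A) b := by
      have := h3.moveBlocksBack
      rw [hP] at this
      exact this
    have hA1' : |coord (prependBlocks [M + 3, M + 3 + 1, M + 3 + 2] A)| ≤ 1 / 10000 :=
      abs_coord_prependTwos_le_of_five_le (by omega)
        (hA.prependBlocks [M + 3 + 1, M + 3 + 2]).rayCons_one
    have hAR' : |coord (prependBlocks [M + 3, M + 3 + 1, M + 3 + 2] A) - coord R|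
        ≤ 13 / 1000000 * q ^ (6 * M + 22) := by
      obtain ⟨c, c1, c2, c3⟩ := coord_prependBlocks_sub [M + 3, M + 3 + 1, M + 3 + 2] hA hR
      have c0 : 0 ≤ c := le_trans (by have := q_pos; positivity) c1
      have c4 : c ≤ 1 :=
        c2.trans (mul_le_one₀ (pow_le_one₀ q_pos.le q_lt_one.le) (by positivity)
          (pow_le_one₀ (by norm_num) (by norm_num)))
      rw [← hRper] at c3
      rw [c3, abs_mul, abs_mul, abs_neg_one_pow, one_mul, abs_of_nonneg c0]
      have := abs_nonneg (coord A - coord R)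
      nlinarith
    refine ⟨by rw [h3.leftRay_sub_two, h4.leftRay_sub_two], ?_⟩
    obtain ⟨b', hb', rfl⟩ := next_blocks_eq hM4 hM hb hL hLper
      (upper (hb.prependBlocks _) h1 h2 h3) (upper hb hA1' hAR' h4)
    exact complete (hA.prependBlocks _) hb' hA1' hAR' h4
  have all : ∀ t : ℕ, G (i - t * (3 * M + 15 : ℕ)) := by
    intro t
    induction t with
    | zero => simpa using complete hA hb hA1 hAR hread
    | succ t ih =>
      have := (step ih).2
      convert this using 1
      push_cast; ring
  have := eq_of_forall_eq_prependBlocks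
    (f := fun t : ℕ => leftRay θ (i - t * (3 * M + 15 : ℕ) - 2))
    (fun t => (step (all t)).1.trans (by congr 2; push_cast; ring)) hLper 0
  simpa using this

/-- A periodic word that agrees with `θ(ω_k)` to the left of some position is a translate of
`θ(ω_k)`. -/
lemma lam_le_of_leftRay_eq {k : ℕ} (hk : 1 ≤ k) {θ : ℤ → ℕ+} {p : ℤ} (hp : 0 < p)
    (hper : Function.Periodic θ p) {j : ℤ}
    (h : leftRay θ (j - 1) = rayCons 1 (omegaLeft k)) (t : ℤ) :
    lam θ t ≤ markovValue (thetaOmega k) := by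
  have h1 : ∀ s : ℤ, s ≤ -1 → θ (j + s) = thetaOmega k s := by
    intro s hs
    rw [← (readsAt_thetaOmega hk).2] at h
    have := congrFun h (-1 - s).toNat
    unfold leftRay at this
    have e : (((-1 - s).toNat : ℕ) : ℤ) = -1 - s := by omega
    rw [e, show j - 1 - (-1 - s) = j + s by ring, show 0 - 1 - (-1 - s) = s by ring] at this
    exact this
  have hl := length_omega k hk
  set P : ℤ := ((omega k).length : ℤ) with hP
  have hP0 : 0 < P := by omega
  have h2 : ∀ s : ℤ, θ (j + s) = thetaOmega k s := by
    intro s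
    have e1 := (hper.int_mul (P * (|s| + 1))).sub_eq (j + s)
    have e2 := ((thetaOmega_periodic k).int_mul (p * (|s| + 1))).sub_eq s
    simp only [Int.cast_id] at e1 e2
    rw [← hP] at e2
    rw [← e1, ← e2, show j + s - P * (|s| + 1) * p = j + (s - p * (|s| + 1) * P) by ring]
    apply h1
    have : 1 ≤ p * P := by nlinarith
    have := le_abs_self s
    have := abs_nonneg s
    nlinarith
  have h3 : θ = fun s => thetaOmega k (s - j) := by
    funext s
    rw [← h2]; congr 1; ring
  have h4 : lam θ t = lam (thetaOmega k) (t - j) := by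
    rw [h3]
    unfold lam
    congr 3
    · funext n; exact congrArg _ (by ring)
    · funext n; exact congrArg _ (by ring)
  rw [h4]
  exact le_ciSup (bddAbove_lam (thetaOmega_oneTwo k)) _

/-! ### The Lagrange spectrum does not contain the values of `γ_k^1` -/

lemma coord_gammaRight_sub_le {k : ℕ} (hk : 1 ≤ k) :
    coord (gammaRight k) - coord (omegaRight k)
      ≤ 4262 / 1000000 * q ^ (6 * (2 * k - 1) + 4) := by
  obtain ⟨c, c1, c2, c3⟩ := coord_prependBlocks_sub [2 * k - 1, 2 * k - 1 + 1, 2 * k - 1 + 2]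
    (oneTwo_const_two.rayCons_one.prependBlocks [2 * k - 1, 2 * k - 1 + 1, 2 * k - 1])
    (omegaRight_oneTwo k)
  obtain ⟨h1, h2⟩ := coord_second_sub hk
  have hodd : Odd ([2 * k - 1, 2 * k - 1 + 1, 2 * k - 1 + 2].sum
      + [2 * k - 1, 2 * k - 1 + 1, 2 * k - 1 + 2].length) := by
    refine ⟨3 * k + 1, ?_⟩
    simp; omega
  have c0 : 0 ≤ c := le_trans (by have := q_pos; positivity) c1
  rw [← omegaRight_eq hk, ← gammaRight_eq, hodd.neg_one_pow] at c3
  simp only [List.sum_cons, List.sum_nil, List.length_cons, List.length_nil] at c2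
  rw [c3]
  generalize 2 * k - 1 = N at *
  have e : q ^ (6 * N + 4) = q ^ (N + (N + 1 + (N + 2 + 0))) * q ^ (3 * N + 1) := by
    rw [← pow_add]; congr 1; omega
  have := mul_le_mul c2 h2 h1.le (by have := q_pos; positivity)
  have : 0 < q ^ (N + (N + 1 + (N + 2 + 0))) * q ^ (3 * N + 1) := by
    have := q_pos; positivity
  rw [e]
  nlinarith

/-- A ray that agrees with `R = ω ω …` for nearly three periods has almost the same coordinate. -/
lemma abs_coord_periods_sub_le {M : ℕ} {R a : ℕ → ℕ+} (hR : OneTwo R) (ha : OneTwo a)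
    (hRper : R = prependBlocks [M + 3, M + 3 + 1, M + 3 + 2] R) :
    |coord (prependBlocks [M + 3, M + 3 + 1, M + 3 + 2]
        (prependBlocks [M + 3, M + 3 + 1, M + 3 + 2, M + 3, M + 3 + 1] (prependTwos (M + 3) a)))
      - coord R| ≤ 13 / 1000000 * q ^ (6 * M + 22) := by
  have q0 := q_pos
  have hRR : R = prependBlocks [M + 3, M + 3 + 1, M + 3 + 2, M + 3, M + 3 + 1]
      (prependTwos (M + 3) (prependTwos 2 (rayCons 1 R))) := by
    rw [← prependTwos_add]
    conv_lhs => rw [hRper, hRper]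
    rfl
  obtain ⟨c, c1, c2, c3⟩ := coord_prependBlocks_sub
    [M + 3, M + 3 + 1, M + 3 + 2, M + 3, M + 3 + 1] (ha.prependTwos (M + 3))
    ((hR.rayCons_one.prependTwos 2).prependTwos (M + 3))
  obtain ⟨d, d1, d2, d3⟩ := coord_prependBlocks_sub [M + 3, M + 3 + 1, M + 3 + 2]
    ((ha.prependTwos (M + 3)).prependBlocks [M + 3, M + 3 + 1, M + 3 + 2, M + 3, M + 3 + 1]) hR
  have c0 : 0 ≤ c := le_trans (by positivity) c1
  have d0 : 0 ≤ d := le_trans (by positivity) d1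
  rw [← hRR, coord_prependTwos, coord_prependTwos, ← mul_sub] at c3
  rw [← hRper] at d3
  have hz : |coord a - coord (prependTwos 2 (rayCons 1 R))| ≤ 1 := by
    have k1 := ha.coord_mem
    have k2 := (hR.rayCons_one.prependTwos 2).coord_mem
    rw [abs_le]; constructor <;> linarith
  rw [d3, c3]
  simp only [abs_mul, abs_pow, abs_neg, abs_one, one_pow, one_mul, abs_of_nonneg c0,
    abs_of_nonneg d0, abs_of_pos q0]
  simp only [List.sum_cons, List.sum_nil, List.length_cons, List.length_nil] at c2 d2
  have c5 : c * q ^ (M + 3) ≤ 13 / 1000 * q ^ (6 * M + 22) := by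
    rw [show M + 3 + (M + 3 + 1 + (M + 3 + 2 + (M + 3 + (M + 3 + 1 + 0)))) = 5 * M + 19 by ring]
      at c2
    have h1 : c * q ^ (M + 3) ≤ q ^ (5 * M + 19) * (13 / 1000) * q ^ (M + 3) := by
      refine mul_le_mul_of_nonneg_right (c2.trans ?_) (pow_nonneg q0.le _)
      exact mul_le_mul_of_nonneg_left (by norm_num) (pow_nonneg q0.le _)
    refine h1.trans (le_of_eq ?_)
    rw [show 6 * M + 22 = 5 * M + 19 + (M + 3) by ring, pow_add q (5 * M + 19)]
    ring
  have d5 : d ≤ 1 / 1000 := by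
    have h1 : q ^ (M + 3 + (M + 3 + 1 + (M + 3 + 2 + 0))) ≤ q ^ 5 := q_pow_le (by omega)
    have h2 := mul_le_mul h1 (show (419 / 1000 : ℝ) ^ (0 + 1 + 1 + 1) ≤ 1 by norm_num)
      (by positivity) (by positivity)
    linarith [q_pow_five]
  have h5 : 0 ≤ c * q ^ (M + 3) := mul_nonneg c0 (pow_nonneg q0.le _)
  calc d * (c * (q ^ (M + 3) * |coord a - coord (prependTwos 2 (rayCons 1 R))|))
      = d * ((c * q ^ (M + 3)) * |coord a - coord (prependTwos 2 (rayCons 1 R))|) := by ring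
    _ ≤ 1 / 1000 * ((13 / 1000 * q ^ (6 * M + 22)) * 1) := by gcongr
    _ = _ := by ring

set_option maxHeartbeats 400000 in
/-- No periodic word has a `λ` close to the Markov value of `γ_k^1` as its largest one. -/
lemma false_of_readsAt {k : ℕ} (hk : 4 ≤ k) {ε : ℝ} (hε0 : 0 ≤ ε)
    (hε : ε ≤ q ^ (6 * (2 * k - 1) + 40)) (hε1 : ε < gammaHeight k - omegaHeight k)
    {θ : ℤ → ℕ+} {p : ℤ} (hp : 0 < p) (hper : Function.Periodic θ p)
    (hlam : ∀ t, lam θ t ≤ gammaHeight k + ε) {i : ℤ} (hi : gammaHeight k - ε ≤ lam θ i)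
    {a b : ℕ → ℕ+} (ha : OneTwo a) (hb : OneTwo b)
    (hread : ReadsAt θ i (prependTwos 3 a) (prependTwos 2 b)) : False := by
  have q0 := q_pos
  have hL := omegaLeft_oneTwo k
  have hL1 := omegaLeft_near (k := k) (by omega)
  have hLper := omegaLeft_eq (k := k) (by omega)
  have hR := omegaRight_oneTwo k
  have hRper := omegaRight_eq (k := k) (by omega)
  have hγ : gammaRight k = prependBlocks
    [2 * k - 1, 2 * k - 1 + 1, 2 * k - 1 + 2, 2 * k - 1, 2 * k - 1 + 1]
    (prependTwos (2 * k - 1) (rayCons 1 (rayCons 1 (fun _ => 2)))) := rfl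
  have hgR := coord_gammaRight_sub_le (k := k) (by omega)
  have hg1 : |coord (gammaRight k)| ≤ 1 / 10000 :=
    abs_coord_prependTwos_le_of_five_le (by omega)
      (oneTwo_const_two.rayCons_one.prependBlocks
        [2 * k - 1 + 1, 2 * k - 1 + 2, 2 * k - 1, 2 * k - 1 + 1, 2 * k - 1]).rayCons_one
  have hG := (gammaHeight_mem (k := k) (by omega)).2
  have hgdef : gammaHeight k = height (coord (gammaRight k)) (coord (omegaLeft k)) := rfl
  suffices ∃ j, leftRay θ (j - 1) = rayCons 1 (omegaLeft k) by
    obtain ⟨j, hj⟩ := this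
    have := lam_le_of_leftRay_eq (by omega) hp hper hj i
    rw [markovValue_thetaOmega (by omega)] at this
    linarith
  -- the first three digits on the right of `i` are twos, whence the shift by three
  obtain ⟨M, hM4, hM, e⟩ : ∃ M, 4 ≤ M ∧ Even M ∧ 2 * k - 1 = M + 3 :=
    ⟨2 * k - 4, by omega, ⟨k - 2, by omega⟩, by omega⟩
  rw [e] at hLper hRper hγ hgR hG hε
  rw [show 6 * (M + 3) + 4 = 6 * M + 22 by ring] at hgR
  rw [show 6 * (M + 3) + 40 = 6 * M + 58 by ring] at hε
  generalize omegaRight k = R at *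
  generalize gammaRight k = Γ at *
  generalize omegaLeft k = L at *
  have hLL : L = prependBlocks [M + 3 + 2, M + 3 + 1, M + 3, M + 3 + 2, M + 3 + 1]
      (prependTwos M (prependTwos 3 (rayCons 1 L))) := by
    rw [← prependTwos_add]
    conv_lhs => rw [hLper, hLper]
    rfl
  have hQ : 0 < q ^ (6 * M + 22) := pow_pos q0 _
  obtain ⟨a', b', ha', hb', ea, eb⟩ := agree_of_height_near hM4 hL
    (hL1.trans (by norm_num)) ha hb (by
      rw [← hLL, ← hγ, ← hread.lam_eq, ← hgdef, abs_le]
      constructor <;> linarith [hlam i])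
  rw [ea, eb] at hread
  have hread' : ReadsAt θ i _ (prependBlocks [M + 3 + 2, M + 3 + 1, M + 3]
    (prependBlocks [M + 3 + 2, M + 3 + 1] (prependTwos M b'))) := hread
  have h1 := hread'.moveBlocksBack
  set A := prependBlocks [M + 3, M + 3 + 1, M + 3 + 2, M + 3, M + 3 + 1] (prependTwos (M + 3) a')
    with hAdef
  have hA : OneTwo A := (ha'.prependTwos _).prependBlocks _
  have h2 := leftRay_eq_of_lam_le hM4 hM hR hL hL1 hRper hLper hg1 hgR (ε := ε) ?_ ?_ ?_
    (hA.prependBlocks _) hb' h1 ?_ ?_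
  · rw [h1.leftRay_sub_two] at h2
    exact ⟨_, by rw [← h2]; exact h1.2⟩
  · refine hε.trans ?_
    rw [show 6 * M + 58 = 6 * M + 22 + 36 by ring, pow_add]
    have : q ^ 36 ≤ q ^ 8 := q_pow_le (by norm_num)
    have : q ^ 8 ≤ 1 / 100000 := (pow_le_pow_left₀ q0.le q_ub.le 8).trans (by norm_num)
    nlinarith
  · rw [← hgdef]; exact hlam
  · rw [← hgdef]
    have h3 : q ^ (6 * M + 58) ≤ q ^ (M + 3) := q_pow_le (by omega)
    have h4 : 0 < q ^ (M + 3) := pow_pos q0 _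
    nlinarith [sqrt_two_lb]
  · exact abs_coord_prependTwos_le_of_five_le (by omega)
      (hA.prependBlocks [M + 3 + 1, M + 3 + 2]).rayCons_one
  · exact abs_coord_periods_sub_le hR ha' hRper

/-- The largest `λ` of a periodic word is attained. -/
lemma exists_lam_eq_markovValue {θ : ℤ → ℕ+} {p : ℤ} (hp : 0 < p) (hper : Function.Periodic θ p) :
    (∀ t, lam θ t ≤ markovValue θ) ∧ ∃ i, lam θ i = markovValue θ := by
  have hfin : (Set.range (lam θ)).Finite := by
    refine ((Set.finite_Ico (0 : ℤ) p).image (lam θ)).subset ?_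
    rintro _ ⟨t, rfl⟩
    obtain ⟨s, hs, h⟩ := (lam_periodic hper).exists_mem_Ico₀ hp t
    exact ⟨s, hs, h.symm⟩
  exact ⟨fun t => le_ciSup hfin.bddAbove t, (Set.range_nonempty _).csSup_mem hfin⟩

lemma gammaHeight_near {k : ℕ} (hk : 4 ≤ k) :
    312131 / 100000 ≤ gammaHeight k ∧ gammaHeight k ≤ 312135 / 100000 := by
  obtain ⟨h1, h2⟩ := gammaHeight_mem (k := k) (by omega)
  have hQ : 0 < q ^ (2 * k - 1) := pow_pos q_pos _
  have hQ1 : q ^ (2 * k - 1) ≤ 5 / 1000000 :=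
    (q_pow_le (show 7 ≤ 2 * k - 1 by omega)).trans
      ((pow_le_pow_left₀ q_pos.le q_ub.le 7).trans (by norm_num))
  have s0 := sqrt_two_lb
  have s1 := sqrt_two_ub
  have e : 3 / √2 = 3 / 2 * √2 := by
    rw [div_eq_iff (by linarith)]
    linarith [sqrt_two_mul]
  rw [e] at h1 h2
  constructor <;> nlinarith

lemma gammaHeight_notMem_lagrangeSpectrum {k : ℕ} (hk : 4 ≤ k) :
    gammaHeight k ∉ lagrangeSpectrum := by
  intro hmem
  obtain ⟨ε, hε0, hε1, hε2⟩ : ∃ ε : ℝ, 0 < ε ∧ ε ≤ q ^ (6 * (2 * k - 1) + 40) ∧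
      ε < gammaHeight k - omegaHeight k := by
    have h1 : 0 < q ^ (6 * (2 * k - 1) + 40) := pow_pos q_pos _
    have h2 := omegaHeight_lt_gammaHeight (k := k) (by omega)
    refine ⟨min (q ^ (6 * (2 * k - 1) + 40)) ((gammaHeight k - omegaHeight k) / 2),
      lt_min h1 (by linarith), min_le_left _ _, (min_le_right _ _).trans_lt (by linarith)⟩
  obtain ⟨_, ⟨θ, ⟨p, hp, hper⟩, rfl⟩, hdist⟩ := Metric.mem_closure_iff.mp hmem ε hε0
  rw [Real.dist_eq] at hdist
  obtain ⟨d1, d2⟩ := abs_lt.mp hdist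
  obtain ⟨hle, i, hi⟩ := exists_lam_eq_markovValue hp hper
  have hε3 : ε ≤ 1 / 100000 := by
    refine hε1.trans ((q_pow_le (show 8 ≤ 6 * (2 * k - 1) + 40 by omega)).trans ?_)
    exact (pow_le_pow_left₀ q_pos.le q_ub.le 8).trans (by norm_num)
  obtain ⟨g1, g2⟩ := gammaHeight_near hk
  have hdig := oneTwo_of_lam_le (θ := θ) (fun t => (hle t).trans (by linarith))
  obtain ⟨a, b, ha, hb, h | h⟩ := readsAt_or_reflect_of_height_near hdig (i := i) (by linarith)
    (by linarith)
  · exact false_of_readsAt hk hε0.le hε1 hε2 hp hper (fun t => (hle t).trans (by linarith))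
      (by linarith) ha hb h
  · exact false_of_readsAt hk hε0.le hε1 hε2 hp (reflect_periodic hper)
      (fun t => by rw [lam_reflect]; exact (hle _).trans (by linarith))
      (by rw [lam_reflect, neg_neg]; linarith) ha hb h

lemma markovValue_thetaOmega_mem {k : ℕ} (hk : 1 ≤ k) :
    ∃ θ : ℤ → ℕ+, (∃ p : ℤ, 0 < p ∧ Function.Periodic θ p) ∧
      markovValue θ = markovValue (thetaOmega k) :=
  ⟨thetaOmega k, ⟨_, by rw [length_omega k hk]; positivity, thetaOmega_periodic k⟩, rfl⟩

lemma limit_mem_lagrangeSpectrum : 1 + 3 / √2 ∈ lagrangeSpectrum :=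
  mem_closure_of_tendsto tendsto_markovValue_thetaOmega
    ((eventually_ge_atTop 1).mono fun _ hk => markovValue_thetaOmega_mem hk)

lemma markovValue_gammaOne_mem {k : ℕ} (hk : 4 ≤ k) :
    markovValue (gammaOne k) ∈ markovSpectrum \ lagrangeSpectrum := by
  obtain ⟨h1, h2⟩ := markovValue_gammaOne (k := k) (by omega)
  refine ⟨⟨_, h1, rfl⟩, ?_⟩
  rw [h2]
  exact gammaHeight_notMem_lagrangeSpectrum hk

lemma tendsto_markovValue_gammaOne :
    Tendsto (fun k : ℕ => markovValue (gammaOne k)) atTop (𝓝 (1 + 3 / √2)) := by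
  refine tendsto_of_tendsto_of_tendsto_of_le_of_le' tendsto_markovValue_thetaOmega
    (tendsto_markovValue_thetaOmega.comp (tendsto_sub_atTop_nat 1)) ?_ ?_
  · filter_upwards [eventually_ge_atTop 3] with k hk
    exact (markovValue_thetaOmega_lt_gammaOne hk).le
  · filter_upwards [eventually_ge_atTop 3] with k hk
    exact (markovValue_gammaOne_lt_thetaOmega hk).le

lemma limit_mem_closure : 1 + 3 / √2 ∈ closure (markovSpectrum \ lagrangeSpectrum) :=
  mem_closure_of_tendsto tendsto_markovValue_gammaOne
    ((eventually_ge_atTop 4).mono fun _ hk => markovValue_gammaOne_mem hk)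

end

end MarkovLagrange

theorem theorem1p1 :
    (∀ k : ℕ, 3 ≤ k →
      MarkovLagrange.markovValue (MarkovLagrange.thetaOmega k)
          < MarkovLagrange.markovValue (MarkovLagrange.gammaOne k) ∧
        MarkovLagrange.markovValue (MarkovLagrange.gammaOne k)
          < MarkovLagrange.markovValue (MarkovLagrange.thetaOmega (k - 1))) ∧
    Tendsto (fun k : ℕ => MarkovLagrange.markovValue (MarkovLagrange.thetaOmega k)) atTop
      (𝓝 (1 + 3 / Real.sqrt 2)) ∧
    1 + 3 / Real.sqrt 2 ∈ MarkovLagrange.lagrangeSpectrum ∧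
    (∀ k : ℕ, 4 ≤ k →
      MarkovLagrange.markovValue (MarkovLagrange.gammaOne k) ∈
        MarkovLagrange.markovSpectrum \ MarkovLagrange.lagrangeSpectrum) ∧
    1 + 3 / Real.sqrt 2 ∈
      MarkovLagrange.lagrangeSpectrum ∩
        closure (MarkovLagrange.markovSpectrum \ MarkovLagrange.lagrangeSpectrum) ∧
    ¬ IsClosed (MarkovLagrange.markovSpectrum \ MarkovLagrange.lagrangeSpectrum) := by
  open MarkovLagrange in
  exact ⟨fun k hk => ⟨markovValue_thetaOmega_lt_gammaOne hk, markovValue_gammaOne_lt_thetaOmega hk⟩,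
    tendsto_markovValue_thetaOmega, limit_mem_lagrangeSpectrum,
    fun k hk => markovValue_gammaOne_mem hk, ⟨limit_mem_lagrangeSpectrum, limit_mem_closure⟩,
    fun h => (h.closure_subset limit_mem_closure).2 limit_mem_lagrangeSpectrum⟩
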